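/- Conventions. Fix a commutative ring $\mathbb K$; modules, algebras and $\otimes$ are over $\mathbb K$, and gradings are by $\mathbb Z$. Fix $n\in\mathbb Z$ and write $|a|_n=|a|+n$ for homogeneous $a$. An $n$-graded *biderivation* in a graded algebra $C$ is a bilinear map $\{-,-\}$ on $C$ with $\{C^p,C^q\}\subset C^{p+q+n}$ such that for homogeneous $a,b,c$ $$\{a,bc\}=\{a,b\}c+(-1)^{|a|_n|b|}b\{a,c\},\quad \{ab,c\}=a\{b,c\}+(-1)^{|b||c|_n}\{a,c\}b,\quad \{a,b\}=-(-1)^{|a|_n|b|_n}\{b,a\}.$$ It is *Gerstenhaber* if $(-1)^{|a|_n|c|_n}\{a,\{b,c\}\}+(-1)^{|b|_n|a|_n}\{b,\{c,a\}\}+(-1)^{|c|_n|b|_n}\{c,\{a,b\}\}=0$ for all homogeneous $a,b,c$. Let $A$ be a unital graded algebra. Let $P_{21,n}$ and $P_{312,n}$ be the graded permutations $a\otimes b\mapsto(-1)^{|a|_n|b|_n}b\otimes a$ and $a\otimes b\otimes c\mapsto(-1)^{(|a|_n+|b|_n)|c|_n}c\otimes a\otimes b$, and let $P_{21}=P_{21,0}$,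 $P_{312}=P_{312,0}$. An $n$-graded *double bracket* in $A$ is a linear map $\{\!\!\{-,-\}\!\!\}:A\otimes A\to A\otimes A$ with $\{\!\!\{A^p,A^q\}\!\!\}\subset\bigoplus_{i+j=p+q+n}A^i\otimes A^j$, $\{\!\!\{-,-\}\!\!\}P_{21,n}=-P_{21}\{\!\!\{-,-\}\!\!\}$, and, for homogeneous $a,b,c$, $$\{\!\!\{a,bc\}\!\!\}=\{\!\!\{a,b\}\!\!\}c+(-1)^{|a|_n|b|}b\{\!\!\{a,c\}\!\!\},\qquad \{\!\!\{ab,c\}\!\!\}=a*\{\!\!\{b,c\}\!\!\}+(-1)^{|b||c|_n}\{\!\!\{a,c\}\!\!\}*b,$$ where $a(x\otimes y)b=ax\otimes yb$ and $a*(x\otimes y)*b=(-1)^{|a||xb|+|b||y|}xb\otimes ay$. It is *Gerstenhaber* if $\sum_{i=0}^{2}P_{312}^{i}(\{\!\!\{-,-\}\!\!\}\otimes\mathrm{id})(\mathrm{id}\otimes\{\!\!\{-,-\}\!\!\})P_{312,n}^{-i}=0$. Let $M$ be a coassociative counital coalgebra with counit $\varepsilon$; write $\alpha^1\otimes\alpha^2$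 and $\alpha^1\otimes\alpha^2\otimes\alpha^3$ for the iterated comultiplications of $\alpha\in M$. A linear map $v:M\otimes M\to\mathbb K$ is *cyclic* if $v(\alpha\otimes\beta^2)\,\beta^1\otimes\beta^3=v(\beta\otimes\alpha^2)\,\alpha^3\otimes\alpha^1$ for all $\alpha,\beta\in M$. The unital representation algebra $A_M^+$ is the unital graded algebra generated by symbols $a_\alpha$ ($a\in A$, $\alpha\in M$), bilinear in $(a,\alpha)$ and of degree $|a|$, subject to $(ab)_\alpha=a_{\alpha^1}b_{\alpha^2}$, $(1_A)_\alpha=\varepsilon(\alpha)1$, and $a_\alpha b_\beta=(-1)^{|a||b|}b_\beta a_\alpha$ for homogeneous $a,b$. A homomorphism $p:A\to B$ of unital graded algebras induces $p_M^+:A_M^+\to B_M^+$, $a_\alpha\mapsto p(a)_\alpha$. Each $\varphi\in M^*=\operatorname{Hom}_{\mathbb K}(M,\mathbb K)$ determines a derivation $\delta_\varphi$ of $A_M^+$ with $\delta_\varphi(a_\alpha)=a_{\varphi(\alpha^2)\alpha^1-\varphi(\alpha^1)\alpha^2}$. Let $E=\{x\in A_M^+ : \delta_\varphi(x)=0\text{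 for all }\varphi\in M^*\}$, a graded subalgebra of $A_M^+$. **Theorem (Hamiltonian reduction).** Let $\{\!\!\{-,-\}\!\!\}$ be an $n$-graded double bracket in a unital graded algebra $A$ and let $v$ be a cyclic bilinear form on a counital coalgebra $M$. Let $B$ be a graded algebra and $p:A\to B$ a surjective graded algebra homomorphism (so that $B$ is unital with unit $p(1_A)$) whose kernel is generated, as a two-sided ideal of $A$, by a set $\mathcal M\subset A^{-n}$ such that for every $\xi\in\mathcal M$ there is $k_\xi\in\mathbb K$ with $$\{\!\!\{\xi,a\}\!\!\}\equiv k_\xi(a\otimes1_A-1_A\otimes a)\ \bmod\ (A\otimes\operatorname{Ker}p+\operatorname{Ker}p\otimes A)\qquad\text{for all }a\in A.$$ Then: 1. There is a unique $n$-graded biderivation $\{-,-\}_v^+$ in $A_M^+$ such that, for all $a,b\in A$ and $\alpha,\beta\in M$, $$\{a_\alpha,b_\beta\}_v^+=v(\alpha\otimes\beta^2)\,\{\!\!\{a,b\}\!\!\}'_{\beta^1}\,\{\!\!\{a,b\}\!\!\}''_{\beta^3},$$ where $\{\!\!\{a,b\}\!\!\}=\{\!\!\{a,b\}\!\!\}'\otimes\{\!\!\{a,b\}\!\!\}''$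 with summation suppressed; and $\{E,E\}_v^+\subset E$. 2. $p_M^+(E)$ is a graded subalgebra of $B_M^+$, and the bracket $\{-,-\}_v^+$ in $E$ descends along $p_M^+$ to a unique bracket $\{-,-\}$ in $p_M^+(E)$, that is, to a unique bilinear map with $\{p_M^+(x),p_M^+(y)\}=p_M^+(\{x,y\}_v^+)$ for $x,y\in E$; this bracket is an $n$-graded biderivation. 3. If $\{\!\!\{-,-\}\!\!\}$ is Gerstenhaber, then so is $\{-,-\}$. -/

import Mathlib

open scoped TensorProduct DirectSum

universe u v w

noncomputable section

/-! ## Graded signs and graded permutations -/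

section GradedModules

variable {K : Type u} [CommRing K] {A : Type v} [Ring A] [Algebra K A]

/-- The linear endomorphism `a ↦ (-1) ^ (k * |a|) a` (for homogeneous `a`) of a graded algebra. -/
def signTwist (𝒜 : ℤ → Submodule K A) [GradedAlgebra 𝒜] (k : ℤ) : A →ₗ[K] A :=
  DirectSum.toModule K ℤ A (fun p => ((k * p).negOnePow : ℤ) • (𝒜 p).subtype) ∘ₗ
    (DirectSum.decomposeLinearEquiv 𝒜).toLinearMap

theorem signTwist_apply (𝒜 : ℤ → Submodule K A) [GradedAlgebra 𝒜] (k p : ℤ) {a : A}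
    (ha : a ∈ 𝒜 p) : signTwist 𝒜 k a = ((k * p).negOnePow : ℤ) • a := by
  lift a to 𝒜 p using ha
  simp [signTwist]

/-- The `n`-graded flip `P_{21,n}`:
`a ⊗ b ↦ (-1) ^ ((|a| + n) * (|b| + n)) b ⊗ a` for homogeneous `a`, `b`. -/
def gradedFlip (𝒜 : ℤ → Submodule K A) [GradedAlgebra 𝒜] (n : ℤ) : A ⊗[K] A →ₗ[K] A ⊗[K] A :=
  TensorProduct.lift
    (DirectSum.toModule K ℤ (A →ₗ[K] A ⊗[K] A)
        (fun p => (((p + n) * n).negOnePow : ℤ) •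
          ((LinearMap.lcomp K (A ⊗[K] A) (signTwist 𝒜 (p + n))) ∘ₗ
            (TensorProduct.mk K A A).flip ∘ₗ (𝒜 p).subtype)) ∘ₗ
      (DirectSum.decomposeLinearEquiv 𝒜).toLinearMap)

theorem gradedFlip_tmul (𝒜 : ℤ → Submodule K A) [GradedAlgebra 𝒜] (n p q : ℤ) {a b : A}
    (ha : a ∈ 𝒜 p) (hb : b ∈ 𝒜 q) :
    gradedFlip 𝒜 n (a ⊗ₜ[K] b) = (((p + n) * (q + n)).negOnePow : ℤ) • (b ⊗ₜ[K] a) := by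
  have h := signTwist_apply 𝒜 (p + n) q hb
  lift a to 𝒜 p using ha
  simp only [gradedFlip, TensorProduct.lift.tmul, LinearMap.comp_apply, LinearEquiv.coe_coe,
    DirectSum.decomposeLinearEquiv_apply, DirectSum.decompose_coe, ← DirectSum.lof_eq_of K,
    DirectSum.toModule_lof, LinearMap.smul_apply, LinearMap.lcomp_apply, h,
    LinearMap.flip_apply, TensorProduct.mk_apply, Submodule.subtype_apply, map_zsmul,
    TensorProduct.smul_tmul', smul_smul]
  rw [← Units.val_mul, ← Int.negOnePow_add,
    show (p + n) * n + (p + n) * q = (p + n) * (q + n) by ring]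

/-- The `n`-graded cyclic permutation `P_{312,n}` of `A ⊗ A ⊗ A`:
`a ⊗ b ⊗ c ↦ (-1) ^ ((|a|_n + |b|_n) |c|_n) c ⊗ a ⊗ b`. -/
def gradedPerm312 (𝒜 : ℤ → Submodule K A) [GradedAlgebra 𝒜] (n : ℤ) :
    A ⊗[K] (A ⊗[K] A) →ₗ[K] A ⊗[K] (A ⊗[K] A) :=
  (TensorProduct.assoc K A A A).toLinearMap ∘ₗ (gradedFlip 𝒜 n).rTensor A ∘ₗ
    (TensorProduct.assoc K A A A).symm.toLinearMap ∘ₗ (gradedFlip 𝒜 n).lTensor A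

theorem gradedPerm312_tmul (𝒜 : ℤ → Submodule K A) [GradedAlgebra 𝒜] (n p q r : ℤ) {a b c : A}
    (ha : a ∈ 𝒜 p) (hb : b ∈ 𝒜 q) (hc : c ∈ 𝒜 r) :
    gradedPerm312 𝒜 n (a ⊗ₜ[K] (b ⊗ₜ[K] c)) =
      ((((p + n) + (q + n)) * (r + n)).negOnePow : ℤ) • (c ⊗ₜ[K] (a ⊗ₜ[K] b)) := by
  have e : (((p + n) + (q + n)) * (r + n)).negOnePow =
      ((q + n) * (r + n)).negOnePow * ((p + n) * (r + n)).negOnePow := by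
    rw [← Int.negOnePow_add]; congr 1; ring
  rw [e]
  have h1 := gradedFlip_tmul 𝒜 n q r hb hc
  have h2 := gradedFlip_tmul 𝒜 n p r ha hc
  rcases Int.units_eq_one_or ((q + n) * (r + n)).negOnePow with h | h <;>
    rcases Int.units_eq_one_or ((p + n) * (r + n)).negOnePow with h' | h' <;>
    rw [h] at h1 ⊢ <;> rw [h'] at h2 ⊢ <;>
    simp [gradedPerm312, h1, h2, TensorProduct.tmul_neg, TensorProduct.neg_tmul]

/-- The `n`-graded cyclic permutation `P_{231,n}`, the inverse of `P_{312,n}`: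
`a ⊗ b ⊗ c ↦ (-1) ^ (|a|_n (|b|_n + |c|_n)) b ⊗ c ⊗ a`. -/
def gradedPerm231 (𝒜 : ℤ → Submodule K A) [GradedAlgebra 𝒜] (n : ℤ) :
    A ⊗[K] (A ⊗[K] A) →ₗ[K] A ⊗[K] (A ⊗[K] A) :=
  (gradedFlip 𝒜 n).lTensor A ∘ₗ (TensorProduct.assoc K A A A).toLinearMap ∘ₗ
    (gradedFlip 𝒜 n).rTensor A ∘ₗ (TensorProduct.assoc K A A A).symm.toLinearMap

theorem gradedPerm231_tmul (𝒜 : ℤ → Submodule K A) [GradedAlgebra 𝒜] (n p q r : ℤ) {a b c : A}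
    (ha : a ∈ 𝒜 p) (hb : b ∈ 𝒜 q) (hc : c ∈ 𝒜 r) :
    gradedPerm231 𝒜 n (a ⊗ₜ[K] (b ⊗ₜ[K] c)) =
      (((p + n) * ((q + n) + (r + n))).negOnePow : ℤ) • (b ⊗ₜ[K] (c ⊗ₜ[K] a)) := by
  have e : ((p + n) * ((q + n) + (r + n))).negOnePow =
      ((p + n) * (q + n)).negOnePow * ((p + n) * (r + n)).negOnePow := by
    rw [← Int.negOnePow_add]; congr 1; ring
  rw [e]
  have h1 := gradedFlip_tmul 𝒜 n p q ha hb
  have h2 := gradedFlip_tmul 𝒜 n p r ha hc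
  rcases Int.units_eq_one_or ((p + n) * (q + n)).negOnePow with h | h <;>
    rcases Int.units_eq_one_or ((p + n) * (r + n)).negOnePow with h' | h' <;>
    rw [h] at h1 ⊢ <;> rw [h'] at h2 ⊢ <;>
    simp [gradedPerm231, h1, h2, TensorProduct.tmul_neg, TensorProduct.neg_tmul]

/-- The degree `k` part `⨁_{i + j = k} A^i ⊗ A^j` of `A ⊗ A`. -/
def tensorDegree (𝒜 : ℤ → Submodule K A) (k : ℤ) : Submodule K (A ⊗[K] A) :=
  Submodule.span K {t | ∃ i j : ℤ, i + j = k ∧ ∃ x ∈ 𝒜 i, ∃ y ∈ 𝒜 j, t = x ⊗ₜ[K] y}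

/-- The grading induced on a subalgebra of a graded algebra. -/
def subalgebraGrading (𝒜 : ℤ → Submodule K A) (S : Subalgebra K A) (p : ℤ) : Submodule K S :=
  (𝒜 p).comap S.val.toLinearMap

/-! ## Brackets and double brackets -/

/-- `n`-graded biderivations in a (not necessarily commutative) graded algebra. -/
structure IsGradedBiderivation (𝒜 : ℤ → Submodule K A) (n : ℤ) (br : A →ₗ[K] A →ₗ[K] A) :
    Prop where
  graded : ∀ (p q : ℤ) (a b : A), a ∈ 𝒜 p → b ∈ 𝒜 q → br a b ∈ 𝒜 (p + q + n)
  leibniz_right : ∀ (p q r : ℤ) (a b c : A), a ∈ 𝒜 p → b ∈ 𝒜 q → c ∈ 𝒜 r →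
    br a (b * c) = br a b * c + (((p + n) * q).negOnePow : ℤ) • (b * br a c)
  leibniz_left : ∀ (p q r : ℤ) (a b c : A), a ∈ 𝒜 p → b ∈ 𝒜 q → c ∈ 𝒜 r →
    br (a * b) c = a * br b c + ((q * (r + n)).negOnePow : ℤ) • (br a c * b)
  antisymm : ∀ (p q : ℤ) (a b : A), a ∈ 𝒜 p → b ∈ 𝒜 q →
    br a b = -((((p + n) * (q + n)).negOnePow : ℤ) • br b a)

/-- An `n`-graded biderivation is Gerstenhaber if its Jacobi form vanishes. -/
structure IsGerstenhaber (𝒜 : ℤ → Submodule K A) (n : ℤ) (br : A →ₗ[K] A →ₗ[K] A) : Prop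
    extends IsGradedBiderivation 𝒜 n br where
  jacobi : ∀ (p q r : ℤ) (a b c : A), a ∈ 𝒜 p → b ∈ 𝒜 q → c ∈ 𝒜 r →
    (((p + n) * (r + n)).negOnePow : ℤ) • br a (br b c) +
      (((q + n) * (p + n)).negOnePow : ℤ) • br b (br c a) +
      (((r + n) * (q + n)).negOnePow : ℤ) • br c (br a b) = 0

/-- `n`-graded double brackets.  The outer bimodule structure on `A ⊗ A` is
`a (x ⊗ y) b = a x ⊗ y b`, the inner one is
`a * (x ⊗ y) * b = (-1) ^ (|a| |x b| + |b| |y|) x b ⊗ a y`. -/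
structure IsDoubleBracket (𝒜 : ℤ → Submodule K A) [GradedAlgebra 𝒜] (n : ℤ)
    (db : A ⊗[K] A →ₗ[K] A ⊗[K] A) : Prop where
  graded : ∀ (p q : ℤ) (a b : A), a ∈ 𝒜 p → b ∈ 𝒜 q →
    db (a ⊗ₜ[K] b) ∈ tensorDegree 𝒜 (p + q + n)
  antisymm : db ∘ₗ gradedFlip 𝒜 n = -(gradedFlip 𝒜 0 ∘ₗ db)
  leibniz_right : ∀ (p q r : ℤ) (a b c : A), a ∈ 𝒜 p → b ∈ 𝒜 q → c ∈ 𝒜 r →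
    db (a ⊗ₜ[K] (b * c)) = (LinearMap.mulRight K c).lTensor A (db (a ⊗ₜ[K] b)) +
      (((p + n) * q).negOnePow : ℤ) • (LinearMap.mulLeft K b).rTensor A (db (a ⊗ₜ[K] c))
  leibniz_left : ∀ (p q r : ℤ) (a b c : A), a ∈ 𝒜 p → b ∈ 𝒜 q → c ∈ 𝒜 r →
    db ((a * b) ⊗ₜ[K] c) =
      TensorProduct.map (signTwist 𝒜 p) (LinearMap.mulLeft K a) (db (b ⊗ₜ[K] c)) +
      ((q * (r + n)).negOnePow : ℤ) •
        TensorProduct.map (LinearMap.mulRight K b) (signTwist 𝒜 q) (db (a ⊗ₜ[K] c))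

/-- The linear map `({-,-} ⊗ id) (id ⊗ {-,-})` on `A ⊗ A ⊗ A`. -/
def doubleBracketIter (db : A ⊗[K] A →ₗ[K] A ⊗[K] A) :
    A ⊗[K] (A ⊗[K] A) →ₗ[K] A ⊗[K] (A ⊗[K] A) :=
  (TensorProduct.assoc K A A A).toLinearMap ∘ₗ db.rTensor A ∘ₗ
    (TensorProduct.assoc K A A A).symm.toLinearMap ∘ₗ db.lTensor A

/-- The induced tribracket
`∑_{i=0}^{2} P_{312}^i ({-,-} ⊗ id) (id ⊗ {-,-}) P_{312,n}^{-i}`, where `P_{312,n}^{-1}` is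
`P_{231,n}`. -/
def tribracket (𝒜 : ℤ → Submodule K A) [GradedAlgebra 𝒜] (n : ℤ)
    (db : A ⊗[K] A →ₗ[K] A ⊗[K] A) : A ⊗[K] (A ⊗[K] A) →ₗ[K] A ⊗[K] (A ⊗[K] A) :=
  ∑ i ∈ Finset.range 3,
    ((gradedPerm312 𝒜 0) ^ i) ∘ₗ doubleBracketIter db ∘ₗ ((gradedPerm231 𝒜 n) ^ i)

/-- `n`-graded double Gerstenhaber brackets. -/
structure IsDoubleGerstenhaber (𝒜 : ℤ → Submodule K A) [GradedAlgebra 𝒜] (n : ℤ)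
    (db : A ⊗[K] A →ₗ[K] A ⊗[K] A) : Prop extends IsDoubleBracket 𝒜 n db where
  tribracket_eq_zero : tribracket 𝒜 n db = 0

end GradedModules

/-! ## Coalgebras: cyclic forms and coderivations -/

section Coalgebras

variable {K : Type u} [CommRing K] {M : Type w} [AddCommGroup M] [Module K M] [Coalgebra K M]

/-- The map `α ⊗ β ↦ v (α ⊗ β²) β¹ ⊗ β³`. -/
def hatMap (v : M ⊗[K] M →ₗ[K] K) : M ⊗[K] M →ₗ[K] M ⊗[K] M :=
  ((TensorProduct.lid K M).toLinearMap ∘ₗ v.rTensor M ∘ₗ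
      (TensorProduct.assoc K M M M).symm.toLinearMap).lTensor M ∘ₗ
    (TensorProduct.leftComm K M M (M ⊗[K] M)).toLinearMap ∘ₗ
    (((Coalgebra.comul (R := K) (A := M)).lTensor M) ∘ₗ
      (Coalgebra.comul (R := K) (A := M))).lTensor M

/-- A bilinear form `v` on `M` is cyclic if `hatMap v` commutes with the flip of `M ⊗ M`. -/
def IsCyclicForm (v : M ⊗[K] M →ₗ[K] K) : Prop :=
  hatMap v ∘ₗ (TensorProduct.comm K M M).toLinearMap =
    (TensorProduct.comm K M M).toLinearMap ∘ₗ hatMap v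

/-- Coderivations of a coalgebra. -/
def IsCoderivation (d : M →ₗ[K] M) : Prop :=
  Coalgebra.comul (R := K) (A := M) ∘ₗ d =
    (d.rTensor M + d.lTensor M) ∘ₗ Coalgebra.comul (R := K) (A := M)

theorem IsCoderivation.counit_comp {d : M →ₗ[K] M} (hd : IsCoderivation d) (x : M) :
    Coalgebra.counit (R := K) (d x) = 0 := by
  have h := LinearMap.congr_fun hd x
  simp only [LinearMap.comp_apply, LinearMap.add_apply] at h
  let ε : M →ₗ[K] K := Coalgebra.counit
  have h1 : ∀ y : M, (TensorProduct.lid K K) (TensorProduct.map ε ε (Coalgebra.comul y)) = ε y := by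
    intro y
    have e : TensorProduct.map ε ε = ε.lTensor K ∘ₗ ε.rTensor M := by
      ext; simp
    rw [e, LinearMap.comp_apply, Coalgebra.rTensor_counit_comul]
    simp
  have h2 : (TensorProduct.lid K K) (TensorProduct.map ε ε (d.rTensor M (Coalgebra.comul x))) =
      ε (d x) := by
    have e : TensorProduct.map ε ε ∘ₗ d.rTensor M = (ε ∘ₗ d).rTensor K ∘ₗ ε.lTensor M := by
      ext; simp
    rw [← LinearMap.comp_apply, e, LinearMap.comp_apply, Coalgebra.lTensor_counit_comul]
    simp
  have h3 : (TensorProduct.lid K K) (TensorProduct.map ε ε (d.lTensor M (Coalgebra.comul x))) =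
      ε (d x) := by
    have e : TensorProduct.map ε ε ∘ₗ d.lTensor M = (ε ∘ₗ d).lTensor K ∘ₗ ε.rTensor M := by
      ext; simp
    rw [← LinearMap.comp_apply, e, LinearMap.comp_apply, Coalgebra.rTensor_counit_comul]
    simp
  have h4 := h1 (d x)
  rw [h, map_add, map_add, h2, h3] at h4
  simpa using h4

/-- The inner coderivation `α ↦ φ (α²) α¹ - φ (α¹) α²`. -/
def innerCoder (φ : M →ₗ[K] K) : M →ₗ[K] M :=
  (TensorProduct.rid K M).toLinearMap ∘ₗ φ.lTensor M ∘ₗ Coalgebra.comul (R := K) (A := M) -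
    (TensorProduct.lid K M).toLinearMap ∘ₗ φ.rTensor M ∘ₗ Coalgebra.comul (R := K) (A := M)

theorem isCoderivation_innerCoder (φ : M →ₗ[K] K) : IsCoderivation (innerCoder φ) := by
  have hco (x : M) := Coalgebra.coassoc_apply (R := K) x
  have hr : Coalgebra.comul (R := K) (A := M) ∘ₗ ((TensorProduct.rid K M).toLinearMap ∘ₗ
      φ.lTensor M ∘ₗ Coalgebra.comul) = ((TensorProduct.rid K M).toLinearMap ∘ₗ
      φ.lTensor M ∘ₗ Coalgebra.comul).lTensor M ∘ₗ Coalgebra.comul := by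
    have e1 : Coalgebra.comul (R := K) (A := M) ∘ₗ (TensorProduct.rid K M).toLinearMap ∘ₗ
        φ.lTensor M = ((TensorProduct.rid K M).toLinearMap ∘ₗ φ.lTensor M).lTensor M ∘ₗ
          (TensorProduct.assoc K M M M).toLinearMap ∘ₗ (Coalgebra.comul).rTensor M := by
      ext x y
      simp only [TensorProduct.AlgebraTensorModule.curry_apply, LinearMap.restrictScalars_self,
        TensorProduct.curry_apply, LinearMap.comp_apply, LinearMap.lTensor_tmul,
        LinearMap.rTensor_tmul, LinearEquiv.coe_coe, TensorProduct.rid_tmul, map_smul]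
      generalize Coalgebra.comul (R := K) x = t
      induction t with
      | zero => simp
      | tmul a b => simp
      | add a b ha hb => simp only [smul_add, TensorProduct.add_tmul, map_add, ha, hb]
    ext x
    have := LinearMap.congr_fun e1 (Coalgebra.comul x)
    simp only [LinearMap.comp_apply, LinearEquiv.coe_coe, hco] at this ⊢
    rw [this]
    simp only [LinearMap.lTensor_comp, LinearMap.comp_apply]
  have hl : Coalgebra.comul (R := K) (A := M) ∘ₗ ((TensorProduct.lid K M).toLinearMap ∘ₗ
      φ.rTensor M ∘ₗ Coalgebra.comul) = ((TensorProduct.lid K M).toLinearMap ∘ₗ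
      φ.rTensor M ∘ₗ Coalgebra.comul).rTensor M ∘ₗ Coalgebra.comul := by
    have e1 : Coalgebra.comul (R := K) (A := M) ∘ₗ (TensorProduct.lid K M).toLinearMap ∘ₗ
        φ.rTensor M = ((TensorProduct.lid K M).toLinearMap ∘ₗ φ.rTensor M).rTensor M ∘ₗ
          (TensorProduct.assoc K M M M).symm.toLinearMap ∘ₗ (Coalgebra.comul).lTensor M := by
      ext x y
      simp only [TensorProduct.AlgebraTensorModule.curry_apply, LinearMap.restrictScalars_self,
        TensorProduct.curry_apply, LinearMap.comp_apply, LinearMap.lTensor_tmul,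
        LinearMap.rTensor_tmul, LinearEquiv.coe_coe, TensorProduct.lid_tmul, map_smul]
      generalize Coalgebra.comul (R := K) y = t
      induction t with
      | zero => simp
      | tmul a b => simp [TensorProduct.smul_tmul']
      | add a b ha hb => simp only [smul_add, TensorProduct.tmul_add, map_add, ha, hb]
    ext x
    have := LinearMap.congr_fun e1 (Coalgebra.comul x)
    simp only [LinearMap.comp_apply, LinearEquiv.coe_coe, ← hco,
      LinearEquiv.symm_apply_apply] at this ⊢
    rw [this]
    simp only [LinearMap.rTensor_comp, LinearMap.comp_apply]
  have hm : ((TensorProduct.rid K M).toLinearMap ∘ₗ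
      φ.lTensor M ∘ₗ Coalgebra.comul).rTensor M ∘ₗ Coalgebra.comul =
      ((TensorProduct.lid K M).toLinearMap ∘ₗ
      φ.rTensor M ∘ₗ Coalgebra.comul).lTensor M ∘ₗ Coalgebra.comul := by
    have e1 : ((TensorProduct.lid K M).toLinearMap ∘ₗ φ.rTensor M).lTensor M ∘ₗ
        (TensorProduct.assoc K M M M).toLinearMap =
        ((TensorProduct.rid K M).toLinearMap ∘ₗ φ.lTensor M).rTensor M := by
      ext x y z
      simp [TensorProduct.smul_tmul]
    ext x
    have := LinearMap.congr_fun e1 ((Coalgebra.comul).rTensor M (Coalgebra.comul x))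
    simp only [LinearMap.comp_apply, LinearEquiv.coe_coe, hco] at this ⊢
    simp only [← LinearMap.comp_assoc, LinearMap.lTensor_comp, LinearMap.rTensor_comp,
      LinearMap.comp_apply] at this ⊢
    exact this.symm
  unfold IsCoderivation innerCoder
  rw [LinearMap.comp_sub, hr, hl, LinearMap.add_comp, LinearMap.rTensor_sub,
    LinearMap.lTensor_sub, LinearMap.sub_comp, LinearMap.sub_comp, hm]
  abel

end Coalgebras

/-! ## The unital representation algebra -/

section RepAlg

variable {K : Type u} [CommRing K] {A : Type v} [Ring A] [Algebra K A]

/-- For a linear map `f` from `A ⊗ M` to an algebra, the map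
`(a ⊗ b) ⊗ (α ⊗ β) ↦ f (a ⊗ α) f (b ⊗ β)`. -/
def pairEval {M : Type w} [AddCommGroup M] [Module K M] {R : Type*} [Ring R] [Algebra K R]
    (f : A ⊗[K] M →ₗ[K] R) : (A ⊗[K] A) ⊗[K] (M ⊗[K] M) →ₗ[K] R :=
  LinearMap.mul' K R ∘ₗ TensorProduct.map f f ∘ₗ
    (TensorProduct.tensorTensorTensorComm K A A M M).toLinearMap

@[simp]
theorem pairEval_tmul {M : Type w} [AddCommGroup M] [Module K M] {R : Type*} [Ring R] [Algebra K R]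
    (f : A ⊗[K] M →ₗ[K] R) (a b : A) (α β : M) :
    pairEval f ((a ⊗ₜ[K] b) ⊗ₜ[K] (α ⊗ₜ[K] β)) = f (a ⊗ₜ[K] α) * f (b ⊗ₜ[K] β) := by
  simp [pairEval]

theorem map_pairEval {M : Type w} [AddCommGroup M] [Module K M] {R S : Type*} [Ring R] [Algebra K R] [Ring S] [Algebra K S]
    (g : R →ₐ[K] S) (f : A ⊗[K] M →ₗ[K] R) (t : (A ⊗[K] A) ⊗[K] (M ⊗[K] M)) :
    g (pairEval f t) = pairEval (g.toLinearMap ∘ₗ f) t := by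
  have : g.toLinearMap ∘ₗ pairEval f = pairEval (g.toLinearMap ∘ₗ f) := by
    ext a b α β
    simp
  exact LinearMap.congr_fun this t

variable (𝒜 : ℤ → Submodule K A) (M : Type w) [AddCommGroup M] [Module K M] [Coalgebra K M]

/-- The defining relations, besides the bilinearity built into the tensor algebra of `A ⊗ M`. -/
inductive RepRel : TensorAlgebra K (A ⊗[K] M) → TensorAlgebra K (A ⊗[K] M) → Prop
  | mul (a b : A) (α : M) :
      RepRel (TensorAlgebra.ι K ((a * b) ⊗ₜ[K] α))
        (pairEval (TensorAlgebra.ι K) ((a ⊗ₜ[K] b) ⊗ₜ[K] Coalgebra.comul (R := K) α))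
  | one (α : M) :
      RepRel (TensorAlgebra.ι K ((1 : A) ⊗ₜ[K] α))
        (algebraMap K (TensorAlgebra K (A ⊗[K] M)) (Coalgebra.counit (R := K) α))
  | comm (p q : ℤ) (a b : A) (α β : M) (ha : a ∈ 𝒜 p) (hb : b ∈ 𝒜 q) :
      RepRel (TensorAlgebra.ι K (a ⊗ₜ[K] α) * TensorAlgebra.ι K (b ⊗ₜ[K] β))
        (((p * q).negOnePow : ℤ) •
          (TensorAlgebra.ι K (b ⊗ₜ[K] β) * TensorAlgebra.ι K (a ⊗ₜ[K] α)))

/-- The unital representation algebra `A_M^+`. -/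
def RepAlg : Type (max u v w) := RingQuot (RepRel 𝒜 M)

instance : Ring (RepAlg 𝒜 M) := inferInstanceAs (Ring (RingQuot (RepRel 𝒜 M)))
instance : Algebra K (RepAlg 𝒜 M) := inferInstanceAs (Algebra K (RingQuot (RepRel 𝒜 M)))

namespace RepAlg

/-- The generators `a_α` of `A_M^+`, as a linear map in `a ⊗ α`. -/
def gen : A ⊗[K] M →ₗ[K] RepAlg 𝒜 M :=
  (RingQuot.mkAlgHom K (RepRel 𝒜 M)).toLinearMap ∘ₗ TensorAlgebra.ι K

variable {M}

theorem gen_mul (a b : A) (α : M) :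
    gen 𝒜 M ((a * b) ⊗ₜ[K] α) =
      pairEval (gen 𝒜 M) ((a ⊗ₜ[K] b) ⊗ₜ[K] Coalgebra.comul (R := K) α) := by
  have h := RingQuot.mkAlgHom_rel K (RepRel.mul (𝒜 := 𝒜) a b α)
  rw [map_pairEval] at h
  exact h

theorem gen_one (α : M) :
    gen 𝒜 M ((1 : A) ⊗ₜ[K] α) = algebraMap K (RepAlg 𝒜 M) (Coalgebra.counit (R := K) α) := by
  have h := RingQuot.mkAlgHom_rel K (RepRel.one (𝒜 := 𝒜) α)
  rw [AlgHom.commutes] at h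
  exact h

theorem gen_comm {p q : ℤ} {a b : A} (ha : a ∈ 𝒜 p) (hb : b ∈ 𝒜 q) (α β : M) :
    gen 𝒜 M (a ⊗ₜ[K] α) * gen 𝒜 M (b ⊗ₜ[K] β) =
      ((p * q).negOnePow : ℤ) • (gen 𝒜 M (b ⊗ₜ[K] β) * gen 𝒜 M (a ⊗ₜ[K] α)) := by
  have h := RingQuot.mkAlgHom_rel K (RepRel.comm (𝒜 := 𝒜) p q a b α β ha hb)
  rw [map_mul, map_zsmul, map_mul] at h
  exact h

/-- The universal property of `A_M^+`. -/
def lift {R : Type*} [Ring R] [Algebra K R] (f : A ⊗[K] M →ₗ[K] R)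
    (hmul : ∀ (a b : A) (α : M), f ((a * b) ⊗ₜ[K] α) =
      pairEval f ((a ⊗ₜ[K] b) ⊗ₜ[K] Coalgebra.comul (R := K) α))
    (hone : ∀ α : M, f ((1 : A) ⊗ₜ[K] α) = algebraMap K R (Coalgebra.counit (R := K) α))
    (hcomm : ∀ (p q : ℤ) (a b : A) (α β : M), a ∈ 𝒜 p → b ∈ 𝒜 q →
      f (a ⊗ₜ[K] α) * f (b ⊗ₜ[K] β) =
        ((p * q).negOnePow : ℤ) • (f (b ⊗ₜ[K] β) * f (a ⊗ₜ[K] α))) :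
    RepAlg 𝒜 M →ₐ[K] R :=
  RingQuot.liftAlgHom K ⟨TensorAlgebra.lift K f, by
    intro x y h
    have e : (TensorAlgebra.lift K f).toLinearMap ∘ₗ TensorAlgebra.ι K = f := by
      ext; simp
    cases h with
    | mul a b α => rw [map_pairEval, e, TensorAlgebra.lift_ι_apply, hmul]
    | one α => rw [AlgHom.commutes, TensorAlgebra.lift_ι_apply, hone]
    | comm p q a b α β ha hb =>
      simp only [map_mul, map_zsmul, TensorAlgebra.lift_ι_apply]
      exact hcomm p q a b α β ha hb⟩

@[simp]
theorem lift_gen {R : Type*} [Ring R] [Algebra K R] (f : A ⊗[K] M →ₗ[K] R) (h1 h2 h3)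
    (t : A ⊗[K] M) : lift 𝒜 f h1 h2 h3 (gen 𝒜 M t) = f t := by
  have := RingQuot.liftAlgHom_mkAlgHom_apply K (s := RepRel 𝒜 M) (TensorAlgebra.lift K f)
    (fun x y h => by
      have e : (TensorAlgebra.lift K f).toLinearMap ∘ₗ TensorAlgebra.ι K = f := by
        ext; simp
      cases h with
      | mul a b α => rw [map_pairEval, e, TensorAlgebra.lift_ι_apply, h1]
      | one α => rw [AlgHom.commutes, TensorAlgebra.lift_ι_apply, h2]
      | comm p q a b α β ha hb =>
        simp only [map_mul, map_zsmul, TensorAlgebra.lift_ι_apply]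
        exact h3 p q a b α β ha hb) (TensorAlgebra.ι K t)
  rw [TensorAlgebra.lift_ι_apply] at this
  exact this

theorem algHom_ext {R : Type*} [Ring R] [Algebra K R] {f g : RepAlg 𝒜 M →ₐ[K] R}
    (h : ∀ (a : A) (α : M), f (gen 𝒜 M (a ⊗ₜ[K] α)) = g (gen 𝒜 M (a ⊗ₜ[K] α))) : f = g := by
  apply RingQuot.ringQuot_ext'
  apply TensorAlgebra.hom_ext
  ext a α
  exact h a α

variable (M)

/-- The degree `p` part of `A_M^+`: the span of the monomials `(a₁)_{α₁} ⋯ (a_k)_{α_k}` with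
homogeneous `a₁, …, a_k` whose degrees add up to `p`.  A factor `(|a|, a, α)` of a monomial is
recorded together with its degree. -/
def grading (p : ℤ) : Submodule K (RepAlg 𝒜 M) :=
  Submodule.span K {x | ∃ l : List (ℤ × A × M), (∀ t ∈ l, t.2.1 ∈ 𝒜 t.1) ∧
    (l.map (fun t => t.1)).sum = p ∧
    x = (l.map (fun t => gen 𝒜 M (t.2.1 ⊗ₜ[K] t.2.2))).prod}

variable {M}

theorem gen_mem_grading {p : ℤ} {a : A} (ha : a ∈ 𝒜 p) (α : M) :
    gen 𝒜 M (a ⊗ₜ[K] α) ∈ grading 𝒜 M p :=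
  Submodule.subset_span ⟨[(p, a, α)], by simpa using ha, by simp, by simp⟩

instance : SetLike.GradedMonoid (grading 𝒜 M) where
  one_mem := Submodule.subset_span ⟨[], by simp, by simp, by simp⟩
  mul_mem := by
    intro i j x y hx hy
    refine Submodule.span_induction₂ (p := fun x y _ _ => x * y ∈ grading 𝒜 M (i + j))
      ?_ ?_ ?_ ?_ ?_ ?_ ?_ hx hy
    · rintro x y ⟨l, h1, h2, rfl⟩ ⟨l', h1', h2', rfl⟩
      refine Submodule.subset_span ⟨l ++ l', ?_, by simp [h2, h2'], by simp⟩
      intro t ht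
      rcases List.mem_append.1 ht with ht | ht
      · exact h1 t ht
      · exact h1' t ht
    · intro y _; simp
    · intro y _; simp
    · intro x y z _ _ _ h h'; rw [add_mul]; exact add_mem h h'
    · intro x y z _ _ _ h h'; rw [mul_add]; exact add_mem h h'
    · intro r x y _ _ h; rw [smul_mul_assoc]; exact Submodule.smul_mem _ _ h
    · intro r x y _ _ h; rw [mul_smul_comm]; exact Submodule.smul_mem _ _ h

section Grading

variable [GradedAlgebra 𝒜]

/-- The map `a_α ↦ a_α` with values in the direct sum of the homogeneous parts. -/
def genGraded : A ⊗[K] M →ₗ[K] ⨁ i, grading 𝒜 M i :=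
  TensorProduct.lift
    (DirectSum.toModule K ℤ (M →ₗ[K] ⨁ i, grading 𝒜 M i)
        (fun p => LinearMap.mk₂ K
          (fun (a : 𝒜 p) (α : M) => DirectSum.lof K ℤ (fun i => grading 𝒜 M i) p
            ⟨gen 𝒜 M ((a : A) ⊗ₜ[K] α), gen_mem_grading 𝒜 a.2 α⟩)
          (fun a b α => by
            rw [← map_add]; congr 1; ext; simp [TensorProduct.add_tmul])
          (fun c a α => by
            rw [← map_smul]; congr 1; ext
            simp [← TensorProduct.smul_tmul'])
          (fun a α β => by
            rw [← map_add]; congr 1; ext; simp [TensorProduct.tmul_add])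
          (fun c a α => by
            rw [← map_smul]; congr 1; ext; simp)) ∘ₗ
      (DirectSum.decomposeLinearEquiv 𝒜).toLinearMap)

theorem genGraded_tmul {p : ℤ} {a : A} (ha : a ∈ 𝒜 p) (α : M) :
    genGraded 𝒜 (a ⊗ₜ[K] α) = DirectSum.of (fun i => grading 𝒜 M i) p
      ⟨gen 𝒜 M (a ⊗ₜ[K] α), gen_mem_grading 𝒜 ha α⟩ := by
  lift a to 𝒜 p using ha
  simp only [genGraded, TensorProduct.lift.tmul, LinearMap.comp_apply, LinearEquiv.coe_coe,
    DirectSum.decomposeLinearEquiv_apply, DirectSum.decompose_coe, ← DirectSum.lof_eq_of K,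
    DirectSum.toModule_lof, LinearMap.mk₂_apply]

theorem pairEval_genGraded {p q : ℤ} {a b : A} (ha : a ∈ 𝒜 p) (hb : b ∈ 𝒜 q)
    (t : M ⊗[K] M) (x : grading 𝒜 M (p + q))
    (hx : (x : RepAlg 𝒜 M) = pairEval (gen 𝒜 M) ((a ⊗ₜ[K] b) ⊗ₜ[K] t)) :
    pairEval (genGraded 𝒜) ((a ⊗ₜ[K] b) ⊗ₜ[K] t) =
      DirectSum.of (fun i => grading 𝒜 M i) (p + q) x := by
  induction t generalizing x with
  | zero =>
    have : x = 0 := by ext; simpa using hx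
    simp [this]
  | tmul α β =>
    rw [pairEval_tmul, genGraded_tmul 𝒜 ha, genGraded_tmul 𝒜 hb, DirectSum.of_mul_of]
    congr 1
    ext
    rw [hx, pairEval_tmul]
    rfl
  | add s t hs ht =>
    have key : ∀ u : M ⊗[K] M,
        pairEval (gen 𝒜 M) ((a ⊗ₜ[K] b) ⊗ₜ[K] u) ∈ grading 𝒜 M (p + q) := by
      intro u
      induction u with
      | zero => simp
      | tmul α β =>
        rw [pairEval_tmul]
        exact SetLike.mul_mem_graded (gen_mem_grading 𝒜 ha α) (gen_mem_grading 𝒜 hb β)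
      | add u u' h h' => rw [TensorProduct.tmul_add, map_add]; exact add_mem h h'
    rw [TensorProduct.tmul_add, map_add, hs ⟨_, key s⟩ rfl, ht ⟨_, key t⟩ rfl, ← map_add]
    congr 1
    ext
    rw [hx, TensorProduct.tmul_add, map_add]
    rfl

theorem genGraded_mul (a b : A) (α : M) : genGraded 𝒜 ((a * b) ⊗ₜ[K] α) =
    pairEval (genGraded 𝒜) ((a ⊗ₜ[K] b) ⊗ₜ[K] Coalgebra.comul (R := K) α) := by
  induction a using DirectSum.Decomposition.inductionOn 𝒜 with
  | zero => simp
  | add a a' h h' =>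
    simp only [add_mul, TensorProduct.add_tmul, map_add, h, h']
  | homogeneous a =>
    induction b using DirectSum.Decomposition.inductionOn 𝒜 with
    | zero => simp
    | add b b' h h' =>
      simp only [mul_add, TensorProduct.add_tmul, TensorProduct.tmul_add, map_add, h, h']
    | homogeneous b =>
      rw [genGraded_tmul 𝒜 (SetLike.mul_mem_graded a.2 b.2)]
      exact (pairEval_genGraded 𝒜 a.2 b.2 _ _ (gen_mul 𝒜 _ _ _)).symm

theorem genGraded_one (α : M) : genGraded 𝒜 ((1 : A) ⊗ₜ[K] α) =
    algebraMap K (⨁ i, grading 𝒜 M i) (Coalgebra.counit (R := K) α) := by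
  rw [genGraded_tmul 𝒜 SetLike.GradedOne.one_mem, DirectSum.algebraMap_apply]
  congr 1
  ext
  exact gen_one 𝒜 α

theorem genGraded_comm (p q : ℤ) (a b : A) (α β : M) (ha : a ∈ 𝒜 p) (hb : b ∈ 𝒜 q) :
    genGraded 𝒜 (a ⊗ₜ[K] α) * genGraded 𝒜 (b ⊗ₜ[K] β) =
      ((p * q).negOnePow : ℤ) • (genGraded 𝒜 (b ⊗ₜ[K] β) * genGraded 𝒜 (a ⊗ₜ[K] α)) := by
  rw [genGraded_tmul 𝒜 ha, genGraded_tmul 𝒜 hb, DirectSum.of_mul_of, DirectSum.of_mul_of]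
  refine Eq.trans ?_ (map_zsmul (DirectSum.of (fun i => grading 𝒜 M i) (q + p)) _ _)
  apply DirectSum.of_eq_of_gradedMonoid_eq
  refine Sigma.subtype_ext (add_comm p q) ?_
  exact gen_comm 𝒜 ha hb α β

/-- The decomposition of `A_M^+` into homogeneous parts. -/
def decomposeHom : RepAlg 𝒜 M →ₐ[K] ⨁ i, grading 𝒜 M i :=
  @lift K _ A _ _ 𝒜 M _ _ _ (⨁ i, grading 𝒜 M i) _
    (DirectSum.instAlgebra K fun i => ↥(grading 𝒜 M i)) (genGraded 𝒜) (genGraded_mul 𝒜)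
    (genGraded_one 𝒜) (genGraded_comm 𝒜)

theorem decomposeHom_gen (t : A ⊗[K] M) : decomposeHom 𝒜 (gen 𝒜 M t) = genGraded 𝒜 t := by
  have := @lift_gen K _ A _ _ 𝒜 M _ _ _ (⨁ i, grading 𝒜 M i) _
    (DirectSum.instAlgebra K fun i => ↥(grading 𝒜 M i)) (genGraded 𝒜) (genGraded_mul 𝒜)
    (genGraded_one 𝒜) (genGraded_comm 𝒜) t
  exact this

theorem decomposeHom_nil (x : RepAlg 𝒜 M) (hx : x = 1) (h) : decomposeHom 𝒜 x =
      DirectSum.of (fun i => grading 𝒜 M i) 0 ⟨x, h⟩ := by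
  subst hx
  rw [map_one]
  rfl

theorem decomposeHom_cons (p q : ℤ) (x y : RepAlg 𝒜 M) (hx : x ∈ grading 𝒜 M p) 
   (hy : y ∈ grading 𝒜 M q) (hx' : decomposeHom 𝒜 x =
      DirectSum.of (fun i => grading 𝒜 M i) p ⟨x, hx⟩) (hy' : decomposeHom 𝒜 y =
      DirectSum.of (fun i => grading 𝒜 M i) q ⟨y, hy⟩) (h : x * y ∈ grading 𝒜 M (p + q)) : 
    decomposeHom 𝒜 (x * y) =
      DirectSum.of (fun i => grading 𝒜 M i) (p + q) ⟨x * y, h⟩ := by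
  rw [map_mul, hx', hy', DirectSum.of_mul_of]
  rfl

theorem decomposeHom_prod (l : List (ℤ × A × M)) (h1 : ∀ t ∈ l, t.2.1 ∈ 𝒜 t.1) 
    (h : (l.map (fun t => gen 𝒜 M (t.2.1 ⊗ₜ[K] t.2.2))).prod ∈
      grading 𝒜 M (l.map (fun t => t.1)).sum) :
    decomposeHom 𝒜 (l.map (fun t => gen 𝒜 M (t.2.1 ⊗ₜ[K] t.2.2))).prod =
      DirectSum.of (fun i => grading 𝒜 M i) (l.map (fun t => t.1)).sum ⟨_, h⟩ := by
  induction l with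
  | nil => exact decomposeHom_nil 𝒜 _ rfl h
  | cons t l ih =>
    have h1' : ∀ s ∈ l, s.2.1 ∈ 𝒜 s.1 := fun s hs => h1 s (List.mem_cons_of_mem _ hs)
    have hl : (l.map (fun t => gen 𝒜 M (t.2.1 ⊗ₜ[K] t.2.2))).prod ∈
        grading 𝒜 M (l.map (fun t => t.1)).sum := Submodule.subset_span ⟨l, h1', rfl, rfl⟩
    have ht := h1 t List.mem_cons_self
    have h2 := decomposeHom_gen 𝒜 (t.2.1 ⊗ₜ[K] t.2.2)
    rw [genGraded_tmul 𝒜 ht] at h2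
    exact decomposeHom_cons 𝒜 t.1 _ _ _ (gen_mem_grading 𝒜 ht t.2.2) hl h2 (ih h1' hl) h

theorem decomposeHom_of_mem {p : ℤ} (x : RepAlg 𝒜 M) (hx : x ∈ grading 𝒜 M p) :
    ∀ h : x ∈ grading 𝒜 M p,
      decomposeHom 𝒜 x = DirectSum.of (fun i => grading 𝒜 M i) p ⟨x, h⟩ := by
  refine Submodule.span_induction (p := fun y _ => ∀ h : y ∈ grading 𝒜 M p,
    decomposeHom 𝒜 y = DirectSum.of (fun i => grading 𝒜 M i) p ⟨y, h⟩) ?_ ?_ ?_ ?_ hx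
  · rintro y ⟨l, h1, rfl, rfl⟩ h
    exact decomposeHom_prod 𝒜 l h1 h
  · intro h
    have : (⟨0, h⟩ : grading 𝒜 M p) = 0 := rfl
    rw [this, map_zero, map_zero]
  · intro y z hy hz h h' hyz
    rw [map_add, h hy, h' hz, ← map_add]
    rfl
  · intro c y hy h hcy
    rw [map_smul, h hy]
    exact (map_smul (DirectSum.lof K ℤ (fun i => grading 𝒜 M i) p) c ⟨y, hy⟩).symm

/-- `A_M^+` is a graded algebra. -/
instance : GradedAlgebra (grading 𝒜 M) :=
  GradedAlgebra.ofAlgHom (grading 𝒜 M) (decomposeHom 𝒜)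
    (by
      apply algHom_ext
      intro a α
      induction a using DirectSum.Decomposition.inductionOn 𝒜 with
      | zero => simp
      | add a a' h h' =>
        simp only [TensorProduct.add_tmul, map_add, h, h']
      | homogeneous a =>
        simp [decomposeHom_gen, genGraded_tmul 𝒜 a.2])
    (fun _ x => decomposeHom_of_mem 𝒜 _ x.2 x.2)

end Grading

/-! ### Functoriality -/

section Map

variable {B : Type*} [Ring B] [Algebra K B] (ℬ : ℤ → Submodule K B)
  [GradedAlgebra 𝒜] [GradedAlgebra ℬ]

variable {𝒜 ℬ}

variable (M) in
/-- The algebra homomorphism `p_M^+ : A_M^+ → B_M^+`, `a_α ↦ (p a)_α`. -/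
def map (p : 𝒜 →ₐᵍ[K] ℬ) : RepAlg 𝒜 M →ₐ[K] RepAlg ℬ M :=
  lift 𝒜 (gen ℬ M ∘ₗ (p.toAlgHom.toLinearMap).rTensor M)
    (by
      intro a b α
      have e : pairEval (gen ℬ M ∘ₗ (p.toAlgHom.toLinearMap).rTensor M) =
          pairEval (gen ℬ M) ∘ₗ
            (TensorProduct.map p.toAlgHom.toLinearMap p.toAlgHom.toLinearMap).rTensor
              (M ⊗[K] M) := by
        ext; simp
      rw [e]
      simp [gen_mul])
    (by
      intro α
      simp [gen_one])
    (by
      intro i j a b α β ha hb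
      simp only [LinearMap.comp_apply, LinearMap.rTensor_tmul]
      exact gen_comm ℬ (p.map_mem ha) (p.map_mem hb) α β)

@[simp]
theorem map_gen (p : 𝒜 →ₐᵍ[K] ℬ) (a : A) (α : M) :
    map M p (gen 𝒜 M (a ⊗ₜ[K] α)) = gen ℬ M (p a ⊗ₜ[K] α) := by
  exact lift_gen 𝒜 _ _ _ _ _

end Map

/-! ### The action of coderivations -/

/-- The linear map `a_α ↦ a_α + a_{d(α)} ε` to the dual numbers over `A_M^+`. -/
def genDual (d : M →ₗ[K] M) : A ⊗[K] M →ₗ[K] TrivSqZeroExt (RepAlg 𝒜 M) (RepAlg 𝒜 M) :=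
  (TrivSqZeroExt.inlAlgHom K (RepAlg 𝒜 M) (RepAlg 𝒜 M)).toLinearMap ∘ₗ gen 𝒜 M +
    (TrivSqZeroExt.inrHom (RepAlg 𝒜 M) (RepAlg 𝒜 M)).restrictScalars K ∘ₗ gen 𝒜 M ∘ₗ
      d.lTensor A

theorem genDual_tmul (d : M →ₗ[K] M) (a : A) (α : M) :
    genDual 𝒜 d (a ⊗ₜ[K] α) = TrivSqZeroExt.inl (gen 𝒜 M (a ⊗ₜ[K] α)) +
      TrivSqZeroExt.inr (gen 𝒜 M (a ⊗ₜ[K] d α)) := by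
  simp [genDual]

theorem pairEval_genDual (d : M →ₗ[K] M) (a b : A) (t : M ⊗[K] M) :
    pairEval (genDual 𝒜 d) ((a ⊗ₜ[K] b) ⊗ₜ[K] t) =
      TrivSqZeroExt.inl (pairEval (gen 𝒜 M) ((a ⊗ₜ[K] b) ⊗ₜ[K] t)) +
      TrivSqZeroExt.inr (pairEval (gen 𝒜 M)
        ((a ⊗ₜ[K] b) ⊗ₜ[K] (d.rTensor M + d.lTensor M) t)) := by
  induction t with
  | zero => simp
  | tmul α β =>
    simp only [pairEval_tmul, genDual_tmul, LinearMap.add_apply, LinearMap.rTensor_tmul,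
      LinearMap.lTensor_tmul, TensorProduct.tmul_add, map_add]
    ext <;> simp [add_comm]
  | add s t hs ht =>
    simp only [TensorProduct.tmul_add, map_add, hs, ht, TrivSqZeroExt.inl_add,
      TrivSqZeroExt.inr_add]
    abel

/-- For a coderivation `d` of `M`, the algebra homomorphism `x ↦ x + d(x) ε` to the dual numbers
over `A_M^+` that encodes the derivation `d` of `A_M^+`. -/
def coderHom (d : M →ₗ[K] M) (hd : IsCoderivation d) :
    RepAlg 𝒜 M →ₐ[K] TrivSqZeroExt (RepAlg 𝒜 M) (RepAlg 𝒜 M) :=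
  lift 𝒜 (genDual 𝒜 d)
    (by
      intro a b α
      have h := LinearMap.congr_fun hd α
      rw [LinearMap.comp_apply, LinearMap.comp_apply] at h
      rw [pairEval_genDual, genDual_tmul, gen_mul, gen_mul, h])
    (by
      intro α
      rw [genDual_tmul, gen_one, gen_one, hd.counit_comp]
      simp [TrivSqZeroExt.algebraMap_eq_inl'])
    (by
      intro p q a b α β ha hb
      simp only [genDual_tmul]
      ext
      · simpa using gen_comm 𝒜 ha hb α β
      · have h1 := gen_comm 𝒜 ha hb α (d β)
        have h2 := gen_comm 𝒜 ha hb (d α) β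
        simp only [TrivSqZeroExt.snd_mul, TrivSqZeroExt.snd_smul, TrivSqZeroExt.fst_add,
          TrivSqZeroExt.snd_add, TrivSqZeroExt.fst_inl, TrivSqZeroExt.snd_inl,
          TrivSqZeroExt.fst_inr, TrivSqZeroExt.snd_inr, add_zero, zero_add, smul_eq_mul,
          MulOpposite.smul_eq_mul_unop, MulOpposite.unop_op, h1, h2, smul_add]
        rw [add_comm])

/-- The action of a coderivation `d` on `A_M^+`, that is the derivation with
`a_α ↦ a_{d(α)}`. -/
def coderAct (d : M →ₗ[K] M) (hd : IsCoderivation d) : RepAlg 𝒜 M →ₗ[K] RepAlg 𝒜 M :=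
  (TrivSqZeroExt.sndHom (RepAlg 𝒜 M) (RepAlg 𝒜 M)).restrictScalars K ∘ₗ
    (coderHom 𝒜 d hd).toLinearMap

@[simp]
theorem coderAct_gen (d : M →ₗ[K] M) (hd : IsCoderivation d) (a : A) (α : M) :
    coderAct 𝒜 d hd (gen 𝒜 M (a ⊗ₜ[K] α)) = gen 𝒜 M (a ⊗ₜ[K] d α) := by
  simp [coderAct, coderHom, genDual_tmul]

theorem fst_coderHom (d : M →ₗ[K] M) (hd : IsCoderivation d) (x : RepAlg 𝒜 M) :
    (coderHom 𝒜 d hd x).fst = x := by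
  have : (TrivSqZeroExt.fstHom K (RepAlg 𝒜 M) (RepAlg 𝒜 M)).comp (coderHom 𝒜 d hd) =
      AlgHom.id K _ := by
    apply algHom_ext
    intro a α
    simp [coderHom, genDual_tmul]
  exact AlgHom.congr_fun this x

theorem coderAct_mul (d : M →ₗ[K] M) (hd : IsCoderivation d) (x y : RepAlg 𝒜 M) :
    coderAct 𝒜 d hd (x * y) = coderAct 𝒜 d hd x * y + x * coderAct 𝒜 d hd y := by
  simp [coderAct, fst_coderHom, add_comm]

theorem coderAct_algebraMap (d : M →ₗ[K] M) (hd : IsCoderivation d) (r : K) :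
    coderAct 𝒜 d hd (algebraMap K _ r) = 0 := by
  simp [coderAct, TrivSqZeroExt.algebraMap_eq_inl']

variable (M)

/-- The subalgebra `E` of `A_M^+` formed by the elements annihilated by all inner coderivations
of `M`. -/
def invariants : Subalgebra K (RepAlg 𝒜 M) where
  carrier := {x | ∀ φ : M →ₗ[K] K,
    coderAct 𝒜 (innerCoder φ) (isCoderivation_innerCoder φ) x = 0}
  mul_mem' := by
    intro x y hx hy φ
    rw [coderAct_mul, hx φ, hy φ, zero_mul, mul_zero, add_zero]
  add_mem' := by
    intro x y hx hy φ
    rw [map_add, hx φ, hy φ, add_zero]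
  algebraMap_mem' := by
    intro r φ
    exact coderAct_algebraMap 𝒜 _ _ r

variable {M}

/-- The defining property of the bracket `{-,-}_v^+` in `A_M^+`: it is an `n`-graded biderivation
and `{a_α, b_β} = {a,b}'_{α_β} {a,b}''_{β^α}` where `α_β ⊗ β^α = hatMap v (α ⊗ β)`. -/
structure IsInducedBracket (n : ℤ) (db : A ⊗[K] A →ₗ[K] A ⊗[K] A) (v : M ⊗[K] M →ₗ[K] K)
    (br : RepAlg 𝒜 M →ₗ[K] RepAlg 𝒜 M →ₗ[K] RepAlg 𝒜 M) : Prop where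
  biderivation : IsGradedBiderivation (grading 𝒜 M) n br
  apply_gen : ∀ (a b : A) (α β : M),
    br (gen 𝒜 M (a ⊗ₜ[K] α)) (gen 𝒜 M (b ⊗ₜ[K] β)) =
      pairEval (gen 𝒜 M) (db (a ⊗ₜ[K] b) ⊗ₜ[K] hatMap v (α ⊗ₜ[K] β))

section Reduction

variable {B : Type*} [Ring B] [Algebra K B] {ℬ : ℤ → Submodule K B}
  [GradedAlgebra 𝒜] [GradedAlgebra ℬ]

variable {𝒜}

variable (M) in
/-- The subalgebra `p_M^+ (E)` of `B_M^+`. -/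
def reduced (p : 𝒜 →ₐᵍ[K] ℬ) : Subalgebra K (RepAlg ℬ M) :=
  (invariants 𝒜 M).map (map M p)

/-- The element `p_M^+ (x)` of `p_M^+ (E)` for `x ∈ E`. -/
def toReduced (p : 𝒜 →ₐᵍ[K] ℬ) (x : invariants 𝒜 M) : reduced M p :=
  ⟨map M p x, x, x.2, rfl⟩

/-- The bracket `br'` in `p_M^+ (E)` is obtained from the bracket `br` restricted to `E` by descent
along `p_M^+ : E → p_M^+ (E)`. -/
def Descends (p : 𝒜 →ₐᵍ[K] ℬ) (br : RepAlg 𝒜 M →ₗ[K] RepAlg 𝒜 M →ₗ[K] RepAlg 𝒜 M)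
    (br' : reduced M p →ₗ[K] reduced M p →ₗ[K] reduced M p) : Prop :=
  ∀ x y : invariants 𝒜 M,
    (br' (toReduced p x) (toReduced p y) : RepAlg ℬ M) = map M p (br x y)

end Reduction

end RepAlg

end RepAlg

end

/-! A graded derivation of $A_M^+$ is determined by its values on the generators (`gradedDer_ext`).
Conversely, a map of the right degree on generators extends to a derivation once it satisfies the
Leibniz rule on $(ab)_\alpha=a_{\alpha^1}b_{\alpha^2}$ (`exists_gradedDer`): a derivation $D$ of
degree $k$ amounts to an algebra homomorphism sending $x$ to the upper triangular matrix with
diagonal $(-1)^{k|x|}x,\ x$ and corner $Dx$, so the universal property applies. Most identities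
below are equalities of two derivations, checked on generators.

The bracket arises in two extensions. The right Leibniz rule of the double bracket extends
$\{a_\alpha,-\}$ to a derivation (`exists_gen_adjoint`). Antisymmetry of the double bracket and
cyclicity of $v$ make the bracket of generators antisymmetric (`genBracket_antisymm`); this dictates
the values of $\{x,-\}$ on generators for every homogeneous $x$, and a second extension gives the
bracket (`exists_bracket`). Cyclicity also makes $v$ invariant under inner coderivations, so every
$\delta_\varphi$ is a derivation of the bracket and $E$ is closed under it
(`IsInducedBracket.coderAct_bracket`).

For the Jacobi identity, the Jacobi expression is up to sign a derivation in its last argument and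
is cyclically symmetric, so generators suffice. There it is a difference of two values of the
tribracket, at $(a,b,c)$ and $(a,c,b)$ (`jacobiator_gen`); the three summands of a tribracket are
matched by a cyclic symmetry of iterated contractions with $v$ (`IsCyclicForm.tripleHat_rotate`).

For the descent, the hypothesis on $\xi\in\mathcal M$ says that modulo the kernel of $p_M^+$ the
field $\{\xi_\alpha,-\}$ is $k_\xi\delta_\varphi$ with $\varphi=v(\alpha\otimes-)$
(`IsInducedBracket.map_moment`). It therefore kills homogeneous $y\in E$. The
$a\in\operatorname{Ker}p$ with $p_M^+\{y,a_\beta\}=0$ for all $\beta$ form an ideal containing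
$\mathcal M$, hence all of $\operatorname{Ker}p$. So $p_M^+\{y,a_\alpha\}$ depends only on $p(a)$,
and $\{y,-\}$ descends to a derivation of $B_M^+$ (`IsInducedBracket.exists_hamiltonian_descent`);
no description of the kernel of $p_M^+$ is needed. Bracket identities pass to $p_M^+(E)$ because its
homogeneous elements lift to homogeneous elements of $E$. -/

noncomputable section

/-! ## Signs -/

theorem negOnePow_coe_congr {j k : ℤ} (h : Even (j - k)) :
    (j.negOnePow : ℤ) = (k.negOnePow : ℤ) := by
  rw [(Int.negOnePow_eq_iff j k).2 h]

theorem negOnePow_smul_congr {X : Type*} [AddCommGroup X] {j k : ℤ} (h : Even (j - k)) (x : X) :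
    (j.negOnePow : ℤ) • x = (k.negOnePow : ℤ) • x := by
  rw [negOnePow_coe_congr h]

theorem negOnePow_coe_mul (j k : ℤ) :
    (j.negOnePow : ℤ) * (k.negOnePow : ℤ) = ((j + k).negOnePow : ℤ) := by
  rw [Int.negOnePow_add, Units.val_mul]

theorem negOnePow_smul_smul {X : Type*} [AddCommGroup X] (j k : ℤ) (x : X) :
    (j.negOnePow : ℤ) • (k.negOnePow : ℤ) • x = ((j + k).negOnePow : ℤ) • x := by
  rw [smul_smul, negOnePow_coe_mul]

theorem negOnePow_smul_even {X : Type*} [AddCommGroup X] {j : ℤ} (h : Even j) (x : X) :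
    (j.negOnePow : ℤ) • x = x := by
  rw [Int.negOnePow_even j h]; simp

theorem negOnePow_smul_mem {K X : Type*} [Ring K] [AddCommGroup X] [Module K X] (S : Submodule K X)
    (j : ℤ) {x : X} (hx : x ∈ S) : (j.negOnePow : ℤ) • x ∈ S :=
  S.toAddSubgroup.zsmul_mem hx _

/-! ## Graded derivations -/

section GradedDerivations

variable {K : Type*} [CommRing K] {C : Type*} [Ring C] [Algebra K C]

/-- The derivations of degree `k` of a graded algebra. -/
def gradedDer (𝒞 : ℤ → Submodule K C) (k : ℤ) : Submodule K (C →ₗ[K] C) where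
  carrier := {D | (∀ p, ∀ x ∈ 𝒞 p, D x ∈ 𝒞 (p + k)) ∧
    ∀ p, ∀ x ∈ 𝒞 p, ∀ y, D (x * y) = D x * y + ((k * p).negOnePow : ℤ) • (x * D y)}
  zero_mem' := by simp
  add_mem' := by
    rintro D E ⟨hD, hD'⟩ ⟨hE, hE'⟩
    refine ⟨fun p x hx => add_mem (hD p x hx) (hE p x hx), fun p x hx y => ?_⟩
    simp only [LinearMap.add_apply, hD' p x hx y, hE' p x hx y, add_mul, mul_add, smul_add]
    abel
  smul_mem' := by
    rintro c D ⟨hD, hD'⟩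
    refine ⟨fun p x hx => Submodule.smul_mem _ _ (hD p x hx), fun p x hx y => ?_⟩
    simp only [LinearMap.smul_apply, hD' p x hx y, smul_add, smul_mul_assoc, mul_smul_comm]
    rw [smul_comm c]

variable {𝒞 : ℤ → Submodule K C} {k : ℤ} {D : C →ₗ[K] C}

theorem gradedDer_apply_mem (hD : D ∈ gradedDer 𝒞 k) {p : ℤ} {x : C} (hx : x ∈ 𝒞 p) :
    D x ∈ 𝒞 (p + k) := hD.1 p x hx

theorem gradedDer_mul (hD : D ∈ gradedDer 𝒞 k) {p : ℤ} {x : C} (hx : x ∈ 𝒞 p) (y : C) :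
    D (x * y) = D x * y + ((k * p).negOnePow : ℤ) • (x * D y) := hD.2 p x hx y

theorem gradedDer_congr {l : ℤ} (hD : D ∈ gradedDer 𝒞 k) (h : k = l) : D ∈ gradedDer 𝒞 l :=
  h ▸ hD

theorem negOnePow_smul_gradedDer (hD : D ∈ gradedDer 𝒞 k) (j : ℤ) :
    (j.negOnePow : ℤ) • D ∈ gradedDer 𝒞 k := negOnePow_smul_mem _ j hD

/-- In a graded-commutative algebra, graded derivations can be multiplied by elements. -/
theorem mulLeft_comp_gradedDer [SetLike.GradedMonoid 𝒞]
    (hcomm : ∀ (p q : ℤ) (x y : C), x ∈ 𝒞 p → y ∈ 𝒞 q →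
      x * y = ((p * q).negOnePow : ℤ) • (y * x))
    (hD : D ∈ gradedDer 𝒞 k) {q : ℤ} {b : C} (hb : b ∈ 𝒞 q) :
    LinearMap.mulLeft K b ∘ₗ D ∈ gradedDer 𝒞 (q + k) := by
  refine ⟨fun p x hx => ?_, fun p x hx y => ?_⟩
  · have := SetLike.mul_mem_graded hb (gradedDer_apply_mem hD hx)
    rwa [show p + (q + k) = q + (p + k) by ring]
  · simp only [LinearMap.comp_apply, LinearMap.mulLeft_apply, gradedDer_mul hD hx, mul_add,
      mul_assoc, mul_smul_comm]
    rw [← mul_assoc b x, hcomm q p b x hb hx, smul_mul_assoc, negOnePow_smul_smul, mul_assoc]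
    congr 1
    exact negOnePow_smul_congr (by grind) _

/-- The mixed terms, one derivation on each factor, cancel by the choice of sign. This serves both
the invariance of the bracket and the Jacobi identity. -/
theorem gradedDer_commutator {l : ℤ} {E : C →ₗ[K] C} [SetLike.GradedMonoid 𝒞]
    (hD : D ∈ gradedDer 𝒞 k) (hE : E ∈ gradedDer 𝒞 l) :
    D ∘ₗ E - ((k * l).negOnePow : ℤ) • (E ∘ₗ D) ∈ gradedDer 𝒞 (k + l) := by
  refine ⟨fun p x hx => ?_, fun p x hx y => ?_⟩
  · have h1 := gradedDer_apply_mem hD (gradedDer_apply_mem hE hx)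
    have h2 := gradedDer_apply_mem hE (gradedDer_apply_mem hD hx)
    rw [show p + l + k = p + (k + l) by ring] at h1
    rw [show p + k + l = p + (k + l) by ring] at h2
    exact sub_mem h1 (negOnePow_smul_mem _ _ h2)
  · simp only [LinearMap.sub_apply, LinearMap.smul_apply, LinearMap.comp_apply,
      gradedDer_mul hD hx, gradedDer_mul hE hx, map_add, map_zsmul,
      gradedDer_mul hD (gradedDer_apply_mem hE hx), gradedDer_mul hE (gradedDer_apply_mem hD hx),
      smul_add, sub_mul, mul_sub, smul_sub, smul_mul_assoc, mul_smul_comm, negOnePow_smul_smul]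
    rw [negOnePow_smul_congr (j := k * l + l * (p + k)) (k := l * p) (by grind),
      negOnePow_smul_congr (j := k * (p + l)) (k := k * l + k * p) (by grind),
      negOnePow_smul_congr (j := k * l + (k * p + l * p)) (k := (k + l) * p + k * l) (by grind),
      negOnePow_smul_congr (j := l * p + k * p) (k := (k + l) * p) (by grind)]
    abel

end GradedDerivations

/-! ### Products of two linear maps on generators -/

section PairEval

variable {K : Type*} [CommRing K] {A : Type*} [Ring A] [Algebra K A]
  {M : Type*} [AddCommGroup M] [Module K M] {R : Type*} [Ring R] [Algebra K R]

/-- For linear maps `f`, `g` from `A ⊗ M` to an algebra, the map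
`(a ⊗ b) ⊗ (α ⊗ β) ↦ f (a ⊗ α) g (b ⊗ β)`. -/
def mixedEval (f g : A ⊗[K] M →ₗ[K] R) : (A ⊗[K] A) ⊗[K] (M ⊗[K] M) →ₗ[K] R :=
  LinearMap.mul' K R ∘ₗ TensorProduct.map f g ∘ₗ
    (TensorProduct.tensorTensorTensorComm K A A M M).toLinearMap

@[simp]
theorem mixedEval_tmul (f g : A ⊗[K] M →ₗ[K] R) (a b : A) (α β : M) :
    mixedEval f g ((a ⊗ₜ[K] b) ⊗ₜ[K] (α ⊗ₜ[K] β)) = f (a ⊗ₜ[K] α) * g (b ⊗ₜ[K] β) := by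
  simp [mixedEval]

end PairEval

/-! ### Upper triangular matrices, the carriers of derivations -/

section UpperTriangular

variable {R : Type*} [Ring R]

/-- Upper triangular matrices of size two. -/
def upperTriangular (x y z : R) : Matrix (Fin 2) (Fin 2) R := !![x, y; 0, z]

theorem upperTriangular_mul (x y z x' y' z' : R) :
    upperTriangular x y z * upperTriangular x' y' z' =
      upperTriangular (x * x') (x * y' + y * z') (z * z') := by
  simp [upperTriangular]

theorem upperTriangular_add (x y z x' y' z' : R) :
    upperTriangular x y z + upperTriangular x' y' z' =
      upperTriangular (x + x') (y + y') (z + z') := by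
  ext i j; fin_cases i <;> fin_cases j <;> simp [upperTriangular]

theorem upperTriangular_zero : upperTriangular (0 : R) 0 0 = 0 := by
  ext i j; fin_cases i <;> fin_cases j <;> simp [upperTriangular]

theorem upperTriangular_one : upperTriangular (1 : R) 0 1 = 1 := by
  ext i j; fin_cases i <;> fin_cases j <;> simp [upperTriangular]

theorem smul_upperTriangular {K : Type*} [CommRing K] [Module K R] (c : K) (x y z : R) :
    c • upperTriangular x y z = upperTriangular (c • x) (c • y) (c • z) := by
  ext i j; fin_cases i <;> fin_cases j <;> simp [upperTriangular]

theorem zsmul_upperTriangular (c : ℤ) (x y z : R) :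
    c • upperTriangular x y z = upperTriangular (c • x) (c • y) (c • z) :=
  smul_upperTriangular c x y z

theorem upperTriangular_algebraMap {K : Type*} [CommRing K] [Algebra K R] (c : K) :
    upperTriangular (algebraMap K R c) 0 (algebraMap K R c) =
      algebraMap K (Matrix (Fin 2) (Fin 2) R) c := by
  ext i j; fin_cases i <;> fin_cases j <;>
    simp [upperTriangular, Matrix.algebraMap_matrix_apply]

end UpperTriangular

/-! ### Graded derivations of the representation algebra: uniqueness and extension from generators
-/

namespace RepAlg

variable {K : Type u} [CommRing K] {A : Type v} [Ring A] [Algebra K A]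
  {𝒜 : ℤ → Submodule K A} {M : Type w} [AddCommGroup M] [Module K M] [Coalgebra K M]

/-- The homogeneous parts are spanned by monomials, and a monomial is reached from 1 by prepending
generators. The predicate carries the degree so that signs can be tracked. -/
theorem homogeneous_induction {P : ℤ → RepAlg 𝒜 M → Prop} (zero : ∀ p, P p 0)
    (add : ∀ p x y, P p x → P p y → P p (x + y)) (smul : ∀ p (c : K) x, P p x → P p (c • x))
    (one : P 0 1)
    (gen_mul : ∀ p q a α y, a ∈ 𝒜 p → y ∈ grading 𝒜 M q → P q y →
      P (p + q) (gen 𝒜 M (a ⊗ₜ[K] α) * y))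
    {p : ℤ} {x : RepAlg 𝒜 M} (hx : x ∈ grading 𝒜 M p) : P p x := by
  refine Submodule.span_induction (p := fun y _ => P p y) ?_ (zero p)
    (fun _ _ _ _ => add p _ _) (fun c _ _ => smul p c _) hx
  rintro y ⟨l, h1, rfl, rfl⟩
  clear hx
  induction l with
  | nil => simpa using one
  | cons t l ih =>
    have h1' : ∀ s ∈ l, s.2.1 ∈ 𝒜 s.1 := fun s hs => h1 s (List.mem_cons_of_mem _ hs)
    simp only [List.map_cons, List.sum_cons, List.prod_cons]
    exact gen_mul _ _ _ _ _ (h1 t List.mem_cons_self) (Submodule.subset_span ⟨l, h1', rfl, rfl⟩)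
      (ih h1')

theorem commute_gen {p q : ℤ} {a : A} (ha : a ∈ 𝒜 p) (α : M) {x : RepAlg 𝒜 M}
    (hx : x ∈ grading 𝒜 M q) :
    gen 𝒜 M (a ⊗ₜ[K] α) * x = ((p * q).negOnePow : ℤ) • (x * gen 𝒜 M (a ⊗ₜ[K] α)) := by
  refine homogeneous_induction (P := fun q x => gen 𝒜 M (a ⊗ₜ[K] α) * x =
    ((p * q).negOnePow : ℤ) • (x * gen 𝒜 M (a ⊗ₜ[K] α))) ?_ ?_ ?_ ?_ ?_ hx
  · simp
  · intro q x y hx hy; rw [mul_add, hx, hy, add_mul, smul_add]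
  · intro q c x hx; rw [mul_smul_comm, hx, smul_mul_assoc, smul_comm]
  · simp
  · intro r q b β y hb _ h
    rw [← mul_assoc, gen_comm 𝒜 ha hb, smul_mul_assoc, mul_assoc, h, mul_smul_comm,
      negOnePow_smul_smul, mul_assoc]
    congr 3; ring

/-- `A_M^+` is graded-commutative. -/
theorem mul_comm_graded {p q : ℤ} {x y : RepAlg 𝒜 M} (hx : x ∈ grading 𝒜 M p)
    (hy : y ∈ grading 𝒜 M q) : x * y = ((p * q).negOnePow : ℤ) • (y * x) := by
  refine homogeneous_induction (P := fun p x => x * y = ((p * q).negOnePow : ℤ) • (y * x))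
    ?_ ?_ ?_ ?_ ?_ hx
  · simp
  · intro q x y hx hy; rw [mul_add, add_mul, hx, hy, smul_add]
  · intro q c x hx; rw [mul_smul_comm, smul_mul_assoc, hx, smul_comm]
  · simp
  · intro p r a α z ha _ h
    rw [mul_assoc, h, mul_smul_comm, ← mul_assoc, commute_gen ha α hy, smul_mul_assoc,
      negOnePow_smul_smul, mul_assoc]
    congr 3; ring

theorem mulLeft_comp_mem_gradedDer {q k : ℤ} {b : RepAlg 𝒜 M} (hb : b ∈ grading 𝒜 M q)
    {D : RepAlg 𝒜 M →ₗ[K] RepAlg 𝒜 M} (hD : D ∈ gradedDer (grading 𝒜 M) k) :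
    LinearMap.mulLeft K b ∘ₗ D ∈ gradedDer (grading 𝒜 M) (q + k) :=
  mulLeft_comp_gradedDer (fun _ _ _ _ => mul_comm_graded) hD hb

section Graded

variable [GradedAlgebra 𝒜]

theorem linearMap_ext_homogeneous {N : Type*} [AddCommGroup N] [Module K N]
    {f g : RepAlg 𝒜 M →ₗ[K] N}
    (h : ∀ p, ∀ x ∈ grading 𝒜 M p, f x = g x) : f = g := by
  ext x
  induction x using DirectSum.Decomposition.inductionOn (grading 𝒜 M) with
  | zero => simp
  | homogeneous x => exact h _ _ x.2
  | add x y hx hy => rw [map_add, map_add, hx, hy]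

/-- A graded derivation along an algebra homomorphism vanishes if it vanishes on the generators. -/
theorem eq_zero_of_leibniz {R : Type*} [Ring R] [Algebra K R] (g : RepAlg 𝒜 M →ₐ[K] R) (k : ℤ)
    (D : RepAlg 𝒜 M →ₗ[K] R)
    (hD : ∀ p, ∀ x ∈ grading 𝒜 M p, ∀ y,
      D (x * y) = D x * g y + ((k * p).negOnePow : ℤ) • (g x * D y))
    (hgen : ∀ p, ∀ a ∈ 𝒜 p, ∀ α, D (gen 𝒜 M (a ⊗ₜ[K] α)) = 0) : D = 0 := by
  refine linearMap_ext_homogeneous fun p x hx => ?_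
  refine homogeneous_induction (P := fun _ x => D x = 0) ?_ ?_ ?_ ?_ ?_ hx
  · simp
  · intro q x y hx hy; rw [map_add, hx, hy, add_zero]
  · intro q c x hx; rw [map_smul, hx, smul_zero]
  -- The Leibniz rule at $1\cdot1$ reads $D1=D1+D1$.
  · have := hD 0 1 SetLike.GradedOne.one_mem 1
    simpa using this
  · intro p q a α y ha _ h
    rw [hD p _ (gen_mem_grading 𝒜 ha α), h, hgen p a ha α]; simp

theorem gradedDer_ext {k : ℤ} {D E : RepAlg 𝒜 M →ₗ[K] RepAlg 𝒜 M}
    (hD : D ∈ gradedDer (grading 𝒜 M) k) (hE : E ∈ gradedDer (grading 𝒜 M) k)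
    (h : ∀ p, ∀ a ∈ 𝒜 p, ∀ α, D (gen 𝒜 M (a ⊗ₜ[K] α)) = E (gen 𝒜 M (a ⊗ₜ[K] α))) : D = E := by
  rw [← sub_eq_zero]
  refine eq_zero_of_leibniz (AlgHom.id K _) k _
    (fun p x hx y => gradedDer_mul (sub_mem hD hE) hx y) fun p a ha α => ?_
  rw [LinearMap.sub_apply, h p a ha α, sub_self]

variable (𝒜) in
/-- The generators of `A_M^+` as upper triangular matrices, the upper right entries being given
by a linear map `f`. -/
def genMatrix (k : ℤ) (f : A ⊗[K] M →ₗ[K] RepAlg 𝒜 M) :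
    A ⊗[K] M →ₗ[K] Matrix (Fin 2) (Fin 2) (RepAlg 𝒜 M) :=
  Matrix.singleLinearMap K 0 0 ∘ₗ signTwist (grading 𝒜 M) k ∘ₗ gen 𝒜 M +
    Matrix.singleLinearMap K 0 1 ∘ₗ f + Matrix.singleLinearMap K 1 1 ∘ₗ gen 𝒜 M

theorem genMatrix_apply (k : ℤ) (f : A ⊗[K] M →ₗ[K] RepAlg 𝒜 M) (t : A ⊗[K] M) :
    genMatrix 𝒜 k f t =
      upperTriangular (signTwist (grading 𝒜 M) k (gen 𝒜 M t)) (f t) (gen 𝒜 M t) := by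
  ext i j
  fin_cases i <;> fin_cases j <;> simp [genMatrix, Matrix.single, upperTriangular]

theorem genMatrix_tmul (k : ℤ) (f : A ⊗[K] M →ₗ[K] RepAlg 𝒜 M) {p : ℤ} {a : A} (ha : a ∈ 𝒜 p)
    (α : M) : genMatrix 𝒜 k f (a ⊗ₜ[K] α) =
      upperTriangular (((k * p).negOnePow : ℤ) • gen 𝒜 M (a ⊗ₜ[K] α)) (f (a ⊗ₜ[K] α))
        (gen 𝒜 M (a ⊗ₜ[K] α)) := by
  rw [genMatrix_apply, signTwist_apply (grading 𝒜 M) k p (gen_mem_grading 𝒜 ha α)]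

theorem pairEval_genMatrix (k : ℤ) (f : A ⊗[K] M →ₗ[K] RepAlg 𝒜 M) {p q : ℤ} {a b : A}
    (ha : a ∈ 𝒜 p) (hb : b ∈ 𝒜 q) (t : M ⊗[K] M) :
    pairEval (genMatrix 𝒜 k f) ((a ⊗ₜ[K] b) ⊗ₜ[K] t) =
      upperTriangular (((k * (p + q)).negOnePow : ℤ) • pairEval (gen 𝒜 M) ((a ⊗ₜ[K] b) ⊗ₜ[K] t))
          (mixedEval f (gen 𝒜 M) ((a ⊗ₜ[K] b) ⊗ₜ[K] t) +
            ((k * p).negOnePow : ℤ) • mixedEval (gen 𝒜 M) f ((a ⊗ₜ[K] b) ⊗ₜ[K] t))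
          (pairEval (gen 𝒜 M) ((a ⊗ₜ[K] b) ⊗ₜ[K] t)) := by
  induction t with
  | zero => simp only [TensorProduct.tmul_zero, map_zero, smul_zero, add_zero, upperTriangular_zero]
  | tmul α β =>
    rw [pairEval_tmul, genMatrix_tmul k f ha, genMatrix_tmul k f hb, upperTriangular_mul]
    simp only [pairEval_tmul, mixedEval_tmul, smul_mul_assoc, mul_smul_comm, negOnePow_smul_smul]
    rw [mul_add, add_comm (k * p), add_comm (f (a ⊗ₜ[K] α) * gen 𝒜 M (b ⊗ₜ[K] β))]
  | add s t hs ht =>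
    simp only [TensorProduct.tmul_add, map_add, hs, ht, upperTriangular_add, smul_add]
    congr 1
    abel

section Lift

variable {k : ℤ} {f : A ⊗[K] M →ₗ[K] RepAlg 𝒜 M}
  {Φ : RepAlg 𝒜 M →ₐ[K] Matrix (Fin 2) (Fin 2) (RepAlg 𝒜 M)}

/-- The shape of the matrix is preserved by products, so only the corner entry carries new
information. -/
theorem matrixHom_apply (hΦ : ∀ t, Φ (gen 𝒜 M t) = genMatrix 𝒜 k f t) {p : ℤ} {x : RepAlg 𝒜 M}
    (hx : x ∈ grading 𝒜 M p) :
    Φ x = upperTriangular (((k * p).negOnePow : ℤ) • x) (Φ x 0 1) x := by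
  refine homogeneous_induction (P := fun p x =>
    Φ x = upperTriangular (((k * p).negOnePow : ℤ) • x) (Φ x 0 1) x) ?_ ?_ ?_ ?_ ?_ hx
  · intro p
    rw [map_zero, smul_zero, Matrix.zero_apply, upperTriangular_zero]
  · intro p x y hx hy
    rw [map_add, Matrix.add_apply, smul_add, ← upperTriangular_add, ← hx, ← hy]
  · intro p c x hx
    rw [map_smul, smul_comm]
    exact (congrArg (c • ·) hx).trans (smul_upperTriangular c _ _ _)
  · rw [map_one, mul_zero, negOnePow_smul_even Even.zero]
    exact upperTriangular_one.symm
  · intro p q a α y ha hy h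
    have e : Φ (gen 𝒜 M (a ⊗ₜ[K] α) * y) = _ := map_mul Φ _ _
    rw [hΦ, genMatrix_tmul k f ha, h, upperTriangular_mul] at e
    rw [e, smul_mul_assoc, mul_smul_comm, negOnePow_smul_smul, mul_add]
    rfl

/-- The corner of a product of upper triangular matrices is the graded Leibniz rule. -/
theorem matrixHom_gen_mul (hΦ : ∀ t, Φ (gen 𝒜 M t) = genMatrix 𝒜 k f t) {p q : ℤ}
    {x y : RepAlg 𝒜 M} (hx : x ∈ grading 𝒜 M p) (hy : y ∈ grading 𝒜 M q) :
    Φ (x * y) 0 1 = Φ x 0 1 * y + ((k * p).negOnePow : ℤ) • (x * Φ y 0 1) := by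
  have e : Φ (x * y) = _ := map_mul Φ _ _
  rw [matrixHom_apply hΦ hx, matrixHom_apply hΦ hy, upperTriangular_mul] at e
  refine (congrFun (congrFun e 0) 1).trans ?_
  rw [← smul_mul_assoc, add_comm (Φ x 0 1 * y)]
  rfl

theorem matrixHom_mem_grading (hΦ : ∀ t, Φ (gen 𝒜 M t) = genMatrix 𝒜 k f t)
    (hdeg : ∀ p, ∀ a ∈ 𝒜 p, ∀ α, f (a ⊗ₜ[K] α) ∈ grading 𝒜 M (p + k)) {p : ℤ} {x : RepAlg 𝒜 M}
    (hx : x ∈ grading 𝒜 M p) : Φ x 0 1 ∈ grading 𝒜 M (p + k) := by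
  refine homogeneous_induction (P := fun p x => Φ x 0 1 ∈ grading 𝒜 M (p + k)) ?_ ?_ ?_ ?_ ?_ hx
  · intro p
    rw [map_zero]
    exact zero_mem _
  · intro p x y hx hy
    rw [map_add]
    exact add_mem hx hy
  · intro p c x hx
    rw [map_smul]
    exact Submodule.smul_mem _ _ hx
  · rw [map_one]
    exact zero_mem _
  · intro p q a α y ha hy h
    rw [matrixHom_gen_mul hΦ (gen_mem_grading 𝒜 ha α) hy, hΦ, genMatrix_tmul k f ha]
    refine add_mem ?_ (negOnePow_smul_mem _ _ ?_)
    · rw [add_right_comm]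
      exact SetLike.mul_mem_graded (hdeg p a ha α) hy
    · rw [add_assoc]
      exact SetLike.mul_mem_graded (gen_mem_grading 𝒜 ha α) h

end Lift

-- Since $1_\alpha=\varepsilon(\alpha)1$, counitality turns each summand of the hypothesis into
-- $f(1\otimes\alpha)$, which is thus equal to its own double.
omit [GradedAlgebra 𝒜] in
theorem apply_one_tmul_eq_zero {f : A ⊗[K] M →ₗ[K] RepAlg 𝒜 M}
    (h : ∀ α, f ((1 : A) ⊗ₜ[K] α) =
      mixedEval f (gen 𝒜 M) (((1 : A) ⊗ₜ[K] (1 : A)) ⊗ₜ[K] Coalgebra.comul (R := K) α) +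
        mixedEval (gen 𝒜 M) f (((1 : A) ⊗ₜ[K] (1 : A)) ⊗ₜ[K] Coalgebra.comul (R := K) α)) (α : M) :
    f ((1 : A) ⊗ₜ[K] α) = 0 := by
  have h1 : ∀ t : M ⊗[K] M, mixedEval f (gen 𝒜 M) (((1 : A) ⊗ₜ[K] (1 : A)) ⊗ₜ[K] t) =
      f ((1 : A) ⊗ₜ[K] TensorProduct.rid K M (Coalgebra.counit.lTensor M t)) := by
    intro t
    induction t with
    | zero => simp
    | tmul α β => simp [gen_one, Algebra.algebraMap_eq_smul_one]
    | add s t hs ht => simp only [TensorProduct.tmul_add, map_add, hs, ht]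
  have h2 : ∀ t : M ⊗[K] M, mixedEval (gen 𝒜 M) f (((1 : A) ⊗ₜ[K] (1 : A)) ⊗ₜ[K] t) =
      f ((1 : A) ⊗ₜ[K] TensorProduct.lid K M (Coalgebra.counit.rTensor M t)) := by
    intro t
    induction t with
    | zero => simp
    | tmul α β => simp [gen_one, Algebra.algebraMap_eq_smul_one]
    | add s t hs ht => simp only [TensorProduct.tmul_add, map_add, hs, ht]
  have := h α
  rw [h1, h2, Coalgebra.rTensor_counit_comul, Coalgebra.lTensor_counit_comul] at this
  simpa using this

/-- Extension of a map on generators to a graded derivation of `A_M^+`. -/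
theorem exists_gradedDer (k : ℤ) (f : A ⊗[K] M →ₗ[K] RepAlg 𝒜 M)
    (hdeg : ∀ p, ∀ a ∈ 𝒜 p, ∀ α, f (a ⊗ₜ[K] α) ∈ grading 𝒜 M (p + k))
    (hmul : ∀ p q, ∀ a ∈ 𝒜 p, ∀ b ∈ 𝒜 q, ∀ α, f ((a * b) ⊗ₜ[K] α) =
      mixedEval f (gen 𝒜 M) ((a ⊗ₜ[K] b) ⊗ₜ[K] Coalgebra.comul (R := K) α) +
        ((k * p).negOnePow : ℤ) •
          mixedEval (gen 𝒜 M) f ((a ⊗ₜ[K] b) ⊗ₜ[K] Coalgebra.comul (R := K) α)) :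
    ∃ D ∈ gradedDer (grading 𝒜 M) k, ∀ t, D (gen 𝒜 M t) = f t := by
  have hone := apply_one_tmul_eq_zero (f := f) fun α => by
    have := hmul 0 0 1 SetLike.GradedOne.one_mem 1 SetLike.GradedOne.one_mem α
    rwa [mul_zero, negOnePow_smul_even Even.zero, mul_one] at this
  let Φ : RepAlg 𝒜 M →ₐ[K] Matrix (Fin 2) (Fin 2) (RepAlg 𝒜 M) := lift 𝒜 (genMatrix 𝒜 k f)
    (by
      intro a b α
      induction a using DirectSum.Decomposition.inductionOn 𝒜 with
      | zero => simp only [zero_mul, TensorProduct.zero_tmul, map_zero]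
      | add a a' h h' => simp only [add_mul, TensorProduct.add_tmul, map_add, h, h']
      | homogeneous a =>
        induction b using DirectSum.Decomposition.inductionOn 𝒜 with
        | zero => simp only [mul_zero, TensorProduct.zero_tmul, TensorProduct.tmul_zero, map_zero]
        | add b b' h h' =>
          simp only [mul_add, TensorProduct.add_tmul, TensorProduct.tmul_add, map_add, h, h']
        | homogeneous b =>
          rw [pairEval_genMatrix k f a.2 b.2,
            genMatrix_tmul k f (SetLike.mul_mem_graded a.2 b.2), gen_mul, hmul _ _ _ a.2 _ b.2])
    (by
      intro α
      rw [genMatrix_tmul k f SetLike.GradedOne.one_mem, hone, gen_one, mul_zero,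
        negOnePow_smul_even Even.zero, upperTriangular_algebraMap])
    (by
      intro p q a b α β ha hb
      -- The corners agree because $f$ raises degrees by $k$ and $A_M^+$ is graded-commutative.
      have hab := gen_comm 𝒜 ha hb α β
      have h1 := mul_comm_graded (gen_mem_grading 𝒜 ha α) (hdeg q b hb β)
      have h2 := mul_comm_graded (hdeg p a ha α) (gen_mem_grading 𝒜 hb β)
      rw [genMatrix_tmul k f ha, genMatrix_tmul k f hb, upperTriangular_mul, upperTriangular_mul,
        zsmul_upperTriangular, hab]
      simp only [smul_mul_assoc, mul_smul_comm, hab, h1, h2, smul_add, negOnePow_smul_smul]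
      congr 1
      · exact negOnePow_smul_congr (by grind) _
      · rw [add_comm]
        congr 1 <;> exact negOnePow_smul_congr (by grind) _)
  have hΦ : ∀ t, Φ (gen 𝒜 M t) = genMatrix 𝒜 k f t := fun t => lift_gen 𝒜 _ _ _ _ t
  refine ⟨Matrix.entryLinearMap K (RepAlg 𝒜 M) 0 1 ∘ₗ Φ.toLinearMap,
    ⟨fun p x hx => matrixHom_mem_grading hΦ hdeg hx, fun p x hx y => ?_⟩, fun t => ?_⟩
  · induction y using DirectSum.Decomposition.inductionOn (grading 𝒜 M) with
    | zero => simp only [mul_zero, map_zero, smul_zero, add_zero]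
    | homogeneous y => exact matrixHom_gen_mul hΦ hx y.2
    | add y z hy hz =>
      simp only [mul_add, map_add, hy, hz, smul_add]
      abel
  · change Φ (gen 𝒜 M t) 0 1 = f t
    rw [hΦ, genMatrix_apply]
    rfl

end Graded

end RepAlg

/-! ### Contractions in a coalgebra and cyclic forms -/

section CoalgebraContractions

variable {K : Type u} [CommRing K] {M : Type w} [AddCommGroup M] [Module K M] [Coalgebra K M]

/-- The map `α ↦ ψ (α¹) α²`. -/
def leftContraction (ψ : M →ₗ[K] K) : M →ₗ[K] M :=
  (TensorProduct.lid K M).toLinearMap ∘ₗ ψ.rTensor M ∘ₗ Coalgebra.comul (R := K) (A := M)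

/-- The map `α ↦ ψ (α²) α¹`. -/
def rightContraction (ψ : M →ₗ[K] K) : M →ₗ[K] M :=
  (TensorProduct.rid K M).toLinearMap ∘ₗ ψ.lTensor M ∘ₗ Coalgebra.comul (R := K) (A := M)

theorem leftContraction_apply (ψ : M →ₗ[K] K) (x : M) :
    leftContraction ψ x = TensorProduct.lid K M (ψ.rTensor M (Coalgebra.comul x)) := rfl

theorem rightContraction_apply (ψ : M →ₗ[K] K) (x : M) :
    rightContraction ψ x = TensorProduct.rid K M (ψ.lTensor M (Coalgebra.comul x)) := rfl

theorem innerCoder_eq (φ : M →ₗ[K] K) :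
    innerCoder φ = rightContraction φ - leftContraction φ := rfl

/-- Both sides are $\psi(x^1)\varphi(x^2)$. -/
theorem apply_rightContraction (φ ψ : M →ₗ[K] K) (x : M) :
    ψ (rightContraction φ x) = φ (leftContraction ψ x) := by
  rw [rightContraction_apply, leftContraction_apply]
  generalize Coalgebra.comul (R := K) x = t
  induction t with
  | zero => simp
  | tmul a b => simp [mul_comm]
  | add s t hs ht => simp only [map_add, hs, ht]

theorem counit_leftContraction (ψ : M →ₗ[K] K) (x : M) :
    Coalgebra.counit (R := K) (leftContraction ψ x) = ψ x := by
  rw [← apply_rightContraction, rightContraction_apply, Coalgebra.lTensor_counit_comul]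
  simp

theorem counit_rightContraction (ψ : M →ₗ[K] K) (x : M) :
    Coalgebra.counit (R := K) (rightContraction ψ x) = ψ x := by
  rw [apply_rightContraction, leftContraction_apply, Coalgebra.rTensor_counit_comul]
  simp

/-- By coassociativity both sides are $\psi(x^3)\,x^1\otimes x^2$. -/
theorem comul_rightContraction (ψ : M →ₗ[K] K) (x : M) :
    Coalgebra.comul (R := K) (rightContraction ψ x) =
      (rightContraction ψ).lTensor M (Coalgebra.comul x) := by
  have e : ∀ t : M ⊗[K] M, Coalgebra.comul (TensorProduct.rid K M (ψ.lTensor M t)) =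
      ((TensorProduct.rid K M).toLinearMap ∘ₗ ψ.lTensor M).lTensor M
        (TensorProduct.assoc K M M M ((Coalgebra.comul (R := K)).rTensor M t)) := by
    intro t
    induction t with
    | zero => simp
    | add s t hs ht => simp only [map_add, hs, ht]
    | tmul x y =>
      simp only [LinearMap.lTensor_tmul, LinearMap.rTensor_tmul, TensorProduct.rid_tmul, map_smul]
      generalize Coalgebra.comul (R := K) x = t
      induction t with
      | zero => simp
      | tmul a b => simp
      | add a b ha hb => simp only [smul_add, TensorProduct.add_tmul, map_add, ha, hb]
  rw [rightContraction_apply, e, Coalgebra.coassoc_apply]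
  simp only [rightContraction, LinearMap.lTensor_comp, LinearMap.comp_apply]

theorem comul_leftContraction (ψ : M →ₗ[K] K) (x : M) :
    Coalgebra.comul (R := K) (leftContraction ψ x) =
      (leftContraction ψ).rTensor M (Coalgebra.comul x) := by
  have e : ∀ t : M ⊗[K] M, Coalgebra.comul (TensorProduct.lid K M (ψ.rTensor M t)) =
      ((TensorProduct.lid K M).toLinearMap ∘ₗ ψ.rTensor M).rTensor M
        ((TensorProduct.assoc K M M M).symm ((Coalgebra.comul (R := K)).lTensor M t)) := by
    intro t
    induction t with
    | zero => simp
    | add s t hs ht => simp only [map_add, hs, ht]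
    | tmul x y =>
      simp only [LinearMap.lTensor_tmul, LinearMap.rTensor_tmul, TensorProduct.lid_tmul, map_smul]
      generalize Coalgebra.comul (R := K) y = t
      induction t with
      | zero => simp
      | tmul a b => simp [TensorProduct.smul_tmul']
      | add a b ha hb => simp only [smul_add, TensorProduct.tmul_add, map_add, ha, hb]
  rw [leftContraction_apply, e, ← Coalgebra.coassoc_apply, LinearEquiv.symm_apply_apply]
  simp only [leftContraction, LinearMap.rTensor_comp, LinearMap.comp_apply]

/-- Both sides are $\psi(x^2)\,x^1\otimes x^3$: the contracted middle leg can be grouped with either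
neighbour. The two resulting forms of `hatMap` suit right and left multiplication respectively. -/
theorem rTensor_rightContraction_comul (ψ : M →ₗ[K] K) (x : M) :
    (rightContraction ψ).rTensor M (Coalgebra.comul x) =
      (leftContraction ψ).lTensor M (Coalgebra.comul x) := by
  have e : ∀ t : (M ⊗[K] M) ⊗[K] M,
      ((TensorProduct.lid K M).toLinearMap ∘ₗ ψ.rTensor M).lTensor M
        (TensorProduct.assoc K M M M t) =
      ((TensorProduct.rid K M).toLinearMap ∘ₗ ψ.lTensor M).rTensor M t := by
    have : ((TensorProduct.lid K M).toLinearMap ∘ₗ ψ.rTensor M).lTensor M ∘ₗ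
        (TensorProduct.assoc K M M M).toLinearMap =
        ((TensorProduct.rid K M).toLinearMap ∘ₗ ψ.lTensor M).rTensor M := by
      ext x y z
      simp [TensorProduct.smul_tmul]
    exact fun t => LinearMap.congr_fun this t
  have := e ((Coalgebra.comul).rTensor M (Coalgebra.comul x))
  rw [Coalgebra.coassoc_apply] at this
  simp only [leftContraction, rightContraction, ← LinearMap.comp_assoc, LinearMap.lTensor_comp,
    LinearMap.rTensor_comp, LinearMap.comp_apply] at this ⊢
  exact this.symm

theorem hatMap_tmul (v : M ⊗[K] M →ₗ[K] K) (α β : M) :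
    hatMap v (α ⊗ₜ[K] β) =
      (leftContraction (TensorProduct.curry v α)).lTensor M (Coalgebra.comul β) := by
  have h1 : ∀ s : M ⊗[K] M, TensorProduct.lid K M (v.rTensor M ((TensorProduct.assoc K M M M).symm
      (α ⊗ₜ[K] s))) = TensorProduct.lid K M ((TensorProduct.curry v α).rTensor M s) := by
    intro s
    induction s with
    | zero => simp
    | tmul x y => simp
    | add s t hs ht => simp only [TensorProduct.tmul_add, map_add, hs, ht]
  simp only [hatMap, LinearMap.comp_apply, LinearMap.lTensor_tmul, LinearEquiv.coe_coe]
  generalize Coalgebra.comul (R := K) β = t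
  induction t with
  | zero => simp
  | tmul x y => simp [leftContraction_apply, h1]
  | add s t hs ht => simp only [TensorProduct.tmul_add, map_add, hs, ht]

theorem hatMap_tmul' (v : M ⊗[K] M →ₗ[K] K) (α β : M) :
    hatMap v (α ⊗ₜ[K] β) =
      (rightContraction (TensorProduct.curry v α)).rTensor M (Coalgebra.comul β) := by
  rw [hatMap_tmul, rTensor_rightContraction_comul]

variable {v : M ⊗[K] M →ₗ[K] K}

theorem IsCyclicForm.hatMap_swap (hv : IsCyclicForm v) (α β : M) :
    hatMap v (β ⊗ₜ[K] α) = TensorProduct.comm K M M (hatMap v (α ⊗ₜ[K] β)) := by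
  have := LinearMap.congr_fun hv (α ⊗ₜ[K] β)
  simpa using this

/-- This contraction and the next arise when a double bracket takes a value $1\otimes a$ or
$a\otimes1$, as in the moment condition. -/
theorem lid_counit_hatMap (α β : M) :
    TensorProduct.lid K M (Coalgebra.counit.rTensor M (hatMap v (α ⊗ₜ[K] β))) =
      leftContraction (TensorProduct.curry v α) β := by
  rw [hatMap_tmul', leftContraction_apply, ← LinearMap.rTensor_comp_apply]
  congr 3
  ext x
  exact counit_rightContraction _ x

theorem rid_counit_hatMap (α β : M) :
    TensorProduct.rid K M (Coalgebra.counit.lTensor M (hatMap v (α ⊗ₜ[K] β))) =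
      rightContraction (TensorProduct.curry v α) β := by
  rw [hatMap_tmul, rightContraction_apply, ← LinearMap.lTensor_comp_apply]
  congr 3
  ext x
  exact counit_leftContraction _ x

/-- This is cyclicity with the counit applied to one leg. -/
theorem IsCyclicForm.leftContraction_eq (hv : IsCyclicForm v) (α β : M) :
    leftContraction (TensorProduct.curry v β) α = rightContraction (TensorProduct.curry v α) β := by
  rw [← lid_counit_hatMap, ← rid_counit_hatMap, hv.hatMap_swap α β]
  generalize hatMap v (α ⊗ₜ[K] β) = t
  induction t with
  | zero => simp
  | tmul x y => simp
  | add s t hs ht => simp only [map_add, hs, ht]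

theorem IsCyclicForm.symm (hv : IsCyclicForm v) (α β : M) :
    v (α ⊗ₜ[K] β) = v (β ⊗ₜ[K] α) := by
  have := congrArg (Coalgebra.counit (R := K)) (hv.leftContraction_eq α β)
  rw [counit_leftContraction, counit_rightContraction] at this
  simpa using this.symm

/-- A cyclic form is invariant under inner coderivations. -/
theorem IsCyclicForm.innerCoder_invariant (hv : IsCyclicForm v) (φ : M →ₗ[K] K) (α β : M) :
    v (innerCoder φ α ⊗ₜ[K] β) + v (α ⊗ₜ[K] innerCoder φ β) = 0 := by
  have h : ∀ α β : M, v (α ⊗ₜ[K] innerCoder φ β) =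
      φ (leftContraction (TensorProduct.curry v α) β) -
        φ (rightContraction (TensorProduct.curry v α) β) := by
    intro α β
    rw [apply_rightContraction, ← apply_rightContraction φ, innerCoder_eq]
    simp [TensorProduct.tmul_sub]
  -- The four terms cancel in pairs: cyclicity exchanges left and right contractions when $\alpha$
  -- and $\beta$ trade roles.
  rw [hv.symm, h, h, hv.leftContraction_eq α β, ← hv.leftContraction_eq β α]
  abel

/-- The coderivation distributes over $x^1\otimes x^2$; the part acting on the contracted leg
cancels by invariance of $v$. -/
theorem IsCyclicForm.leftContraction_innerCoder (hv : IsCyclicForm v) (φ : M →ₗ[K] K) (α x : M) :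
    leftContraction (TensorProduct.curry v (innerCoder φ α)) x +
      leftContraction (TensorProduct.curry v α) (innerCoder φ x) =
        innerCoder φ (leftContraction (TensorProduct.curry v α) x) := by
  have hd := LinearMap.congr_fun (isCoderivation_innerCoder φ) x
  simp only [LinearMap.comp_apply] at hd
  rw [leftContraction_apply, leftContraction_apply, leftContraction_apply, hd]
  generalize Coalgebra.comul (R := K) x = t
  induction t with
  | zero => simp
  | tmul y z =>
    have := hv.innerCoder_invariant φ α y
    simp only [LinearMap.add_apply, LinearMap.rTensor_tmul, LinearMap.lTensor_tmul, map_add,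
      TensorProduct.lid_tmul, TensorProduct.curry_apply, map_smul]
    rw [← add_assoc, ← add_smul, this, zero_smul, zero_add]
  | add s t hs ht =>
    simp only [map_add] at hs ht ⊢
    rw [← hs, ← ht]
    abel

/-- This equivariance is why $\delta_\varphi$ is a derivation of the bracket on generators. -/
theorem IsCyclicForm.hatMap_innerCoder (hv : IsCyclicForm v) (φ : M →ₗ[K] K) (α β : M) :
    hatMap v (innerCoder φ α ⊗ₜ[K] β) + hatMap v (α ⊗ₜ[K] innerCoder φ β) =
      ((innerCoder φ).rTensor M + (innerCoder φ).lTensor M) (hatMap v (α ⊗ₜ[K] β)) := by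
  have hd := LinearMap.congr_fun (isCoderivation_innerCoder φ) β
  simp only [LinearMap.comp_apply] at hd
  rw [hatMap_tmul, hatMap_tmul, hatMap_tmul, hd]
  generalize Coalgebra.comul (R := K) β = t
  induction t with
  | zero => simp
  | tmul y z =>
    have := hv.leftContraction_innerCoder φ α z
    simp only [LinearMap.add_apply, LinearMap.rTensor_tmul, LinearMap.lTensor_tmul, map_add,
      ← this, TensorProduct.tmul_add]
    abel
  | add s t hs ht =>
    simp only [map_add] at hs ht ⊢
    rw [← hs, ← ht]
    abel

/-- The element `v (α ⊗ γ²) v (β ⊗ γ⁴) γ¹ ⊗ γ³ ⊗ γ⁵` of `M ⊗ M ⊗ M`. -/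
def tripleHat (v : M ⊗[K] M →ₗ[K] K) (α β γ : M) : M ⊗[K] (M ⊗[K] M) :=
  TensorProduct.assoc K M M M
    ((TensorProduct.curry (hatMap v) α).rTensor M (hatMap v (β ⊗ₜ[K] γ)))

/-- Cyclicity converts the legs of $\gamma$ into legs of $\alpha$, one contraction at a time. This
matches the permutations $P_{312}$ in the tribracket. -/
theorem IsCyclicForm.tripleHat_rotate (hv : IsCyclicForm v) (α β γ : M) :
    TensorProduct.assoc K M M M (TensorProduct.comm K M (M ⊗[K] M) (tripleHat v α β γ)) =
      tripleHat v β γ α := by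
  -- $F(g\otimes g')$ is the map $x\mapsto v(g\otimes x)g'$; on $\Delta\gamma$ cyclicity rewrites it
  -- as $x\mapsto v(\gamma\otimes x^2)x^1$.
  let F : M ⊗[K] M →ₗ[K] M →ₗ[K] M := dualTensorHom K M M ∘ₗ (TensorProduct.curry v).rTensor M
  have hF : F (Coalgebra.comul γ) = rightContraction (TensorProduct.curry v γ) := by
    ext x
    rw [← hv.leftContraction_eq, leftContraction_apply]
    generalize Coalgebra.comul (R := K) γ = t
    induction t with
    | zero => simp
    | tmul a b => simp [F, hv.symm x]
    | add s t hs ht => simp only [map_add, LinearMap.add_apply, hs, ht]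
  -- Stated for an arbitrary $t$ in place of $\Delta\gamma$, so that `hatMap_swap` applies to each
  -- pure tensor separately.
  have key : ∀ t : M ⊗[K] M, TensorProduct.assoc K M M M (TensorProduct.comm K M (M ⊗[K] M)
      (TensorProduct.assoc K M M M ((TensorProduct.curry (hatMap v) α).rTensor M
        ((leftContraction (TensorProduct.curry v β)).lTensor M t)))) =
      ((leftContraction (TensorProduct.curry v β) ∘ₗ F t).rTensor M).lTensor M
        ((Coalgebra.comul (R := K)).lTensor M (Coalgebra.comul α)) := by
    intro t
    induction t with
    | zero => simp
    | add s t hs ht =>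
      simp only [map_add, hs, ht, LinearMap.comp_add, LinearMap.rTensor_add, LinearMap.lTensor_add,
        LinearMap.add_apply]
    | tmul g g' =>
      rw [LinearMap.lTensor_tmul, LinearMap.rTensor_tmul, TensorProduct.curry_apply,
        hv.hatMap_swap g α, hatMap_tmul]
      generalize Coalgebra.comul (R := K) α = s
      induction s with
      | zero => simp
      | add s t hs ht => simp only [map_add, TensorProduct.add_tmul, hs, ht]
      | tmul a a' =>
        simp only [LinearMap.lTensor_tmul, TensorProduct.comm_tmul, TensorProduct.assoc_tmul]
        rw [leftContraction_apply (TensorProduct.curry v g)]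
        generalize Coalgebra.comul (R := K) a' = u
        induction u with
        | zero => simp
        | add s t hs ht => simp only [map_add, TensorProduct.tmul_add, hs, ht]
        | tmul x y => simp [F, TensorProduct.smul_tmul]
  rw [tripleHat, tripleHat, hatMap_tmul, key, hF, hatMap_tmul', ← Coalgebra.coassoc_apply]
  generalize Coalgebra.comul (R := K) α = t
  induction t with
  | zero => simp
  | add s t hs ht => simp only [map_add, hs, ht]
  | tmul x y =>
    simp only [LinearMap.rTensor_tmul, TensorProduct.curry_apply, hatMap_tmul,
      comul_rightContraction, ← LinearMap.lTensor_comp_apply]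
    generalize Coalgebra.comul (R := K) x = u
    induction u with
    | zero => simp
    | add s t hs ht => simp only [map_add, TensorProduct.add_tmul, hs, ht]
    | tmul x y => simp

end CoalgebraContractions

/-! ### Linear maps on tensors tested on homogeneous elements -/

section TensorExt

theorem map_zsmul_tmul {K X Y N : Type*} [CommRing K] [AddCommGroup X] [Module K X]
    [AddCommGroup Y] [Module K Y] [AddCommGroup N] [Module K N] (f : X ⊗[K] Y →ₗ[K] N) (k : ℤ)
    (x : X) (y : Y) : f ((k • x) ⊗ₜ[K] y) = k • f (x ⊗ₜ[K] y) :=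
  map_zsmul (f ∘ₗ (TensorProduct.mk K X Y).flip y) k x

variable {K : Type*} [CommRing K] {A : Type*} [Ring A] [Algebra K A]
  (𝒜 : ℤ → Submodule K A) [GradedAlgebra 𝒜]

theorem tensor_linearMap_ext_homogeneous {N : Type*} [AddCommGroup N] [Module K N]
    {f g : A ⊗[K] A →ₗ[K] N}
    (h : ∀ p q, ∀ a ∈ 𝒜 p, ∀ b ∈ 𝒜 q, f (a ⊗ₜ[K] b) = g (a ⊗ₜ[K] b)) : f = g := by
  ext a b
  simp only [TensorProduct.AlgebraTensorModule.curry_apply, LinearMap.restrictScalars_self,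
    TensorProduct.curry_apply]
  induction a using DirectSum.Decomposition.inductionOn 𝒜 with
  | zero => simp
  | homogeneous a =>
    induction b using DirectSum.Decomposition.inductionOn 𝒜 with
    | zero => simp
    | homogeneous b => exact h _ _ _ a.2 _ b.2
    | add x y hx hy => rw [TensorProduct.tmul_add, map_add, map_add, hx, hy]
  | add x y hx hy => rw [TensorProduct.add_tmul, map_add, map_add, hx, hy]

end TensorExt

/-! ### The bracket on generators and the derivations it defines -/

namespace RepAlg

variable {K : Type u} [CommRing K] {A : Type v} [Ring A] [Algebra K A]
  {𝒜 : ℤ → Submodule K A} {M : Type w} [AddCommGroup M] [Module K M] [Coalgebra K M]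

variable (𝒜) in
/-- The value of the bracket of `A_M^+` on the generators. -/
def genBracket (db : A ⊗[K] A →ₗ[K] A ⊗[K] A) (v : M ⊗[K] M →ₗ[K] K) :
    A ⊗[K] M →ₗ[K] A ⊗[K] M →ₗ[K] RepAlg 𝒜 M :=
  TensorProduct.curry (pairEval (gen 𝒜 M) ∘ₗ TensorProduct.map db (hatMap v) ∘ₗ
    (TensorProduct.tensorTensorTensorComm K A M A M).toLinearMap)

@[simp]
theorem genBracket_tmul (db : A ⊗[K] A →ₗ[K] A ⊗[K] A) (v : M ⊗[K] M →ₗ[K] K) (a b : A)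
    (α β : M) : genBracket 𝒜 db v (a ⊗ₜ[K] α) (b ⊗ₜ[K] β) =
      pairEval (gen 𝒜 M) (db (a ⊗ₜ[K] b) ⊗ₜ[K] hatMap v (α ⊗ₜ[K] β)) := by
  simp [genBracket]

variable (𝒜 M) in
/-- The map `(a ⊗ b ⊗ c) ⊗ (α ⊗ β ⊗ γ) ↦ a_α b_β c_γ`. -/
def tripleEval : (A ⊗[K] (A ⊗[K] A)) ⊗[K] (M ⊗[K] (M ⊗[K] M)) →ₗ[K] RepAlg 𝒜 M :=
  LinearMap.mul' K (RepAlg 𝒜 M) ∘ₗ TensorProduct.map (gen 𝒜 M) (pairEval (gen 𝒜 M)) ∘ₗ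
    (TensorProduct.tensorTensorTensorComm K A (A ⊗[K] A) M (M ⊗[K] M)).toLinearMap

@[simp]
theorem tripleEval_tmul (a : A) (w : A ⊗[K] A) (α : M) (t : M ⊗[K] M) :
    tripleEval 𝒜 M ((a ⊗ₜ[K] w) ⊗ₜ[K] (α ⊗ₜ[K] t)) =
      gen 𝒜 M (a ⊗ₜ[K] α) * pairEval (gen 𝒜 M) (w ⊗ₜ[K] t) := by
  simp [tripleEval]

theorem pairEval_mem_grading {k : ℤ} {w : A ⊗[K] A} (hw : w ∈ tensorDegree 𝒜 k) (t : M ⊗[K] M) :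
    pairEval (gen 𝒜 M) (w ⊗ₜ[K] t) ∈ grading 𝒜 M k := by
  refine Submodule.span_induction
    (p := fun w _ => pairEval (gen 𝒜 M) (w ⊗ₜ[K] t) ∈ grading 𝒜 M k) ?_ ?_ ?_ ?_ hw
  · rintro _ ⟨i, j, rfl, x, hx, y, hy, rfl⟩
    induction t with
    | zero => simp
    | tmul α β =>
      rw [pairEval_tmul]
      exact SetLike.mul_mem_graded (gen_mem_grading 𝒜 hx α) (gen_mem_grading 𝒜 hy β)
    | add s t hs ht => rw [TensorProduct.tmul_add, map_add]; exact add_mem hs ht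
  · simp
  · intro x y _ _ hx hy; rw [TensorProduct.add_tmul, map_add]; exact add_mem hx hy
  · intro c x _ hx; rw [← TensorProduct.smul_tmul', map_smul]; exact Submodule.smul_mem _ _ hx

/-- With $w=\{\!\!\{a,b\}\!\!\}$ the right side is $\{a_\alpha,b_{\beta^1}\}c_{\beta^2}$. A left
contraction leaves the last leg free, so comultiplying it to split $(yc)_\mu$ commutes with
contracting. -/
theorem pairEval_mulRight (v : M ⊗[K] M →ₗ[K] K) (w : A ⊗[K] A) (c : A) (α β : M) :
    pairEval (gen 𝒜 M) ((LinearMap.mulRight K c).lTensor A w ⊗ₜ[K] hatMap v (α ⊗ₜ[K] β)) =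
      LinearMap.mul' K (RepAlg 𝒜 M) (TensorProduct.map
        (pairEval (gen 𝒜 M) ∘ₗ TensorProduct.mk K _ _ w ∘ₗ TensorProduct.curry (hatMap v) α)
        (gen 𝒜 M ∘ₗ TensorProduct.mk K _ _ c) (Coalgebra.comul β)) := by
  let L := leftContraction (TensorProduct.curry v α)
  induction w with
  | zero => simp
  | add w w' hw hw' =>
    simp only [map_add, TensorProduct.add_tmul, LinearMap.add_comp, LinearMap.comp_add,
      TensorProduct.map_add_left, LinearMap.add_apply, hw, hw']
  | tmul x y =>
    have h1 : ∀ s : M ⊗[K] M, pairEval (gen 𝒜 M) ((x ⊗ₜ[K] (y * c)) ⊗ₜ[K] L.lTensor M s) =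
        tripleEval 𝒜 M ((x ⊗ₜ[K] (y ⊗ₜ[K] c)) ⊗ₜ[K]
          (L.rTensor M).lTensor M (Coalgebra.comul.lTensor M s)) := by
      intro s
      induction s with
      | zero => simp
      | add s t hs ht => simp only [map_add, TensorProduct.tmul_add, hs, ht]
      | tmul μ ν => simp [gen_mul, L, comul_leftContraction]
    have h2 : ∀ t : M ⊗[K] M, LinearMap.mul' K (RepAlg 𝒜 M) (TensorProduct.map
        (pairEval (gen 𝒜 M) ∘ₗ TensorProduct.mk K _ _ (x ⊗ₜ[K] y) ∘ₗ
          TensorProduct.curry (hatMap v) α)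
        (gen 𝒜 M ∘ₗ TensorProduct.mk K _ _ c) t) =
        tripleEval 𝒜 M ((x ⊗ₜ[K] (y ⊗ₜ[K] c)) ⊗ₜ[K]
          (L.rTensor M).lTensor M (TensorProduct.assoc K M M M
            (Coalgebra.comul.rTensor M t))) := by
      intro t
      induction t with
      | zero => simp
      | add s t hs ht => simp only [map_add, TensorProduct.tmul_add, hs, ht]
      | tmul μ ν =>
        simp only [TensorProduct.map_tmul, LinearMap.comp_apply, TensorProduct.curry_apply,
          hatMap_tmul, TensorProduct.mk_apply, LinearMap.mul'_apply, LinearMap.rTensor_tmul]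
        generalize Coalgebra.comul (R := K) μ = u
        induction u with
        | zero => simp
        | add s t hs ht =>
          simp only [map_add, TensorProduct.tmul_add, TensorProduct.add_tmul, add_mul, hs, ht]
        | tmul μ μ' => simp [mul_assoc, L]
    rw [h2, Coalgebra.coassoc_apply, ← h1, hatMap_tmul]
    simp [L]

/-- Mirror image of `pairEval_mulRight`, based on the right-contraction form of `hatMap`. -/
theorem pairEval_mulLeft (v : M ⊗[K] M →ₗ[K] K) (w : A ⊗[K] A) (b : A) (α β : M) :
    pairEval (gen 𝒜 M) ((LinearMap.mulLeft K b).rTensor A w ⊗ₜ[K] hatMap v (α ⊗ₜ[K] β)) =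
      LinearMap.mul' K (RepAlg 𝒜 M) (TensorProduct.map
        (gen 𝒜 M ∘ₗ TensorProduct.mk K _ _ b)
        (pairEval (gen 𝒜 M) ∘ₗ TensorProduct.mk K _ _ w ∘ₗ TensorProduct.curry (hatMap v) α)
        (Coalgebra.comul β)) := by
  let L := rightContraction (TensorProduct.curry v α)
  induction w with
  | zero => simp
  | add w w' hw hw' =>
    simp only [map_add, TensorProduct.add_tmul, LinearMap.add_comp, LinearMap.comp_add,
      TensorProduct.map_add_right, LinearMap.add_apply, hw, hw']
  | tmul x y =>
    have h1 : ∀ s : M ⊗[K] M, pairEval (gen 𝒜 M) (((b * x) ⊗ₜ[K] y) ⊗ₜ[K] L.rTensor M s) =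
        tripleEval 𝒜 M ((b ⊗ₜ[K] (x ⊗ₜ[K] y)) ⊗ₜ[K]
          (L.rTensor M).lTensor M (TensorProduct.assoc K M M M
            (Coalgebra.comul.rTensor M s))) := by
      intro s
      induction s with
      | zero => simp
      | add s t hs ht => simp only [map_add, TensorProduct.tmul_add, hs, ht]
      | tmul μ ν =>
        simp only [LinearMap.rTensor_tmul, pairEval_tmul, gen_mul, L, comul_rightContraction]
        generalize Coalgebra.comul (R := K) μ = u
        induction u with
        | zero => simp
        | add s t hs ht =>
          simp only [map_add, TensorProduct.tmul_add, TensorProduct.add_tmul, add_mul, hs, ht]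
        | tmul μ μ' => simp [mul_assoc]
    have h2 : ∀ t : M ⊗[K] M, LinearMap.mul' K (RepAlg 𝒜 M) (TensorProduct.map
        (gen 𝒜 M ∘ₗ TensorProduct.mk K _ _ b)
        (pairEval (gen 𝒜 M) ∘ₗ TensorProduct.mk K _ _ (x ⊗ₜ[K] y) ∘ₗ
          TensorProduct.curry (hatMap v) α) t) =
        tripleEval 𝒜 M ((b ⊗ₜ[K] (x ⊗ₜ[K] y)) ⊗ₜ[K]
          (L.rTensor M).lTensor M (Coalgebra.comul.lTensor M t)) := by
      intro t
      induction t with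
      | zero => simp
      | add s t hs ht => simp only [map_add, TensorProduct.tmul_add, hs, ht]
      | tmul μ ν => simp [hatMap_tmul', L]
    rw [h2, ← Coalgebra.coassoc_apply, ← h1, hatMap_tmul']
    simp [L]

section Graded

variable [GradedAlgebra 𝒜]

theorem pairEval_gradedFlip (w : A ⊗[K] A) (t : M ⊗[K] M) :
    pairEval (gen 𝒜 M) (gradedFlip 𝒜 0 w ⊗ₜ[K] TensorProduct.comm K M M t) =
      pairEval (gen 𝒜 M) (w ⊗ₜ[K] t) := by
  induction t with
  | zero => simp
  | add s t hs ht => simp only [map_add, TensorProduct.tmul_add, hs, ht]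
  | tmul α β =>
    have : pairEval (gen 𝒜 M) ∘ₗ (TensorProduct.mk K _ _).flip (β ⊗ₜ[K] α) ∘ₗ gradedFlip 𝒜 0 =
        pairEval (gen 𝒜 M) ∘ₗ (TensorProduct.mk K _ _).flip (α ⊗ₜ[K] β) := by
      refine tensor_linearMap_ext_homogeneous 𝒜 fun p q a ha b hb => ?_
      simp only [LinearMap.comp_apply, gradedFlip_tmul 𝒜 0 p q ha hb, map_zsmul,
        LinearMap.flip_apply, TensorProduct.mk_apply, pairEval_tmul, gen_comm 𝒜 ha hb α β,
        add_zero]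
    exact LinearMap.congr_fun this w

variable {n : ℤ} {db : A ⊗[K] A →ₗ[K] A ⊗[K] A} {v : M ⊗[K] M →ₗ[K] K}

theorem genBracket_mem_grading (hdb : IsDoubleBracket 𝒜 n db) {p q : ℤ} {a b : A} (ha : a ∈ 𝒜 p)
    (hb : b ∈ 𝒜 q) (α β : M) :
    genBracket 𝒜 db v (a ⊗ₜ[K] α) (b ⊗ₜ[K] β) ∈ grading 𝒜 M (q + (p + n)) := by
  rw [genBracket_tmul, show q + (p + n) = p + q + n by ring]
  exact pairEval_mem_grading (hdb.graded p q a b ha hb) _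

theorem _root_.IsDoubleBracket.gradedFlip_apply (hdb : IsDoubleBracket 𝒜 n db) {p q : ℤ}
    {a b : A} (ha : a ∈ 𝒜 p) (hb : b ∈ 𝒜 q) :
    gradedFlip 𝒜 0 (db (a ⊗ₜ[K] b)) =
      -((((p + n) * (q + n)).negOnePow : ℤ) • db (b ⊗ₜ[K] a)) := by
  have := LinearMap.congr_fun hdb.antisymm (a ⊗ₜ[K] b)
  rw [LinearMap.comp_apply, gradedFlip_tmul 𝒜 n p q ha hb, map_zsmul] at this
  rw [this]
  simp

/-- Graded commutativity allows both tensors to be flipped at once. The flip on $A\otimes A$ is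
absorbed by the antisymmetry of the double bracket, the one on $M\otimes M$ by cyclicity. -/
theorem genBracket_antisymm (hdb : IsDoubleBracket 𝒜 n db) (hv : IsCyclicForm v) {p q : ℤ}
    {a b : A} (ha : a ∈ 𝒜 p) (hb : b ∈ 𝒜 q) (α β : M) :
    genBracket 𝒜 db v (a ⊗ₜ[K] α) (b ⊗ₜ[K] β) =
      -((((p + n) * (q + n)).negOnePow : ℤ) • genBracket 𝒜 db v (b ⊗ₜ[K] β) (a ⊗ₜ[K] α)) := by
  rw [genBracket_tmul, genBracket_tmul, ← pairEval_gradedFlip, hdb.gradedFlip_apply ha hb,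
    hv.hatMap_swap α β, TensorProduct.neg_tmul, map_neg, map_zsmul_tmul]

theorem genBracket_mul (hdb : IsDoubleBracket 𝒜 n db) {p q r : ℤ} {a b c : A} (ha : a ∈ 𝒜 p)
    (hb : b ∈ 𝒜 q) (hc : c ∈ 𝒜 r) (α β : M) :
    genBracket 𝒜 db v (a ⊗ₜ[K] α) ((b * c) ⊗ₜ[K] β) =
      mixedEval (genBracket 𝒜 db v (a ⊗ₜ[K] α)) (gen 𝒜 M)
          ((b ⊗ₜ[K] c) ⊗ₜ[K] Coalgebra.comul (R := K) β) +
        (((p + n) * q).negOnePow : ℤ) • mixedEval (gen 𝒜 M) (genBracket 𝒜 db v (a ⊗ₜ[K] α))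
          ((b ⊗ₜ[K] c) ⊗ₜ[K] Coalgebra.comul (R := K) β) := by
  rw [genBracket_tmul, hdb.leibniz_right p q r a b c ha hb hc, TensorProduct.add_tmul, map_add,
    map_zsmul_tmul, pairEval_mulRight, pairEval_mulLeft]
  generalize Coalgebra.comul (R := K) β = t
  congr 1
  · induction t with
    | zero => simp
    | add s t hs ht => simp only [map_add, TensorProduct.tmul_add, hs, ht]
    | tmul μ ν => simp
  · congr 1
    induction t with
    | zero => simp
    | add s t hs ht => simp only [map_add, TensorProduct.tmul_add, hs, ht]
    | tmul μ ν => simp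

/-- A graded family of maps on generators that extend to derivations extends linearly. -/
theorem exists_linear_gradedDer {N : Type*} [AddCommGroup N] [Module K N]
    (𝒩 : ℤ → Submodule K N) [DirectSum.Decomposition 𝒩] (n : ℤ)
    (f : ∀ p, 𝒩 p →ₗ[K] A ⊗[K] M →ₗ[K] RepAlg 𝒜 M)
    (h : ∀ p (x : 𝒩 p), ∃ D ∈ gradedDer (grading 𝒜 M) (p + n), ∀ t, D (gen 𝒜 M t) = f p x t) :
    ∃ F : N →ₗ[K] RepAlg 𝒜 M →ₗ[K] RepAlg 𝒜 M, ∀ p (x : 𝒩 p),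
      F x ∈ gradedDer (grading 𝒜 M) (p + n) ∧ ∀ t, F x (gen 𝒜 M t) = f p x t := by
  choose D hD hDf using h
  let G (p : ℤ) : 𝒩 p →ₗ[K] RepAlg 𝒜 M →ₗ[K] RepAlg 𝒜 M :=
    { toFun := D p
      map_add' := fun x y => gradedDer_ext (hD p _) (add_mem (hD p x) (hD p y))
        fun q a _ α => by simp [hDf]
      map_smul' := fun c x => gradedDer_ext (hD p _) (Submodule.smul_mem _ c (hD p x))
        fun q a _ α => by simp [hDf] }
  let F : N →ₗ[K] RepAlg 𝒜 M →ₗ[K] RepAlg 𝒜 M := DirectSum.toModule K ℤ _ G ∘ₗ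
    (DirectSum.decomposeLinearEquiv 𝒩).toLinearMap
  have hF : ∀ p (x : 𝒩 p), F x = D p x := by
    intro p x
    simp only [F, LinearMap.comp_apply, LinearEquiv.coe_coe,
      DirectSum.decomposeLinearEquiv_apply, DirectSum.decompose_coe, ← DirectSum.lof_eq_of K,
      DirectSum.toModule_lof]
    rfl
  exact ⟨F, fun p x => by rw [hF]; exact ⟨hD p x, hDf p x⟩⟩

/-- First extension: $\{a_\alpha,-\}$ becomes a derivation of the whole algebra. It exists by
`genBracket_mul` and is linear in $a$ and $\alpha$ because derivations are unique. -/
theorem exists_gen_adjoint (hdb : IsDoubleBracket 𝒜 n db) (v : M ⊗[K] M →ₗ[K] K) :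
    ∃ ad : A ⊗[K] M →ₗ[K] RepAlg 𝒜 M →ₗ[K] RepAlg 𝒜 M, ∀ p, ∀ a ∈ 𝒜 p, ∀ α,
      ad (a ⊗ₜ[K] α) ∈ gradedDer (grading 𝒜 M) (p + n) ∧
        ∀ t, ad (a ⊗ₜ[K] α) (gen 𝒜 M t) = genBracket 𝒜 db v (a ⊗ₜ[K] α) t := by
  have h : ∀ α : M, ∃ F : A →ₗ[K] RepAlg 𝒜 M →ₗ[K] RepAlg 𝒜 M, ∀ p (a : 𝒜 p),
      F a ∈ gradedDer (grading 𝒜 M) (p + n) ∧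
        ∀ t, F a (gen 𝒜 M t) = genBracket 𝒜 db v ((a : A) ⊗ₜ[K] α) t := by
    intro α
    exact exists_linear_gradedDer 𝒜 n
      (fun p => genBracket 𝒜 db v ∘ₗ (TensorProduct.mk K A M).flip α ∘ₗ (𝒜 p).subtype)
      fun p a => exists_gradedDer (p + n) (genBracket 𝒜 db v ((a : A) ⊗ₜ[K] α))
        (fun q b hb β => genBracket_mem_grading hdb a.2 hb α β)
        (fun q r b hb c hc β => genBracket_mul hdb a.2 hb hc α β)
  choose F hF using h
  have hF' : ∀ p, ∀ a ∈ 𝒜 p, ∀ α, F α a ∈ gradedDer (grading 𝒜 M) (p + n) ∧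
      ∀ t, F α a (gen 𝒜 M t) = genBracket 𝒜 db v (a ⊗ₜ[K] α) t :=
    fun p a ha α => hF α p ⟨a, ha⟩
  have hadd : ∀ (a : A) (α β : M), F (α + β) a = F α a + F β a := by
    intro a α β
    induction a using DirectSum.Decomposition.inductionOn 𝒜 with
    | zero => simp
    | add a b ha hb => rw [map_add, map_add, map_add, ha, hb]; abel
    | @homogeneous p a =>
      refine gradedDer_ext (hF' p a a.2 _).1 (add_mem (hF' p a a.2 _).1 (hF' p a a.2 _).1)
        fun q b hb γ => ?_
      rw [LinearMap.add_apply, (hF' p a a.2 _).2, (hF' p a a.2 _).2, (hF' p a a.2 _).2,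
        TensorProduct.tmul_add, map_add, LinearMap.add_apply]
  have hsmul : ∀ (c : K) (a : A) (α : M), F (c • α) a = c • F α a := by
    intro c a α
    induction a using DirectSum.Decomposition.inductionOn 𝒜 with
    | zero => simp
    | add a b ha hb => rw [map_add, map_add, ha, hb, smul_add]
    | @homogeneous p a =>
      refine gradedDer_ext (hF' p a a.2 _).1 (Submodule.smul_mem _ c (hF' p a a.2 _).1)
        fun q b hb γ => ?_
      rw [LinearMap.smul_apply, (hF' p a a.2 _).2, (hF' p a a.2 _).2,
        TensorProduct.tmul_smul, map_smul, LinearMap.smul_apply]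
  exact ⟨TensorProduct.lift (LinearMap.mk₂ K (fun a α => F α a) (fun a b α => map_add _ _ _)
    (fun c a α => map_smul _ _ _) hadd hsmul), hF'⟩

end Graded

end RepAlg

/-! ### Existence and uniqueness of the induced bracket -/

namespace RepAlg

variable {K : Type u} [CommRing K] {A : Type v} [Ring A] [Algebra K A]
  {𝒜 : ℤ → Submodule K A} {M : Type w} [AddCommGroup M] [Module K M] [Coalgebra K M]
  [GradedAlgebra 𝒜] {n : ℤ} {db : A ⊗[K] A →ₗ[K] A ⊗[K] A} {v : M ⊗[K] M →ₗ[K] K}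

section Adjoint

variable {ad : A ⊗[K] M →ₗ[K] RepAlg 𝒜 M →ₗ[K] RepAlg 𝒜 M}

-- Evaluating in the endomorphism algebra, with generators acting by left multiplication, yields
-- sums of operators $b_\mu\,\mathrm{ad}(c_\nu)$.
omit [GradedAlgebra 𝒜] in
theorem adjoint_mul_tmul_mem_gradedDer
    (had : ∀ p, ∀ a ∈ 𝒜 p, ∀ α, ad (a ⊗ₜ[K] α) ∈ gradedDer (grading 𝒜 M) (p + n)) {q r : ℤ}
    {b c : A} (hb : b ∈ 𝒜 q) (hc : c ∈ 𝒜 r) (t : M ⊗[K] M) :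
    mixedEval (LinearMap.mul K (RepAlg 𝒜 M) ∘ₗ gen 𝒜 M) (R := Module.End K (RepAlg 𝒜 M)) ad
      ((b ⊗ₜ[K] c) ⊗ₜ[K] t) ∈ gradedDer (grading 𝒜 M) (q + r + n) := by
  induction t with
  | zero => rw [TensorProduct.tmul_zero, map_zero]; exact zero_mem _
  | add s t hs ht => rw [TensorProduct.tmul_add, map_add]; exact add_mem hs ht
  | tmul μ ν =>
    rw [mixedEval_tmul]
    exact gradedDer_congr (mulLeft_comp_mem_gradedDer (gen_mem_grading 𝒜 hb μ) (had r c hc ν))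
      (by ring)

omit [GradedAlgebra 𝒜] in
theorem mixedEval_end_apply (w : A ⊗[K] A) (t : M ⊗[K] M) (x : RepAlg 𝒜 M) :
    (mixedEval (LinearMap.mul K (RepAlg 𝒜 M) ∘ₗ gen 𝒜 M) (R := Module.End K (RepAlg 𝒜 M)) ad
      (w ⊗ₜ[K] t)) x = mixedEval (gen 𝒜 M) (ad.flip x) (w ⊗ₜ[K] t) := by
  have : LinearMap.applyₗ x ∘ₗ mixedEval (LinearMap.mul K (RepAlg 𝒜 M) ∘ₗ gen 𝒜 M)
      (R := Module.End K (RepAlg 𝒜 M)) ad = mixedEval (gen 𝒜 M) (ad.flip x) := by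
    ext a b α β
    simp
  exact LinearMap.congr_fun this (w ⊗ₜ[K] t)

variable (hdb : IsDoubleBracket 𝒜 n db) (hv : IsCyclicForm v)
  (had : ∀ p, ∀ a ∈ 𝒜 p, ∀ α, ad (a ⊗ₜ[K] α) ∈ gradedDer (grading 𝒜 M) (p + n) ∧
    ∀ t, ad (a ⊗ₜ[K] α) (gen 𝒜 M t) = genBracket 𝒜 db v (a ⊗ₜ[K] α) t)

include hdb hv had

/-- The Leibniz rule in the first slot. Both sides are derivations in $x$; on generators
antisymmetry moves the product to the second slot, where `genBracket_mul` applies. -/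
theorem adjoint_mul {q r : ℤ} {b c : A} (hb : b ∈ 𝒜 q) (hc : c ∈ 𝒜 r) (β : M)
    (x : RepAlg 𝒜 M) :
    ad ((b * c) ⊗ₜ[K] β) x =
      mixedEval (gen 𝒜 M) (ad.flip x) ((b ⊗ₜ[K] c) ⊗ₜ[K] Coalgebra.comul β) +
        ((q * r).negOnePow : ℤ) • mixedEval (gen 𝒜 M) (ad.flip x)
          ((c ⊗ₜ[K] b) ⊗ₜ[K] TensorProduct.comm K M M (Coalgebra.comul β)) := by
  have had' := fun p a ha α => (had p a ha α).1
  have h1 := (had (q + r) (b * c) (SetLike.mul_mem_graded hb hc) β).1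
  have h2 := add_mem (adjoint_mul_tmul_mem_gradedDer had' hb hc (Coalgebra.comul β))
    (negOnePow_smul_gradedDer (gradedDer_congr (adjoint_mul_tmul_mem_gradedDer had' hc hb
      (TensorProduct.comm K M M (Coalgebra.comul β))) (show r + q + n = q + r + n by ring)) (q * r))
  have h := gradedDer_ext h1 h2 (fun p a ha α => ?_)
  · rw [h, ← mixedEval_end_apply, ← mixedEval_end_apply]
    rfl
  · rw [LinearMap.add_apply, LinearMap.smul_apply, mixedEval_end_apply, mixedEval_end_apply,
      (had _ _ (SetLike.mul_mem_graded hb hc) β).2,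
      genBracket_antisymm hdb hv (SetLike.mul_mem_graded hb hc) ha, genBracket_mul hdb ha hb hc]
    generalize Coalgebra.comul (R := K) β = t
    induction t with
    | zero => simp
    | add s t hs ht =>
      simp only [TensorProduct.tmul_add, map_add, smul_add] at hs ht ⊢
      rw [add_add_add_comm, neg_add, hs, ht]
      abel
    | tmul μ ν =>
      have e1 := mul_comm_graded (gen_mem_grading 𝒜 hc ν)
        (genBracket_mem_grading (v := v) hdb ha hb α μ)
      simp only [mixedEval_tmul, TensorProduct.comm_tmul, LinearMap.flip_apply,
        (had q b hb μ).2, (had r c hc ν).2]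
      rw [genBracket_antisymm hdb hv hb ha, genBracket_antisymm hdb hv hc ha]
      simp only [mul_neg, mul_smul_comm, e1, smul_neg, smul_add, negOnePow_smul_smul, neg_add]
      refine (add_comm _ _).trans ?_
      congr 1 <;> exact congrArg Neg.neg (negOnePow_smul_congr (by grind) _)

/-- Second extension: antisymmetry forces the values of $\{x,-\}$ on generators, and `adjoint_mul`
is the compatibility needed to extend them. -/
theorem exists_bracket_apply_gen {p : ℤ} {x : RepAlg 𝒜 M} (hx : x ∈ grading 𝒜 M p)
    {f : A ⊗[K] M →ₗ[K] RepAlg 𝒜 M} (hf : ∀ q, ∀ b ∈ 𝒜 q, ∀ β, f (b ⊗ₜ[K] β) =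
      -((((p + n) * (q + n)).negOnePow : ℤ) • ad (b ⊗ₜ[K] β) x)) :
    ∃ D ∈ gradedDer (grading 𝒜 M) (p + n), ∀ t, D (gen 𝒜 M t) = f t := by
  refine exists_gradedDer (p + n) f (fun q b hb β => ?_) (fun q r b hb c hc β => ?_)
  · rw [hf q b hb β, show q + (p + n) = p + (q + n) by ring]
    exact neg_mem (negOnePow_smul_mem _ _ (gradedDer_apply_mem (had q b hb β).1 hx))
  · rw [hf _ _ (SetLike.mul_mem_graded hb hc), adjoint_mul hdb hv had hb hc]
    generalize Coalgebra.comul (R := K) β = t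
    induction t with
    | zero => simp
    | add s t hs ht =>
      simp only [TensorProduct.tmul_add, map_add, smul_add] at hs ht ⊢
      rw [add_add_add_comm, neg_add, hs, ht]
      abel
    | tmul μ ν =>
      have e1 := mul_comm_graded (gen_mem_grading 𝒜 hc ν)
        (gradedDer_apply_mem (had q b hb μ).1 hx)
      simp only [mixedEval_tmul, TensorProduct.comm_tmul, LinearMap.flip_apply, hf q b hb,
        hf r c hc, mul_neg, neg_mul, mul_smul_comm, smul_mul_assoc, e1, smul_neg, smul_add,
        negOnePow_smul_smul, neg_add]
      refine (add_comm _ _).trans ?_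
      congr 1 <;> exact congrArg Neg.neg (negOnePow_smul_congr (by grind) _)

theorem exists_bracket :
    ∃ br : RepAlg 𝒜 M →ₗ[K] RepAlg 𝒜 M →ₗ[K] RepAlg 𝒜 M,
      (∀ p, ∀ x ∈ grading 𝒜 M p, br x ∈ gradedDer (grading 𝒜 M) (p + n)) ∧
      ∀ p q, ∀ x ∈ grading 𝒜 M p, ∀ b ∈ 𝒜 q, ∀ β, br x (gen 𝒜 M (b ⊗ₜ[K] β)) =
        -((((p + n) * (q + n)).negOnePow : ℤ) • ad (b ⊗ₜ[K] β) x) := by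
  -- The sign $(-1)^{|x|_n|b|_n}$ is split as $(-1)^{|x|_nn}$ times a sign twist of $b$, which makes
  -- the formula linear in $b$.
  let f (p : ℤ) : grading 𝒜 M p →ₗ[K] A ⊗[K] M →ₗ[K] RepAlg 𝒜 M :=
    -((((p + n) * n).negOnePow : ℤ) •
      ((ad ∘ₗ (signTwist 𝒜 (p + n)).rTensor M).flip ∘ₗ (grading 𝒜 M p).subtype))
  have hf : ∀ p (x : grading 𝒜 M p) q, ∀ b ∈ 𝒜 q, ∀ β, f p x (b ⊗ₜ[K] β) =
      -((((p + n) * (q + n)).negOnePow : ℤ) • ad (b ⊗ₜ[K] β) x) := by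
    intro p x q b hb β
    have : f p x (b ⊗ₜ[K] β) = -((((p + n) * n).negOnePow : ℤ) •
      ad ((signTwist 𝒜 (p + n) b) ⊗ₜ[K] β) x) := rfl
    rw [this, signTwist_apply 𝒜 (p + n) q hb, map_zsmul_tmul, LinearMap.smul_apply,
      negOnePow_smul_smul, ← mul_add, add_comm n q]
  obtain ⟨br, hbr⟩ := exists_linear_gradedDer (grading 𝒜 M) n f
    fun p x => exists_bracket_apply_gen hdb hv had x.2 (hf p x)
  refine ⟨br, fun p x hx => (hbr p ⟨x, hx⟩).1, fun p q x hx b hb β => ?_⟩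
  rw [← hf p ⟨x, hx⟩ q b hb β]
  exact (hbr p ⟨x, hx⟩).2 _

end Adjoint

theorem biderivation_mem_gradedDer {br : RepAlg 𝒜 M →ₗ[K] RepAlg 𝒜 M →ₗ[K] RepAlg 𝒜 M}
    (h : IsGradedBiderivation (grading 𝒜 M) n br) {p : ℤ} {x : RepAlg 𝒜 M}
    (hx : x ∈ grading 𝒜 M p) : br x ∈ gradedDer (grading 𝒜 M) (p + n) := by
  refine ⟨fun q y hy => ?_, fun q y hy z => ?_⟩
  · rw [show q + (p + n) = p + q + n by ring]
    exact h.graded p q x y hx hy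
  · induction z using DirectSum.Decomposition.inductionOn (grading 𝒜 M) with
    | zero => simp
    | homogeneous z => exact h.leibniz_right p q _ x y z hx hy z.2
    | add z w hz hw => simp only [mul_add, map_add, hz, hw, smul_add]; abel

/-- The induced bracket in `A_M^+` exists. -/
theorem exists_isInducedBracket (hdb : IsDoubleBracket 𝒜 n db) (hv : IsCyclicForm v) :
    ∃ br : RepAlg 𝒜 M →ₗ[K] RepAlg 𝒜 M →ₗ[K] RepAlg 𝒜 M, IsInducedBracket 𝒜 n db v br := by
  obtain ⟨ad, had⟩ := exists_gen_adjoint hdb v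
  obtain ⟨br, hbr, hbr'⟩ := exists_bracket hdb hv had
  -- The two extensions agree on generators, by antisymmetry there.
  have hgen : ∀ p, ∀ a ∈ 𝒜 p, ∀ α, br (gen 𝒜 M (a ⊗ₜ[K] α)) = ad (a ⊗ₜ[K] α) := by
    intro p a ha α
    refine gradedDer_ext (hbr p _ (gen_mem_grading 𝒜 ha α)) (had p a ha α).1 fun q b hb β => ?_
    rw [hbr' p q _ (gen_mem_grading 𝒜 ha α) b hb, (had p a ha α).2, (had q b hb β).2,
      genBracket_antisymm hdb hv ha hb]
  have hleft : ∀ p q, ∀ x ∈ grading 𝒜 M p, ∀ y ∈ grading 𝒜 M q, br (x * y) =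
      LinearMap.mulLeft K x ∘ₗ br y + ((p * q).negOnePow : ℤ) • (LinearMap.mulLeft K y ∘ₗ br x) := by
    intro p q x hx y hy
    have hxy := SetLike.mul_mem_graded hx hy
    refine gradedDer_ext (hbr _ _ hxy) (add_mem
      (gradedDer_congr (mulLeft_comp_mem_gradedDer hx (hbr q y hy)) (add_assoc _ _ _).symm)
      (negOnePow_smul_gradedDer (gradedDer_congr (mulLeft_comp_mem_gradedDer hy (hbr p x hx))
        (by ring)) _)) fun r c hc γ => ?_
    have e := mul_comm_graded (gradedDer_apply_mem (had r c hc γ).1 hx) hy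
    simp only [LinearMap.add_apply, LinearMap.smul_apply, LinearMap.comp_apply,
      LinearMap.mulLeft_apply, hbr' _ r _ hxy c hc, hbr' _ r _ hx c hc, hbr' _ r _ hy c hc,
      gradedDer_mul (had r c hc γ).1 hx, e, mul_neg, mul_smul_comm, smul_neg, smul_add,
      negOnePow_smul_smul, neg_add]
    refine (add_comm _ _).trans ?_
    congr 1 <;> exact congrArg Neg.neg (negOnePow_smul_congr (by grind) _)
  have hanti : ∀ p q, ∀ x ∈ grading 𝒜 M p, ∀ y ∈ grading 𝒜 M q,
      br x y = -((((p + n) * (q + n)).negOnePow : ℤ) • br y x) := by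
    intro p q x hx y hy
    refine homogeneous_induction (P := fun q y =>
      br x y = -((((p + n) * (q + n)).negOnePow : ℤ) • br y x)) ?_ ?_ ?_ ?_ ?_ hy
    · simp
    · intro q y z hy hz
      rw [map_add, map_add, LinearMap.add_apply, hy, hz, smul_add, neg_add]
    · intro q c y hy
      rw [map_smul, map_smul, LinearMap.smul_apply, hy, smul_neg, smul_comm]
    -- Both $\{x,1\}$ and $\{1,x\}$ vanish, by the Leibniz rules at $1\cdot1$.
    · have h1 := gradedDer_mul (hbr p x hx) (SetLike.GradedOne.one_mem (A := grading 𝒜 M)) 1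
      have h2 := LinearMap.congr_fun (hleft 0 0 1 SetLike.GradedOne.one_mem 1
        SetLike.GradedOne.one_mem) x
      simp only [mul_zero, negOnePow_smul_even Even.zero, mul_one, one_mul,
        left_eq_add] at h1
      simp only [mul_zero, negOnePow_smul_even Even.zero, mul_one, one_mul, LinearMap.add_apply,
        LinearMap.comp_apply, LinearMap.mulLeft_apply, left_eq_add] at h2
      rw [h1, h2, smul_zero, neg_zero]
    · intro q r b β y hb hy h
      have hg := gen_mem_grading 𝒜 hb β
      have e := mul_comm_graded (gradedDer_apply_mem (had q b hb β).1 hx) hy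
      rw [gradedDer_mul (hbr p x hx) hg, hleft q r _ hg y hy, hbr' p q x hx b hb, h,
        hgen q b hb]
      simp only [LinearMap.add_apply, LinearMap.smul_apply, LinearMap.comp_apply,
        LinearMap.mulLeft_apply, neg_mul, smul_mul_assoc, e, mul_neg, mul_smul_comm, smul_neg,
        smul_add, negOnePow_smul_smul, neg_add]
      refine (add_comm _ _).trans ?_
      congr 1 <;> exact congrArg Neg.neg (negOnePow_smul_congr (by grind) _)
  refine ⟨br, ⟨?_, fun p q r a b c ha hb _ => gradedDer_mul (hbr p a ha) hb c, ?_,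
    fun p q x y hx hy => hanti p q x hx y hy⟩, ?_⟩
  · intro p q a b ha hb
    rw [show p + q + n = q + (p + n) by ring]
    exact gradedDer_apply_mem (hbr p a ha) hb
  · intro p q r a b c ha hb hc
    have e := mul_comm_graded hb (gradedDer_apply_mem (hbr p a ha) hc)
    rw [hleft p q a ha b hb]
    simp only [LinearMap.add_apply, LinearMap.smul_apply, LinearMap.comp_apply,
        LinearMap.mulLeft_apply, e, negOnePow_smul_smul]
    congr 1
    exact negOnePow_smul_congr (by grind) _
  · intro a b α β
    rw [← genBracket_tmul]
    induction a using DirectSum.Decomposition.inductionOn 𝒜 with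
    | zero => simp
    | homogeneous a => rw [hgen _ a a.2, (had _ a a.2 α).2]
    | add a a' h h' => simp only [TensorProduct.add_tmul, map_add, LinearMap.add_apply, h, h']

section Induced

variable {br : RepAlg 𝒜 M →ₗ[K] RepAlg 𝒜 M →ₗ[K] RepAlg 𝒜 M}

theorem IsInducedBracket.unique (h : IsInducedBracket 𝒜 n db v br)
    {br₁ : RepAlg 𝒜 M →ₗ[K] RepAlg 𝒜 M →ₗ[K] RepAlg 𝒜 M} (h₁ : IsInducedBracket 𝒜 n db v br₁) :
    br₁ = br := by
  have hgen : ∀ p, ∀ a ∈ 𝒜 p, ∀ α,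
      br₁ (gen 𝒜 M (a ⊗ₜ[K] α)) = br (gen 𝒜 M (a ⊗ₜ[K] α)) := by
    intro p a ha α
    refine gradedDer_ext (biderivation_mem_gradedDer h₁.biderivation (gen_mem_grading 𝒜 ha α))
      (biderivation_mem_gradedDer h.biderivation (gen_mem_grading 𝒜 ha α)) fun q b hb β => ?_
    rw [h.apply_gen, h₁.apply_gen]
  refine linearMap_ext_homogeneous fun p x hx => gradedDer_ext
    (biderivation_mem_gradedDer h₁.biderivation hx)
    (biderivation_mem_gradedDer h.biderivation hx) fun q b hb β => ?_
  -- Antisymmetry puts the generator first, where the brackets already agree.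
  rw [h.biderivation.antisymm p q _ _ hx (gen_mem_grading 𝒜 hb β),
    h₁.biderivation.antisymm p q _ _ hx (gen_mem_grading 𝒜 hb β), hgen q b hb]

end Induced

end RepAlg

/-! ### Homogeneous submodules and subalgebras -/

section HomogeneousSubalgebras

variable {K : Type*} [CommRing K] {C : Type*} [Ring C] [Algebra K C]
  (𝒞 : ℤ → Submodule K C) [GradedAlgebra 𝒞]

/-- Linear maps of degree zero commute with taking homogeneous components. -/
theorem decompose_apply_of_degree_zero {C' : Type*} [Ring C'] [Algebra K C']
    (𝒞' : ℤ → Submodule K C') [GradedAlgebra 𝒞'] (f : C →ₗ[K] C')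
    (hf : ∀ p, ∀ x ∈ 𝒞 p, f x ∈ 𝒞' p) (x : C) (i : ℤ) :
    (DirectSum.decompose 𝒞' (f x) i : C') = f (DirectSum.decompose 𝒞 x i) := by
  induction x using DirectSum.Decomposition.inductionOn 𝒞 with
  | zero => simp
  | @homogeneous p x =>
    by_cases h : p = i
    · subst h
      rw [DirectSum.decompose_of_mem_same 𝒞' (hf _ _ x.2), DirectSum.decompose_of_mem_same 𝒞 x.2]
    · rw [DirectSum.decompose_of_mem_ne 𝒞' (hf _ _ x.2) h, DirectSum.decompose_of_mem_ne 𝒞 x.2 h,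
        map_zero]
  | add x y hx hy => simp [hx, hy]

/-- An element of a homogeneous submodule satisfies an additive property if its components do. -/
theorem homogeneous_submodule_induction {E : Submodule K C}
    (hE : ∀ x ∈ E, ∀ i, (DirectSum.decompose 𝒞 x i : C) ∈ E) {P : C → Prop} (zero : P 0)
    (add : ∀ x y, P x → P y → P (x + y)) {x : C} (hx : x ∈ E)
    (hom : ∀ p, ∀ y ∈ 𝒞 p, y ∈ E → P y) : P x := by
  classical
  rw [← DirectSum.sum_support_decompose 𝒞 x]
  exact Finset.sum_induction _ P add zero
    fun i _ => hom i _ (DirectSum.decompose 𝒞 x i).2 (hE x hx i)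

theorem isInternal_subalgebraGrading (S : Subalgebra K C)
    (hS : ∀ x ∈ S, ∀ i, (DirectSum.decompose 𝒞 x i : C) ∈ S) :
    DirectSum.IsInternal (subalgebraGrading 𝒞 S) := by
  classical
  -- The components of a formal sum are recovered from its value in $C$; this gives injectivity.
  -- Homogeneity of $S$ gives surjectivity.
  have key : ∀ (z : ⨁ i, subalgebraGrading 𝒞 S i) (i : ℤ),
      (DirectSum.decompose 𝒞
        (DirectSum.coeAddMonoidHom (subalgebraGrading 𝒞 S) z : C) i : C) = (z i : S) := by
    intro z i
    induction z using DirectSum.induction_on with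
    | zero => simp
    | of p x =>
      have hx : ((x : S) : C) ∈ 𝒞 p := x.2
      rw [DirectSum.coeAddMonoidHom_of]
      by_cases h : p = i
      · subst h
        rw [DirectSum.decompose_of_mem_same 𝒞 hx, DirectSum.of_eq_same]
      · rw [DirectSum.decompose_of_mem_ne 𝒞 hx h, DirectSum.of_eq_of_ne _ _ _ (Ne.symm h)]
        rfl
    | add x y hx hy => simp [hx, hy]
  refine ⟨fun z z' h => ?_, fun x => ?_⟩
  · ext i
    rw [← key, ← key, h]
  · refine ⟨∑ i ∈ (DirectSum.decompose 𝒞 (x : C)).support,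
      DirectSum.of (fun i => subalgebraGrading 𝒞 S i) i
        ⟨⟨DirectSum.decompose 𝒞 (x : C) i, hS x x.2 i⟩, (DirectSum.decompose 𝒞 (x : C) i).2⟩, ?_⟩
    rw [map_sum]
    simp only [DirectSum.coeAddMonoidHom_of]
    ext
    rw [AddSubmonoidClass.coe_finsetSum]
    exact DirectSum.sum_support_decompose 𝒞 (x : C)

end HomogeneousSubalgebras

/-! ### Inner coderivations, invariants and the behaviour of degrees -/

namespace RepAlg

variable {K : Type u} [CommRing K] {A : Type v} [Ring A] [Algebra K A]
  {𝒜 : ℤ → Submodule K A} {M : Type w} [AddCommGroup M] [Module K M] [Coalgebra K M]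

section CoderAct

variable (𝒜)

theorem coderAct_mem_grading {d : M →ₗ[K] M} (hd : IsCoderivation d) {p : ℤ} {x : RepAlg 𝒜 M}
    (hx : x ∈ grading 𝒜 M p) : coderAct 𝒜 d hd x ∈ grading 𝒜 M p := by
  refine homogeneous_induction (P := fun p x => coderAct 𝒜 d hd x ∈ grading 𝒜 M p)
    ?_ ?_ ?_ ?_ ?_ hx
  · intro p; rw [map_zero]; exact zero_mem _
  · intro p x y hx hy; rw [map_add]; exact add_mem hx hy
  · intro p c x hx; rw [map_smul]; exact Submodule.smul_mem _ _ hx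
  · rw [← map_one (algebraMap K (RepAlg 𝒜 M)), coderAct_algebraMap]; exact zero_mem _
  · intro p q a α y ha hy h
    rw [coderAct_mul, coderAct_gen]
    exact add_mem (SetLike.mul_mem_graded (gen_mem_grading 𝒜 ha _) hy)
      (SetLike.mul_mem_graded (gen_mem_grading 𝒜 ha _) h)

theorem coderAct_mem_gradedDer {d : M →ₗ[K] M} (hd : IsCoderivation d) :
    coderAct 𝒜 d hd ∈ gradedDer (grading 𝒜 M) 0 := by
  refine ⟨fun p x hx => by rw [add_zero]; exact coderAct_mem_grading 𝒜 hd hx,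
    fun p x _ y => ?_⟩
  rw [zero_mul, negOnePow_smul_even Even.zero, coderAct_mul]

theorem coderAct_pairEval {d : M →ₗ[K] M} (hd : IsCoderivation d) (w : A ⊗[K] A) (t : M ⊗[K] M) :
    coderAct 𝒜 d hd (pairEval (gen 𝒜 M) (w ⊗ₜ[K] t)) =
      pairEval (gen 𝒜 M) (w ⊗ₜ[K] (d.rTensor M + d.lTensor M) t) := by
  have : coderAct 𝒜 d hd ∘ₗ pairEval (gen 𝒜 M) = pairEval (gen 𝒜 M) ∘ₗ
      (d.rTensor M + d.lTensor M).lTensor (A ⊗[K] A) := by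
    ext a b α β
    simp [coderAct_mul]
  exact LinearMap.congr_fun this (w ⊗ₜ[K] t)

end CoderAct

variable [GradedAlgebra 𝒜] {n : ℤ} {db : A ⊗[K] A →ₗ[K] A ⊗[K] A} {v : M ⊗[K] M →ₗ[K] K}
  {br : RepAlg 𝒜 M →ₗ[K] RepAlg 𝒜 M →ₗ[K] RepAlg 𝒜 M}

/-- Inner coderivations act on `A_M^+` by derivations of the induced bracket. -/
theorem IsInducedBracket.coderAct_bracket (h : IsInducedBracket 𝒜 n db v br) (hv : IsCyclicForm v)
    (φ : M →ₗ[K] K) (x y : RepAlg 𝒜 M) :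
    coderAct 𝒜 (innerCoder φ) (isCoderivation_innerCoder φ) (br x y) =
      br (coderAct 𝒜 (innerCoder φ) (isCoderivation_innerCoder φ) x) y +
        br x (coderAct 𝒜 (innerCoder φ) (isCoderivation_innerCoder φ) y) := by
  set δ := coderAct 𝒜 (innerCoder φ) (isCoderivation_innerCoder φ) with hδ
  have hδ0 : δ ∈ gradedDer (grading 𝒜 M) 0 := coderAct_mem_gradedDer 𝒜 _
  have hδmem : ∀ p, ∀ x ∈ grading 𝒜 M p, δ x ∈ grading 𝒜 M p :=
    fun p x hx => coderAct_mem_grading 𝒜 _ hx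
  have hbr := fun (p : ℤ) (x : RepAlg 𝒜 M) => biderivation_mem_gradedDer (p := p) (x := x)
    h.biderivation
  have hcomm : ∀ p, ∀ x ∈ grading 𝒜 M p,
      δ ∘ₗ br x - br x ∘ₗ δ ∈ gradedDer (grading 𝒜 M) (p + n) := by
    intro p x hx
    have := gradedDer_commutator hδ0 (hbr p x hx)
    rw [zero_mul, negOnePow_smul_even Even.zero] at this
    exact gradedDer_congr this (zero_add _)
  -- The commutator $[\delta,\{x,-\}]$ and $\{\delta x,-\}$ are both derivations. With $x$ a
  -- generator they are compared on generators through `hatMap_innerCoder`; for general $x$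
  -- antisymmetry reduces to this case.
  have hgen : ∀ p, ∀ a ∈ 𝒜 p, ∀ α, δ ∘ₗ br (gen 𝒜 M (a ⊗ₜ[K] α)) -
      br (gen 𝒜 M (a ⊗ₜ[K] α)) ∘ₗ δ = br (gen 𝒜 M (a ⊗ₜ[K] innerCoder φ α)) := by
    intro p a ha α
    refine gradedDer_ext (hcomm p _ (gen_mem_grading 𝒜 ha _))
      (hbr p _ (gen_mem_grading 𝒜 ha _)) fun q b hb β => ?_
    rw [LinearMap.sub_apply, LinearMap.comp_apply, LinearMap.comp_apply, hδ, coderAct_gen,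
      h.apply_gen, h.apply_gen, h.apply_gen, coderAct_pairEval, ← hv.hatMap_innerCoder,
      TensorProduct.tmul_add, map_add]
    abel
  have hhom : ∀ p, ∀ x ∈ grading 𝒜 M p, δ ∘ₗ br x - br x ∘ₗ δ = br (δ x) := by
    intro p x hx
    refine gradedDer_ext (hcomm p x hx) (hbr p _ (hδmem p x hx)) fun q b hb β => ?_
    have e := LinearMap.congr_fun (hgen q b hb β) x
    rw [LinearMap.sub_apply, LinearMap.comp_apply, LinearMap.comp_apply, sub_eq_iff_eq_add] at e ⊢
    rw [hδ, coderAct_gen, ← hδ,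
      h.biderivation.antisymm p q _ _ hx (gen_mem_grading 𝒜 hb β),
      h.biderivation.antisymm p q _ _ hx (gen_mem_grading 𝒜 hb _),
      h.biderivation.antisymm p q _ _ (hδmem p x hx) (gen_mem_grading 𝒜 hb β),
      map_neg, map_zsmul, e, smul_add, neg_add, add_comm]
  have hall : (LinearMap.llcomp K (RepAlg 𝒜 M) _ _ δ) ∘ₗ br - (LinearMap.lcomp K _ δ) ∘ₗ br =
      br ∘ₗ δ := linearMap_ext_homogeneous fun p x hx => hhom p x hx
  have := LinearMap.congr_fun (LinearMap.congr_fun hall x) y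
  exact sub_eq_iff_eq_add.1 this

theorem IsInducedBracket.apply_mem_invariants (h : IsInducedBracket 𝒜 n db v br)
    (hv : IsCyclicForm v) {x y : RepAlg 𝒜 M} (hx : x ∈ invariants 𝒜 M)
    (hy : y ∈ invariants 𝒜 M) : br x y ∈ invariants 𝒜 M := by
  intro φ
  rw [h.coderAct_bracket hv, hx φ, hy φ, map_zero, map_zero, LinearMap.zero_apply, add_zero]

theorem decompose_mem_invariants {x : RepAlg 𝒜 M} (hx : x ∈ invariants 𝒜 M) (i : ℤ) :
    (DirectSum.decompose (grading 𝒜 M) x i : RepAlg 𝒜 M) ∈ invariants 𝒜 M := by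
  intro φ
  rw [← decompose_apply_of_degree_zero (grading 𝒜 M) (grading 𝒜 M) _
    (fun p x hx => coderAct_mem_grading 𝒜 _ hx), hx φ]
  simp

section Map

variable {B : Type*} [Ring B] [Algebra K B] {ℬ : ℤ → Submodule K B} [GradedAlgebra ℬ]
  (p : 𝒜 →ₐᵍ[K] ℬ)

theorem map_mem_grading {i : ℤ} {x : RepAlg 𝒜 M} (hx : x ∈ grading 𝒜 M i) :
    map M p x ∈ grading ℬ M i := by
  refine homogeneous_induction (P := fun i x => map M p x ∈ grading ℬ M i)
    ?_ ?_ ?_ ?_ ?_ hx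
  · intro p; rw [map_zero]; exact zero_mem _
  · intro p x y hx hy; rw [map_add]; exact add_mem hx hy
  · intro p c x hx; rw [map_smul]; exact Submodule.smul_mem _ _ hx
  · rw [map_one]; exact SetLike.GradedOne.one_mem
  · intro i j a α y ha hy h
    rw [map_mul, map_gen]
    exact SetLike.mul_mem_graded (gen_mem_grading ℬ (p.map_mem ha) _) h

theorem decompose_map (x : RepAlg 𝒜 M) (i : ℤ) :
    (DirectSum.decompose (grading ℬ M) (map M p x) i : RepAlg ℬ M) =
      map M p (DirectSum.decompose (grading 𝒜 M) x i) :=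
  decompose_apply_of_degree_zero (grading 𝒜 M) (grading ℬ M) (map M p).toLinearMap
    (fun _ _ hx => map_mem_grading p hx) x i

/-- `p_M^+ (E)` is a graded subalgebra. -/
theorem decompose_mem_reduced {x : RepAlg ℬ M} (hx : x ∈ reduced M p) (i : ℤ) :
    (DirectSum.decompose (grading ℬ M) x i : RepAlg ℬ M) ∈ reduced M p := by
  obtain ⟨y, hy, rfl⟩ := hx
  exact ⟨_, decompose_mem_invariants hy i, (decompose_map p y i).symm⟩

/-- The degree $i$ component of any invariant preimage is again invariant, since $\delta_\varphi$
has degree zero, and is still a preimage. -/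
theorem exists_homogeneous_toReduced {i : ℤ} {x : reduced M p}
    (hx : x ∈ subalgebraGrading (grading ℬ M) (reduced M p) i) :
    ∃ y : invariants 𝒜 M, (y : RepAlg 𝒜 M) ∈ grading 𝒜 M i ∧ toReduced p y = x := by
  obtain ⟨x, y, hy, rfl⟩ := x
  refine ⟨⟨_, decompose_mem_invariants hy i⟩, (DirectSum.decompose (grading 𝒜 M) y i).2, ?_⟩
  ext
  exact (decompose_map p y i).symm.trans (DirectSum.decompose_of_mem_same (grading ℬ M) hx)

end Map

end RepAlg

/-! ### The Jacobi identity -/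

namespace RepAlg

variable {K : Type u} [CommRing K] {A : Type v} [Ring A] [Algebra K A]
  {𝒜 : ℤ → Submodule K A} {M : Type w} [AddCommGroup M] [Module K M] [Coalgebra K M]

theorem tripleEval_assoc (w : A ⊗[K] A) (c : A) (t : M ⊗[K] M) (γ : M) :
    tripleEval 𝒜 M (TensorProduct.assoc K A A A (w ⊗ₜ[K] c) ⊗ₜ[K]
      TensorProduct.assoc K M M M (t ⊗ₜ[K] γ)) =
      pairEval (gen 𝒜 M) (w ⊗ₜ[K] t) * gen 𝒜 M (c ⊗ₜ[K] γ) := by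
  induction w with
  | zero => simp
  | add w w' h h' => simp only [TensorProduct.add_tmul, map_add, h, h', add_mul]
  | tmul a b =>
    induction t with
    | zero => simp
    | add s t h h' =>
      simp only [TensorProduct.add_tmul, TensorProduct.tmul_add, map_add, h, h', add_mul]
    | tmul α β => simp [mul_assoc]

variable [GradedAlgebra 𝒜] {n : ℤ} {db : A ⊗[K] A →ₗ[K] A ⊗[K] A} {v : M ⊗[K] M →ₗ[K] K}
  {br : RepAlg 𝒜 M →ₗ[K] RepAlg 𝒜 M →ₗ[K] RepAlg 𝒜 M}

/-- In $a_\alpha D(b_\beta)$ the factors are commuted to bring $D$ to the front; the Leibniz sign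
cancels part of the commutation sign and leaves that of the ungraded-shift flip $P_{21}$. -/
theorem gradedDer_pairEval {k : ℤ} {D : RepAlg 𝒜 M →ₗ[K] RepAlg 𝒜 M}
    (hD : D ∈ gradedDer (grading 𝒜 M) k) (w : A ⊗[K] A) (t : M ⊗[K] M) :
    D (pairEval (gen 𝒜 M) (w ⊗ₜ[K] t)) = mixedEval (D ∘ₗ gen 𝒜 M) (gen 𝒜 M) (w ⊗ₜ[K] t) +
      mixedEval (D ∘ₗ gen 𝒜 M) (gen 𝒜 M) (gradedFlip 𝒜 0 w ⊗ₜ[K] TensorProduct.comm K M M t) := by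
  induction t with
  | zero => simp
  | add s t hs ht => simp only [map_add, TensorProduct.tmul_add, hs, ht]; abel
  | tmul α β =>
    have : D ∘ₗ pairEval (gen 𝒜 M) ∘ₗ (TensorProduct.mk K _ _).flip (α ⊗ₜ[K] β) =
        mixedEval (D ∘ₗ gen 𝒜 M) (gen 𝒜 M) ∘ₗ (TensorProduct.mk K _ _).flip (α ⊗ₜ[K] β) +
        mixedEval (D ∘ₗ gen 𝒜 M) (gen 𝒜 M) ∘ₗ (TensorProduct.mk K _ _).flip (β ⊗ₜ[K] α) ∘ₗ
          gradedFlip 𝒜 0 := by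
      refine tensor_linearMap_ext_homogeneous 𝒜 fun p q a ha b hb => ?_
      have e := mul_comm_graded (gen_mem_grading 𝒜 ha α)
        (gradedDer_apply_mem hD (gen_mem_grading 𝒜 hb β))
      simp only [LinearMap.comp_apply, LinearMap.add_apply, gradedFlip_tmul 𝒜 0 p q ha hb,
        map_zsmul, LinearMap.flip_apply, TensorProduct.mk_apply, pairEval_tmul, mixedEval_tmul,
        gradedDer_mul hD (gen_mem_grading 𝒜 ha α), e, negOnePow_smul_smul]
      congr 1
      exact negOnePow_smul_congr (by grind) _
    exact LinearMap.congr_fun this w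

theorem tripleEval_gradedPerm312 (W : A ⊗[K] (A ⊗[K] A)) (T : M ⊗[K] (M ⊗[K] M)) :
    tripleEval 𝒜 M (gradedPerm312 𝒜 0 W ⊗ₜ[K] T) = tripleEval 𝒜 M (W ⊗ₜ[K]
      TensorProduct.assoc K M M M (TensorProduct.comm K M (M ⊗[K] M) T)) := by
  induction T with
  | zero => simp
  | add s t hs ht => simp only [map_add, TensorProduct.tmul_add, hs, ht]
  | tmul α T =>
    induction T with
    | zero => simp
    | add s t hs ht => simp only [map_add, TensorProduct.tmul_add, hs, ht]
    | tmul β γ =>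
      induction W with
      | zero => simp
      | add s t hs ht => simp only [map_add, TensorProduct.add_tmul, hs, ht]
      | tmul a w =>
        induction a using DirectSum.Decomposition.inductionOn 𝒜 with
        | zero => simp
        | add a a' h h' => simp only [map_add, TensorProduct.add_tmul, h, h']
        | @homogeneous p a =>
          have : tripleEval 𝒜 M ∘ₗ (TensorProduct.mk K _ _).flip (α ⊗ₜ[K] (β ⊗ₜ[K] γ)) ∘ₗ
              gradedPerm312 𝒜 0 ∘ₗ TensorProduct.mk K A (A ⊗[K] A) a =
              tripleEval 𝒜 M ∘ₗ (TensorProduct.mk K _ _).flip (β ⊗ₜ[K] (γ ⊗ₜ[K] α)) ∘ₗ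
                TensorProduct.mk K A (A ⊗[K] A) a := by
            refine tensor_linearMap_ext_homogeneous 𝒜 fun q r b hb c hc => ?_
            have e := mul_comm_graded (SetLike.mul_mem_graded (gen_mem_grading 𝒜 a.2 β)
              (gen_mem_grading 𝒜 hb γ)) (gen_mem_grading 𝒜 hc α)
            simp only [LinearMap.comp_apply, TensorProduct.mk_apply, LinearMap.flip_apply,
              gradedPerm312_tmul 𝒜 0 p q r a.2 hb hc, map_zsmul, tripleEval_tmul, pairEval_tmul,
              ← mul_assoc, e, add_zero]
          exact LinearMap.congr_fun this w

section Jacobi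

variable (h : IsInducedBracket 𝒜 n db v br)

include h

omit [GradedAlgebra 𝒜] in
theorem IsInducedBracket.mixedEval_eq_tripleEval (a : A) (α : M) (w : A ⊗[K] A) (t : M ⊗[K] M) :
    mixedEval (br (gen 𝒜 M (a ⊗ₜ[K] α)) ∘ₗ gen 𝒜 M) (gen 𝒜 M) (w ⊗ₜ[K] t) =
      tripleEval 𝒜 M (TensorProduct.assoc K A A A (db.rTensor A
        ((TensorProduct.assoc K A A A).symm (a ⊗ₜ[K] w))) ⊗ₜ[K]
          TensorProduct.assoc K M M M ((TensorProduct.curry (hatMap v) α).rTensor M t)) := by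
  induction w with
  | zero => simp
  | add w w' hw hw' => simp only [TensorProduct.add_tmul, TensorProduct.tmul_add, map_add, hw, hw']
  | tmul x y =>
    induction t with
    | zero => simp
    | add s t hs ht => simp only [TensorProduct.tmul_add, map_add, hs, ht]
    | tmul μ ν =>
      simp only [TensorProduct.assoc_symm_tmul, LinearMap.rTensor_tmul, tripleEval_assoc,
        mixedEval_tmul, LinearMap.comp_apply, h.apply_gen, TensorProduct.curry_apply]

/-- The outer bracket may hit either factor of $\{b_\beta,c_\gamma\}$. The second case is the first
with $b$ and $c$ exchanged, by antisymmetry of the double bracket and cyclicity. -/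
theorem IsInducedBracket.bracket_bracket_gen (hdb : IsDoubleBracket 𝒜 n db) (hv : IsCyclicForm v)
    {p q r : ℤ} {a b c : A} (ha : a ∈ 𝒜 p) (hb : b ∈ 𝒜 q) (hc : c ∈ 𝒜 r) (α β γ : M) :
    br (gen 𝒜 M (a ⊗ₜ[K] α)) (br (gen 𝒜 M (b ⊗ₜ[K] β)) (gen 𝒜 M (c ⊗ₜ[K] γ))) =
      tripleEval 𝒜 M (doubleBracketIter db (a ⊗ₜ[K] (b ⊗ₜ[K] c)) ⊗ₜ[K] tripleHat v α β γ) -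
      (((q + n) * (r + n)).negOnePow : ℤ) •
        tripleEval 𝒜 M
          (doubleBracketIter db (a ⊗ₜ[K] (c ⊗ₜ[K] b)) ⊗ₜ[K] tripleHat v α γ β) := by
  have e : ∀ (b c : A) (β γ : M),
      tripleEval 𝒜 M (doubleBracketIter db (a ⊗ₜ[K] (b ⊗ₜ[K] c)) ⊗ₜ[K] tripleHat v α β γ) =
        mixedEval (br (gen 𝒜 M (a ⊗ₜ[K] α)) ∘ₗ gen 𝒜 M) (gen 𝒜 M)
          (db (b ⊗ₜ[K] c) ⊗ₜ[K] hatMap v (β ⊗ₜ[K] γ)) := by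
    intro b c β γ
    rw [h.mixedEval_eq_tripleEval]
    rfl
  rw [h.apply_gen, gradedDer_pairEval (biderivation_mem_gradedDer h.biderivation
    (gen_mem_grading 𝒜 ha α)), hdb.gradedFlip_apply hb hc, ← hv.hatMap_swap β γ, e, e,
    TensorProduct.neg_tmul, map_neg, map_zsmul_tmul, sub_eq_add_neg]

end Jacobi

/-- Each $P_{312}$ on $A^{\otimes3}$ is traded for a rotation of $M^{\otimes3}$, which
`tripleHat_rotate` turns into a rotation of $\alpha,\beta,\gamma$. -/
theorem tripleEval_tribracket (hv : IsCyclicForm v) {p q r : ℤ} {a b c : A}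
    (ha : a ∈ 𝒜 p) (hb : b ∈ 𝒜 q) (hc : c ∈ 𝒜 r) (α β γ : M) :
    tripleEval 𝒜 M (tribracket 𝒜 n db (a ⊗ₜ[K] (b ⊗ₜ[K] c)) ⊗ₜ[K] tripleHat v α β γ) =
      tripleEval 𝒜 M (doubleBracketIter db (a ⊗ₜ[K] (b ⊗ₜ[K] c)) ⊗ₜ[K] tripleHat v α β γ) +
      (((p + n) * ((q + n) + (r + n))).negOnePow : ℤ) •
        tripleEval 𝒜 M
          (doubleBracketIter db (b ⊗ₜ[K] (c ⊗ₜ[K] a)) ⊗ₜ[K] tripleHat v β γ α) +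
      (((p + n) * ((q + n) + (r + n)) + (q + n) * ((r + n) + (p + n))).negOnePow : ℤ) •
        tripleEval 𝒜 M
          (doubleBracketIter db (c ⊗ₜ[K] (a ⊗ₜ[K] b)) ⊗ₜ[K] tripleHat v γ α β) := by
  have h1 := gradedPerm231_tmul 𝒜 n p q r ha hb hc
  have h2 := gradedPerm231_tmul 𝒜 n q r p hb hc ha
  have e : tribracket 𝒜 n db (a ⊗ₜ[K] (b ⊗ₜ[K] c)) =
      doubleBracketIter db (a ⊗ₜ[K] (b ⊗ₜ[K] c)) +
      gradedPerm312 𝒜 0 (doubleBracketIter db (gradedPerm231 𝒜 n (a ⊗ₜ[K] (b ⊗ₜ[K] c)))) +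
      gradedPerm312 𝒜 0 (gradedPerm312 𝒜 0 (doubleBracketIter db
        (gradedPerm231 𝒜 n (gradedPerm231 𝒜 n (a ⊗ₜ[K] (b ⊗ₜ[K] c)))))) := by
    simp [tribracket, Finset.sum_range_succ, pow_succ]
  rw [e, TensorProduct.add_tmul, TensorProduct.add_tmul, map_add, map_add,
    tripleEval_gradedPerm312, tripleEval_gradedPerm312, tripleEval_gradedPerm312,
    hv.tripleHat_rotate, hv.tripleHat_rotate, h1, map_zsmul (gradedPerm231 𝒜 n), h2]
  simp only [map_zsmul, map_zsmul_tmul, negOnePow_smul_smul]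

/-- The left-hand side of the graded Jacobi identity. -/
def jacobiator (n : ℤ) (br : RepAlg 𝒜 M →ₗ[K] RepAlg 𝒜 M →ₗ[K] RepAlg 𝒜 M) (p q r : ℤ)
    (x y z : RepAlg 𝒜 M) : RepAlg 𝒜 M :=
  (((p + n) * (r + n)).negOnePow : ℤ) • br x (br y z) +
    (((q + n) * (p + n)).negOnePow : ℤ) • br y (br z x) +
    (((r + n) * (q + n)).negOnePow : ℤ) • br z (br x y)

omit [GradedAlgebra 𝒜] in
theorem jacobiator_rotate (p q r : ℤ) (x y z : RepAlg 𝒜 M) :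
    jacobiator n br q r p y z x = jacobiator n br p q r x y z := by
  exact (add_rotate _ _ _).symm

/-- Each double bracket in the Jacobi sum contributes two terms. The six terms group into the
tribracket at $(a,b,c)$ minus the one at $(a,c,b)$, up to sign. -/
theorem jacobiator_gen (h : IsInducedBracket 𝒜 n db v br) (hdb : IsDoubleGerstenhaber 𝒜 n db)
    (hv : IsCyclicForm v) {p q r : ℤ} {a b c : A} (ha : a ∈ 𝒜 p) (hb : b ∈ 𝒜 q) (hc : c ∈ 𝒜 r)
    (α β γ : M) : jacobiator n br p q r (gen 𝒜 M (a ⊗ₜ[K] α)) (gen 𝒜 M (b ⊗ₜ[K] β))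
      (gen 𝒜 M (c ⊗ₜ[K] γ)) = 0 := by
  have h1 := tripleEval_tribracket (n := n) (db := db) hv ha hb hc α β γ
  have h2 := tripleEval_tribracket (n := n) (db := db) hv ha hc hb α γ β
  rw [hdb.tribracket_eq_zero, LinearMap.zero_apply, TensorProduct.zero_tmul, map_zero] at h1 h2
  replace h1 := congrArg ((((p + n) * (r + n)).negOnePow : ℤ) • ·) h1
  replace h2 := congrArg ((((p + n) * (r + n) + (q + n) * (r + n)).negOnePow : ℤ) • ·) h2
  simp only [smul_zero, smul_add, negOnePow_smul_smul] at h1 h2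
  rw [negOnePow_smul_congr (j := (p + n) * (r + n) + (p + n) * (q + n + (r + n)))
      (k := (q + n) * (p + n)) (by grind),
    negOnePow_smul_congr (k := (r + n) * (q + n))
      (j := _ + ((p + n) * (q + n + (r + n)) + (q + n) * (r + n + (p + n)))) (by grind)] at h1
  rw [negOnePow_smul_congr (j := _ + (p + n) * (r + n + (q + n)))
      (k := (r + n) * (q + n) + (p + n) * (q + n)) (by grind),
    negOnePow_smul_congr (k := (q + n) * (p + n) + (r + n) * (p + n))
      (j := _ + ((p + n) * (r + n + (q + n)) + (r + n) * (q + n + (p + n)))) (by grind)] at h2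
  rw [jacobiator, h.bracket_bracket_gen hdb.toIsDoubleBracket hv ha hb hc,
    h.bracket_bracket_gen hdb.toIsDoubleBracket hv hb hc ha,
    h.bracket_bracket_gen hdb.toIsDoubleBracket hv hc ha hb]
  simp only [smul_sub, negOnePow_smul_smul]
  -- The zero on the right is replaced by the difference of the two tribracket relations.
  rw [← sub_zero (0 : RepAlg 𝒜 M)]
  nth_rw 1 [h1]
  rw [h2]
  abel

-- In this form the expression is, up to sign, a derivation applied to $z$: the graded commutator of
-- $\{x,-\}$ and $\{y,-\}$ minus $\{\{x,y\},-\}$.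
omit [GradedAlgebra 𝒜] in
theorem jacobiator_eq (h : IsGradedBiderivation (grading 𝒜 M) n br) {p q r : ℤ}
    {x y z : RepAlg 𝒜 M} (hx : x ∈ grading 𝒜 M p) (hy : y ∈ grading 𝒜 M q)
    (hz : z ∈ grading 𝒜 M r) : jacobiator n br p q r x y z =
      (((p + n) * (r + n)).negOnePow : ℤ) • ((br x ∘ₗ br y -
        (((p + n) * (q + n)).negOnePow : ℤ) • (br y ∘ₗ br x) - br (br x y)) z) := by
  rw [jacobiator, h.antisymm r p z x hz hx, h.antisymm r (p + q + n) z _ hz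
    (h.graded p q x y hx hy)]
  simp only [LinearMap.sub_apply, LinearMap.smul_apply, LinearMap.comp_apply, map_neg, map_zsmul,
    smul_neg, smul_sub, negOnePow_smul_smul]
  rw [sub_eq_add_neg, sub_eq_add_neg]
  congr 1
  · congr 2
    exact negOnePow_smul_congr (by grind) _
  · exact congrArg Neg.neg (negOnePow_smul_congr (by grind) _)

theorem jacobiator_eq_zero_of_gen (h : IsGradedBiderivation (grading 𝒜 M) n br) {p q : ℤ}
    {x y : RepAlg 𝒜 M} (hx : x ∈ grading 𝒜 M p) (hy : y ∈ grading 𝒜 M q)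
    (hgen : ∀ r, ∀ c ∈ 𝒜 r, ∀ γ, jacobiator n br p q r x y (gen 𝒜 M (c ⊗ₜ[K] γ)) = 0) {r : ℤ}
    {z : RepAlg 𝒜 M} (hz : z ∈ grading 𝒜 M r) : jacobiator n br p q r x y z = 0 := by
  have hbr := fun (p : ℤ) (x : RepAlg 𝒜 M) => biderivation_mem_gradedDer (p := p) (x := x) h
  have hxy := h.graded p q x y hx hy
  have e : br x ∘ₗ br y - (((p + n) * (q + n)).negOnePow : ℤ) • (br y ∘ₗ br x) - br (br x y) =
      0 := by
    refine gradedDer_ext (k := (p + n) + (q + n)) (sub_mem (gradedDer_commutator (hbr p x hx)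
      (hbr q y hy)) (gradedDer_congr (hbr _ _ hxy) (by ring))) (zero_mem _) fun r c hc γ => ?_
    have e' := congrArg ((((p + n) * (r + n)).negOnePow : ℤ) • ·)
      ((jacobiator_eq h hx hy (gen_mem_grading 𝒜 hc γ)).symm.trans (hgen r c hc γ))
    simp only [negOnePow_smul_smul, smul_zero] at e'
    rwa [negOnePow_smul_even (by grind)] at e'
  rw [jacobiator_eq h hx hy hz, e, LinearMap.zero_apply, smul_zero]

/-- The bracket induced by a double Gerstenhaber bracket is Gerstenhaber. -/
theorem IsInducedBracket.isGerstenhaber (h : IsInducedBracket 𝒜 n db v br)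
    (hdb : IsDoubleGerstenhaber 𝒜 n db) (hv : IsCyclicForm v) :
    IsGerstenhaber (grading 𝒜 M) n br := by
  have hb := h.biderivation
  refine ⟨hb, fun p q r x y z hx hy hz => ?_⟩
  refine jacobiator_eq_zero_of_gen hb hx hy (fun r c hc γ => ?_) hz
  -- Two rotations bring the next argument to the last place, so that it too can be taken to be a
  -- generator.
  rw [← jacobiator_rotate, ← jacobiator_rotate]
  refine jacobiator_eq_zero_of_gen hb (gen_mem_grading 𝒜 hc γ) hx (fun q b hb' β => ?_) hy
  rw [← jacobiator_rotate, ← jacobiator_rotate]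
  refine jacobiator_eq_zero_of_gen hb (gen_mem_grading 𝒜 hb' β) (gen_mem_grading 𝒜 hc γ)
    (fun p a ha α => ?_) hx
  exact jacobiator_gen h hdb hv hb' hc ha β γ α

end RepAlg

/-! ### Factoring linear and bilinear maps through a surjection -/

section Factorization

variable {K X Y Z : Type*} [CommRing K] [AddCommGroup X] [Module K X] [AddCommGroup Y] [Module K Y]
  [AddCommGroup Z] [Module K Z]

theorem exists_linearMap_factor {f : X →ₗ[K] Y} (hf : Function.Surjective f) (g : X →ₗ[K] Z)
    (h : ∀ x, f x = 0 → g x = 0) : ∃ g' : Y →ₗ[K] Z, ∀ x, g' (f x) = g x := by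
  refine ⟨(LinearMap.ker f).liftQ g h ∘ₗ (f.quotKerEquivOfSurjective hf).symm.toLinearMap,
    fun x => ?_⟩
  have : (f.quotKerEquivOfSurjective hf).symm (f x) = (LinearMap.ker f).mkQ x := by
    rw [LinearEquiv.symm_apply_eq]
    rfl
  rw [LinearMap.comp_apply, LinearEquiv.coe_coe, this]
  rfl

theorem exists_bilinearMap_factor {f : X →ₗ[K] Y} (hf : Function.Surjective f)
    (g : X →ₗ[K] X →ₗ[K] Z) (h₁ : ∀ x y, f x = 0 → g x y = 0) (h₂ : ∀ x y, f y = 0 → g x y = 0) :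
    ∃ g' : Y →ₗ[K] Y →ₗ[K] Z, ∀ x y, g' (f x) (f y) = g x y := by
  obtain ⟨g₁, hg₁⟩ := exists_linearMap_factor hf g fun x hx => LinearMap.ext fun y => h₁ x y hx
  obtain ⟨g₂, hg₂⟩ := exists_linearMap_factor hf g₁.flip fun y hy => LinearMap.ext fun z => by
    obtain ⟨x, rfl⟩ := hf z
    rw [LinearMap.flip_apply, hg₁, h₂ x y hy, LinearMap.zero_apply]
  exact ⟨g₂.flip, fun x y => by rw [LinearMap.flip_apply, hg₂, LinearMap.flip_apply, hg₁]⟩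

end Factorization

section SignTwist

variable {K : Type*} [CommRing K] {C : Type*} [Ring C] [Algebra K C]
  (𝒞 : ℤ → Submodule K C) [GradedAlgebra 𝒞]

/-- Linear maps of degree zero commute with sign twists. -/
theorem apply_signTwist_of_degree_zero {C' : Type*} [Ring C'] [Algebra K C']
    (𝒞' : ℤ → Submodule K C') [GradedAlgebra 𝒞'] (f : C →ₗ[K] C')
    (hf : ∀ p, ∀ x ∈ 𝒞 p, f x ∈ 𝒞' p) (k : ℤ) (x : C) :
    f (signTwist 𝒞 k x) = signTwist 𝒞' k (f x) := by
  induction x using DirectSum.Decomposition.inductionOn 𝒞 with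
  | zero => simp
  | homogeneous x =>
    rw [signTwist_apply 𝒞 _ _ x.2, signTwist_apply 𝒞' _ _ (hf _ _ x.2), map_zsmul]
  | add x y hx hy => simp only [map_add, hx, hy]

variable {𝒞}

/-- A Leibniz rule without homogeneity, needed for arbitrary elements of $\operatorname{Ker}p$. -/
theorem gradedDer_mul_signTwist {k : ℤ} {D : C →ₗ[K] C} (hD : D ∈ gradedDer 𝒞 k) (x y : C) :
    D (x * y) = D x * y + signTwist 𝒞 k x * D y := by
  induction x using DirectSum.Decomposition.inductionOn 𝒞 with
  | zero => simp
  | homogeneous x => rw [gradedDer_mul hD x.2, signTwist_apply 𝒞 _ _ x.2, smul_mul_assoc]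
  | add x x' hx hx' =>
    simp only [add_mul, map_add, hx, hx']
    abel

end SignTwist

/-! ### Hamiltonian reduction -/

namespace RepAlg

variable {K : Type u} [CommRing K] {A : Type v} [Ring A] [Algebra K A]
  {𝒜 : ℤ → Submodule K A} {M : Type w} [AddCommGroup M] [Module K M] [Coalgebra K M]

theorem pairEval_tmul_one (a : A) (t : M ⊗[K] M) :
    pairEval (gen 𝒜 M) ((a ⊗ₜ[K] (1 : A)) ⊗ₜ[K] t) =
      gen 𝒜 M (a ⊗ₜ[K] TensorProduct.rid K M (Coalgebra.counit.lTensor M t)) := by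
  induction t with
  | zero => simp
  | tmul α β => simp [gen_one, Algebra.algebraMap_eq_smul_one]
  | add s t hs ht => simp only [TensorProduct.tmul_add, map_add, hs, ht]

theorem pairEval_one_tmul (a : A) (t : M ⊗[K] M) :
    pairEval (gen 𝒜 M) (((1 : A) ⊗ₜ[K] a) ⊗ₜ[K] t) =
      gen 𝒜 M (a ⊗ₜ[K] TensorProduct.lid K M (Coalgebra.counit.rTensor M t)) := by
  induction t with
  | zero => simp
  | tmul α β => simp [gen_one, Algebra.algebraMap_eq_smul_one]
  | add s t hs ht => simp only [TensorProduct.tmul_add, map_add, hs, ht]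

variable [GradedAlgebra 𝒜] {n : ℤ} {db : A ⊗[K] A →ₗ[K] A ⊗[K] A} {v : M ⊗[K] M →ₗ[K] K}
  {br : RepAlg 𝒜 M →ₗ[K] RepAlg 𝒜 M →ₗ[K] RepAlg 𝒜 M}
  {B : Type*} [Ring B] [Algebra K B] {ℬ : ℤ → Submodule K B} [GradedAlgebra ℬ] {p : 𝒜 →ₐᵍ[K] ℬ}

theorem map_pairEval_eq_zero {w : A ⊗[K] A}
    (hw : w ∈ LinearMap.range ((LinearMap.ker p.toAlgHom.toLinearMap).subtype.lTensor A) ⊔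
      LinearMap.range ((LinearMap.ker p.toAlgHom.toLinearMap).subtype.rTensor A))
    (t : M ⊗[K] M) : map M p (pairEval (gen 𝒜 M) (w ⊗ₜ[K] t)) = 0 := by
  have hgen : ∀ x ∈ LinearMap.ker p.toAlgHom.toLinearMap, ∀ α : M,
      map M p (gen 𝒜 M (x ⊗ₜ[K] α)) = 0 := by
    intro x hx α
    have hx' : p x = 0 := hx
    rw [map_gen, hx', TensorProduct.zero_tmul, map_zero]
  let F : A ⊗[K] A →ₗ[K] RepAlg ℬ M := (map M p).toLinearMap ∘ₗ pairEval (gen 𝒜 M) ∘ₗ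
    (TensorProduct.mk K _ _).flip t
  change w ∈ LinearMap.ker F
  refine (sup_le ?_ ?_ : _ ≤ LinearMap.ker F) hw
  · rw [LinearMap.range_le_ker_iff]
    ext a x
    change map M p (pairEval (gen 𝒜 M) ((a ⊗ₜ[K] (x : A)) ⊗ₜ[K] t)) = 0
    induction t with
    | zero => simp
    | tmul α β => rw [pairEval_tmul, map_mul, hgen _ x.2, mul_zero]
    | add s t hs ht => rw [TensorProduct.tmul_add, map_add, map_add, hs, ht, add_zero]
  · rw [LinearMap.range_le_ker_iff]
    ext x a
    change map M p (pairEval (gen 𝒜 M) (((x : A) ⊗ₜ[K] a) ⊗ₜ[K] t)) = 0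
    induction t with
    | zero => simp
    | tmul α β => rw [pairEval_tmul, map_mul, hgen _ x.2, zero_mul]
    | add s t hs ht => rw [TensorProduct.tmul_add, map_add, map_add, hs, ht, add_zero]

/-- Modulo the kernel of `p_M^+`, the Hamiltonian vector fields of the moment generators are
inner coderivations. -/
theorem IsInducedBracket.map_moment (h : IsInducedBracket 𝒜 n db v br) {ξ : A} (hξ : ξ ∈ 𝒜 (-n))
    {k : K} (hk : ∀ a : A, db (ξ ⊗ₜ[K] a) - k • (a ⊗ₜ[K] (1 : A) - (1 : A) ⊗ₜ[K] a) ∈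
        LinearMap.range ((LinearMap.ker p.toAlgHom.toLinearMap).subtype.lTensor A) ⊔
          LinearMap.range ((LinearMap.ker p.toAlgHom.toLinearMap).subtype.rTensor A))
    (α : M) (y : RepAlg 𝒜 M) : map M p (br (gen 𝒜 M (ξ ⊗ₜ[K] α)) y) =
      k • map M p (coderAct 𝒜 (innerCoder (TensorProduct.curry v α))
        (isCoderivation_innerCoder _) y) := by
  set δ := coderAct 𝒜 (innerCoder (TensorProduct.curry v α)) (isCoderivation_innerCoder _) with hδ
  have hD : br (gen 𝒜 M (ξ ⊗ₜ[K] α)) - k • δ ∈ gradedDer (grading 𝒜 M) 0 :=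
    sub_mem (gradedDer_congr (biderivation_mem_gradedDer h.biderivation (gen_mem_grading 𝒜 hξ α))
      (neg_add_cancel n)) (Submodule.smul_mem _ _ (coderAct_mem_gradedDer 𝒜 _))
  have e : (map M p).toLinearMap ∘ₗ (br (gen 𝒜 M (ξ ⊗ₜ[K] α)) - k • δ) = 0 := by
    refine eq_zero_of_leibniz (map M p) 0 _ (fun i x hx z => ?_) (fun i a _ β => ?_)
    · simp only [LinearMap.comp_apply, AlgHom.toLinearMap_apply]
      rw [gradedDer_mul hD hx, map_add, map_zsmul, map_mul, map_mul]
    -- The tensor $a\otimes1-1\otimes a$ evaluates to $a$ at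
    -- $v(\alpha\otimes\beta^2)\beta^1-v(\alpha\otimes\beta^1)\beta^2$, the inner coderivation of
    -- $v(\alpha\otimes-)$ applied to $\beta$.
    · have e1 := map_pairEval_eq_zero (hk a) (hatMap v (α ⊗ₜ[K] β))
      rw [TensorProduct.sub_tmul, map_sub, ← TensorProduct.smul_tmul', map_smul,
        TensorProduct.sub_tmul, map_sub, map_sub, pairEval_tmul_one, pairEval_one_tmul,
        rid_counit_hatMap, lid_counit_hatMap, ← map_sub (gen 𝒜 M), ← TensorProduct.tmul_sub,
        ← LinearMap.sub_apply, ← innerCoder_eq, ← h.apply_gen, ← coderAct_gen 𝒜 _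
        (isCoderivation_innerCoder _), ← map_sub] at e1
      exact e1
  have := LinearMap.congr_fun e y
  rw [LinearMap.comp_apply, LinearMap.sub_apply, map_sub, LinearMap.zero_apply, sub_eq_zero,
    LinearMap.smul_apply, map_smul] at this
  exact this

section Descent

variable {S : Set A} (hS : ∀ ξ ∈ S, ξ ∈ 𝒜 (-n)) (hker : TwoSidedIdeal.ker p = TwoSidedIdeal.span S)
  (hmod : ∀ ξ ∈ S, ∃ k : K, ∀ a : A,
      db (ξ ⊗ₜ[K] a) - k • (a ⊗ₜ[K] (1 : A) - (1 : A) ⊗ₜ[K] a) ∈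
        LinearMap.range ((LinearMap.ker p.toAlgHom.toLinearMap).subtype.lTensor A) ⊔
          LinearMap.range ((LinearMap.ker p.toAlgHom.toLinearMap).subtype.rTensor A))

include hS hker hmod

/-- The property holds for the generators of $\operatorname{Ker}p$ by the moment condition, and by
the Leibniz rule it is stable under multiplication by elements of $A$. -/
theorem IsInducedBracket.map_bracket_gen_eq_zero (h : IsInducedBracket 𝒜 n db v br) {q : ℤ}
    {y : RepAlg 𝒜 M} (hy : y ∈ grading 𝒜 M q) (hyE : y ∈ invariants 𝒜 M) {a : A} (ha : p a = 0)
    (β : M) : map M p (br y (gen 𝒜 M (a ⊗ₜ[K] β))) = 0 := by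
  have hD := biderivation_mem_gradedDer h.biderivation hy
  have hgen : ∀ a, p a = 0 → ∀ β : M, map M p (gen 𝒜 M (a ⊗ₜ[K] β)) = 0 := by
    intro a ha β
    rw [map_gen, ha, TensorProduct.zero_tmul, map_zero]
  have hsign : ∀ a, p a = 0 → ∀ β : M,
      map M p (signTwist (grading 𝒜 M) (q + n) (gen 𝒜 M (a ⊗ₜ[K] β))) = 0 := by
    intro a ha β
    refine (apply_signTwist_of_degree_zero (grading 𝒜 M) (grading ℬ M) (map M p).toLinearMap
      (fun _ _ hx => map_mem_grading p hx) (q + n) _).trans ?_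
    rw [AlgHom.toLinearMap_apply, hgen a ha, map_zero]
  -- Membership in $\operatorname{Ker}p$ is part of the condition: it kills the Leibniz term in
  -- which $y$ brackets with the other factor.
  let I : TwoSidedIdeal A := TwoSidedIdeal.mk'
    {a | p a = 0 ∧ ∀ β : M, map M p (br y (gen 𝒜 M (a ⊗ₜ[K] β))) = 0}
    (by simp)
    (by
      rintro a b ⟨ha, ha'⟩ ⟨hb, hb'⟩
      refine ⟨by rw [map_add, ha, hb, add_zero], fun β => ?_⟩
      rw [TensorProduct.add_tmul, map_add, map_add, map_add, ha', hb', add_zero])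
    (by
      rintro a ⟨ha, ha'⟩
      refine ⟨by rw [map_neg, ha, neg_zero], fun β => ?_⟩
      rw [TensorProduct.neg_tmul, map_neg, map_neg, map_neg, ha', neg_zero])
    (by
      rintro x a ⟨ha, ha'⟩
      refine ⟨by rw [map_mul, ha, mul_zero], fun β => ?_⟩
      rw [gen_mul]
      generalize Coalgebra.comul (R := K) β = t
      induction t with
      | zero => simp
      | add s t hs ht => rw [TensorProduct.tmul_add, map_add, map_add, map_add, hs, ht, add_zero]
      | tmul μ ν =>
        rw [pairEval_tmul, gradedDer_mul_signTwist hD, map_add, map_mul, map_mul, hgen a ha, ha',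
          mul_zero, mul_zero, add_zero])
    (by
      rintro a x ⟨ha, ha'⟩
      refine ⟨by rw [map_mul, ha, zero_mul], fun β => ?_⟩
      rw [gen_mul]
      generalize Coalgebra.comul (R := K) β = t
      induction t with
      | zero => simp
      | add s t hs ht => rw [TensorProduct.tmul_add, map_add, map_add, map_add, hs, ht, add_zero]
      | tmul μ ν =>
        rw [pairEval_tmul, gradedDer_mul_signTwist hD, map_add, map_mul, map_mul, hsign a ha, ha',
          zero_mul, zero_mul, add_zero])
  have hI : ∀ a, a ∈ I ↔ p a = 0 ∧ ∀ β : M, map M p (br y (gen 𝒜 M (a ⊗ₜ[K] β))) = 0 :=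
    fun a => TwoSidedIdeal.mem_mk' _ _ _ _ _ _ a
  have hle : TwoSidedIdeal.span S ≤ I := by
    rw [TwoSidedIdeal.span_le]
    intro ξ hξ
    refine (hI ξ).2 ⟨?_, fun α => ?_⟩
    · have : ξ ∈ TwoSidedIdeal.ker p := hker ▸ TwoSidedIdeal.subset_span hξ
      exact (TwoSidedIdeal.mem_ker p).1 this
    · obtain ⟨k, hk⟩ := hmod ξ hξ
      -- The only use of invariance: $\{\xi_\alpha,y\}$ maps to $k\,p_M^+(\delta_\varphi y)=0$.
      rw [h.biderivation.antisymm q (-n) _ _ hy (gen_mem_grading 𝒜 (hS ξ hξ) α), map_neg, map_zsmul,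
        h.map_moment (hS ξ hξ) hk, hyE, map_zero, smul_zero, smul_zero, neg_zero]
  have haI : a ∈ TwoSidedIdeal.span S := hker ▸ (TwoSidedIdeal.mem_ker p).2 ha
  exact ((hI a).1 (hle haI)).2 β

/-- Hamiltonian vector fields of homogeneous invariants descend along `p_M^+`. -/
theorem IsInducedBracket.exists_hamiltonian_descent (hp : Function.Surjective p)
    (h : IsInducedBracket 𝒜 n db v br) {q : ℤ}
    {y : RepAlg 𝒜 M} (hy : y ∈ grading 𝒜 M q) (hyE : y ∈ invariants 𝒜 M) :
    ∃ D : RepAlg ℬ M →ₗ[K] RepAlg ℬ M, ∀ x, D (map M p x) = map M p (br y x) := by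
  have hD := biderivation_mem_gradedDer h.biderivation hy
  -- By the preceding lemma $p_M^+\{y,a_\alpha\}$ depends only on $p(a)$, which prescribes a
  -- derivation of $B_M^+$ on generators.
  obtain ⟨g, hg⟩ := exists_linearMap_factor (f := p.toAlgHom.toLinearMap) hp
    (TensorProduct.curry ((map M p).toLinearMap ∘ₗ br y ∘ₗ gen 𝒜 M)) fun a ha =>
      LinearMap.ext fun β => h.map_bracket_gen_eq_zero hS hker hmod hy hyE ha β
  have hf : ∀ a α, TensorProduct.lift g (p a ⊗ₜ[K] α) =
      map M p (br y (gen 𝒜 M (a ⊗ₜ[K] α))) := by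
    intro a α
    rw [TensorProduct.lift.tmul]
    exact LinearMap.congr_fun (hg a) α
  -- Homogeneous lifts let the degree and Leibniz conditions be inherited from $\{y,-\}$.
  have hlift : ∀ i, ∀ b ∈ ℬ i, ∃ a ∈ 𝒜 i, p a = b := by
    intro i b hb
    obtain ⟨a, rfl⟩ := hp b
    refine ⟨DirectSum.decompose 𝒜 a i, (DirectSum.decompose 𝒜 a i).2, ?_⟩
    exact (decompose_apply_of_degree_zero 𝒜 ℬ p.toAlgHom.toLinearMap (fun _ _ hx => p.map_mem hx)
      a i).symm.trans (DirectSum.decompose_of_mem_same ℬ hb)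
  obtain ⟨D, hD', hDgen⟩ := exists_gradedDer (𝒜 := ℬ) (q + n) (TensorProduct.lift g)
    (by
      intro i b hb α
      obtain ⟨a, ha, rfl⟩ := hlift i b hb
      rw [hf]
      exact map_mem_grading p (gradedDer_apply_mem hD (gen_mem_grading 𝒜 ha α)))
    (by
      intro i j b hb c hc α
      obtain ⟨b, hb', rfl⟩ := hlift i b hb
      obtain ⟨c, hc', rfl⟩ := hlift j c hc
      rw [← map_mul, hf, gen_mul]
      generalize Coalgebra.comul (R := K) α = t
      induction t with
      | zero => simp
      | add s t hs ht =>
        simp only [TensorProduct.tmul_add, map_add, hs, ht, smul_add]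
        abel
      | tmul μ ν =>
        rw [pairEval_tmul, mixedEval_tmul, mixedEval_tmul, hf, hf,
          gradedDer_mul hD (gen_mem_grading 𝒜 hb' μ), map_add, map_zsmul, map_mul, map_mul,
          map_gen, map_gen])
  refine ⟨D, fun x => ?_⟩
  have e : D ∘ₗ (map M p).toLinearMap - (map M p).toLinearMap ∘ₗ br y = 0 := by
    refine eq_zero_of_leibniz (map M p) (q + n) _ (fun i x hx z => ?_) (fun i a _ β => ?_)
    · simp only [LinearMap.sub_apply, LinearMap.comp_apply, AlgHom.toLinearMap_apply]
      rw [gradedDer_mul hD hx, map_mul, gradedDer_mul hD' (map_mem_grading p hx), map_add,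
        map_zsmul, map_mul, map_mul, sub_mul, mul_sub, smul_sub]
      abel
    · simp only [LinearMap.sub_apply, LinearMap.comp_apply, AlgHom.toLinearMap_apply]
      rw [map_gen, hDgen, hf, sub_self]
  exact sub_eq_zero.1 (LinearMap.congr_fun e x)

/-- For homogeneous $y$ the image of $\{y,x\}$ is $D(p_M^+(x))$ for a linear $D$; the general case
follows because $E$ is homogeneous. Here $x$ need not be invariant. -/
theorem IsInducedBracket.map_bracket_right_eq_zero (hp : Function.Surjective p)
    (h : IsInducedBracket 𝒜 n db v br) {x y : RepAlg 𝒜 M} (hy : y ∈ invariants 𝒜 M)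
    (hx : map M p x = 0) : map M p (br y x) = 0 := by
  refine homogeneous_submodule_induction (grading 𝒜 M)
    (E := Subalgebra.toSubmodule (invariants 𝒜 M)) (fun x hx i => decompose_mem_invariants hx i)
    (P := fun y => map M p (br y x) = 0) (by simp) (fun y z hy hz => ?_) hy
    (fun q y hy hyE => ?_)
  · rw [map_add, LinearMap.add_apply, map_add, hy, hz, add_zero]
  · obtain ⟨D, hD⟩ := h.exists_hamiltonian_descent hS hker hmod hp hy hyE
    rw [← hD, hx, map_zero]

/-- Antisymmetry reduces this to the other slot, after splitting both arguments into components;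
those of $x$ stay in $E$ and in the kernel of $p_M^+$. -/
theorem IsInducedBracket.map_bracket_left_eq_zero (hp : Function.Surjective p)
    (h : IsInducedBracket 𝒜 n db v br) {x y : RepAlg 𝒜 M} (hxE : x ∈ invariants 𝒜 M)
    (hy : y ∈ invariants 𝒜 M) (hx : map M p x = 0) : map M p (br x y) = 0 := by
  refine homogeneous_submodule_induction (grading 𝒜 M)
    (E := Subalgebra.toSubmodule (invariants 𝒜 M) ⊓ LinearMap.ker (map M p).toLinearMap)
    (fun x hx i => ⟨decompose_mem_invariants hx.1 i, ?_⟩)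
    (P := fun x => map M p (br x y) = 0) (by simp) (fun x z hx hz => ?_) ⟨hxE, hx⟩
    (fun i x hxi hx => ?_)
  · have e : map M p x = 0 := hx.2
    change map M p _ = 0
    rw [← decompose_map, e]
    simp
  · rw [map_add, LinearMap.add_apply, map_add, hx, hz, add_zero]
  · refine homogeneous_submodule_induction (grading 𝒜 M)
      (E := Subalgebra.toSubmodule (invariants 𝒜 M)) (fun x hx i => decompose_mem_invariants hx i)
      (P := fun y => map M p (br x y) = 0) (by simp) (fun y z hy hz => ?_) hy
      (fun q y hyq hyE => ?_)
    · rw [map_add, map_add, hy, hz, add_zero]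
    · rw [h.biderivation.antisymm i q x y hxi hyq, map_neg, map_zsmul,
        h.map_bracket_right_eq_zero hS hker hmod hp hyE hx.2, smul_zero, neg_zero]

/-- The bracket in `E` descends along `p_M^+`. -/
theorem IsInducedBracket.exists_descends (hp : Function.Surjective p) (hv : IsCyclicForm v)
    (h : IsInducedBracket 𝒜 n db v br) :
    ∃ br' : reduced M p →ₗ[K] reduced M p →ₗ[K] reduced M p, Descends p br br' := by
  let f : invariants 𝒜 M →ₗ[K] reduced M p :=
    ((map M p).toLinearMap ∘ₗ (invariants 𝒜 M).val.toLinearMap).codRestrict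
      (Subalgebra.toSubmodule (reduced M p)) fun x => ⟨x, x.2, rfl⟩
  have hf : Function.Surjective f := by
    rintro ⟨_, x, hx, rfl⟩
    exact ⟨⟨x, hx⟩, rfl⟩
  let g : invariants 𝒜 M →ₗ[K] invariants 𝒜 M →ₗ[K] reduced M p :=
    LinearMap.mk₂ K (fun x y => f ⟨br x y, h.apply_mem_invariants hv x.2 y.2⟩)
      (fun x y z => by rw [← map_add]; congr 1; ext; simp)
      (fun c x y => by rw [← map_smul]; congr 1; ext; simp)
      (fun x y z => by rw [← map_add]; congr 1; ext; simp)
      (fun c x y => by rw [← map_smul]; congr 1; ext; simp)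
  obtain ⟨br', hbr'⟩ := exists_bilinearMap_factor hf g
    (fun x y hx => Subtype.ext (h.map_bracket_left_eq_zero hS hker hmod hp x.2 y.2
      (congrArg Subtype.val hx)))
    (fun x y hy => Subtype.ext (h.map_bracket_right_eq_zero hS hker hmod hp x.2
      (congrArg Subtype.val hy)))
  exact ⟨br', fun x y => congrArg Subtype.val (hbr' x y)⟩

end Descent

theorem toReduced_surjective (p : 𝒜 →ₐᵍ[K] ℬ) :
    Function.Surjective (toReduced (M := M) p) := by
  rintro ⟨_, x, hx, rfl⟩
  exact ⟨⟨x, hx⟩, rfl⟩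

variable {br' : reduced M p →ₗ[K] reduced M p →ₗ[K] reduced M p}

theorem Descends.unique (h : Descends p br br')
    {br₁ : reduced M p →ₗ[K] reduced M p →ₗ[K] reduced M p} (h₁ : Descends p br br₁) :
    br₁ = br' := by
  refine LinearMap.ext₂ fun x y => ?_
  obtain ⟨x, rfl⟩ := toReduced_surjective p x
  obtain ⟨y, rfl⟩ := toReduced_surjective p y
  exact Subtype.ext ((h₁ x y).trans (h x y).symm)

/-- The bracket obtained by descent from a biderivation is a biderivation. -/
theorem Descends.isGradedBiderivation (h : Descends p br br')
    (hbr : IsGradedBiderivation (grading 𝒜 M) n br) :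
    IsGradedBiderivation (subalgebraGrading (grading ℬ M) (reduced M p)) n br' where
  graded i j x y hx hy := by
    obtain ⟨x, hx', rfl⟩ := exists_homogeneous_toReduced p hx
    obtain ⟨y, hy', rfl⟩ := exists_homogeneous_toReduced p hy
    change (br' _ _ : RepAlg ℬ M) ∈ grading ℬ M _
    rw [h x y]
    exact map_mem_grading p (hbr.graded i j _ _ hx' hy')
  leibniz_right i j k x y z hx hy hz := by
    obtain ⟨x, hx', rfl⟩ := exists_homogeneous_toReduced p hx
    obtain ⟨y, hy', rfl⟩ := exists_homogeneous_toReduced p hy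
    obtain ⟨z, hz', rfl⟩ := exists_homogeneous_toReduced p hz
    have e : toReduced p y * toReduced p z = toReduced p (y * z) :=
      Subtype.ext (map_mul (map M p) (y : RepAlg 𝒜 M) z).symm
    ext
    push_cast
    rw [e, h, h, h, Subalgebra.coe_mul, hbr.leibniz_right i j k _ _ _ hx' hy' hz', map_add, map_zsmul,
      map_mul, map_mul]
    rfl
  leibniz_left i j k x y z hx hy hz := by
    obtain ⟨x, hx', rfl⟩ := exists_homogeneous_toReduced p hx
    obtain ⟨y, hy', rfl⟩ := exists_homogeneous_toReduced p hy
    obtain ⟨z, hz', rfl⟩ := exists_homogeneous_toReduced p hz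
    have e : toReduced p x * toReduced p y = toReduced p (x * y) :=
      Subtype.ext (map_mul (map M p) (x : RepAlg 𝒜 M) y).symm
    ext
    push_cast
    rw [e, h, h, h, Subalgebra.coe_mul, hbr.leibniz_left i j k _ _ _ hx' hy' hz', map_add, map_zsmul,
      map_mul, map_mul]
    rfl
  antisymm i j x y hx hy := by
    obtain ⟨x, hx', rfl⟩ := exists_homogeneous_toReduced p hx
    obtain ⟨y, hy', rfl⟩ := exists_homogeneous_toReduced p hy
    ext
    push_cast
    rw [h, h, hbr.antisymm i j _ _ hx' hy', map_neg, map_zsmul]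

/-- The bracket obtained by descent from a Gerstenhaber bracket is Gerstenhaber. -/
theorem Descends.isGerstenhaber (h : Descends p br br')
    (hE : ∀ x ∈ invariants 𝒜 M, ∀ y ∈ invariants 𝒜 M, br x y ∈ invariants 𝒜 M)
    (hbr : IsGerstenhaber (grading 𝒜 M) n br) :
    IsGerstenhaber (subalgebraGrading (grading ℬ M) (reduced M p)) n br' where
  toIsGradedBiderivation := h.isGradedBiderivation hbr.toIsGradedBiderivation
  jacobi i j k x y z hx hy hz := by
    obtain ⟨x, hx', rfl⟩ := exists_homogeneous_toReduced p hx
    obtain ⟨y, hy', rfl⟩ := exists_homogeneous_toReduced p hy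
    obtain ⟨z, hz', rfl⟩ := exists_homogeneous_toReduced p hz
    have e : ∀ x y : invariants 𝒜 M, br' (toReduced p x) (toReduced p y) =
        toReduced p ⟨br x y, hE x x.2 y y.2⟩ := fun x y => Subtype.ext (h x y)
    ext
    push_cast
    rw [e y z, e z x, e x y, h, h, h]
    have hJ := congrArg (map M p) (hbr.jacobi i j k _ _ _ hx' hy' hz')
    rw [map_add, map_add, map_zsmul, map_zsmul, map_zsmul, map_zero] at hJ
    exact hJ

end RepAlg

end

theorem mainTheorem5 {K : Type*} [CommRing K]
    {A : Type*} [Ring A] [Algebra K A] (𝒜 : ℤ → Submodule K A) [GradedAlgebra 𝒜]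
    {B : Type*} [Ring B] [Algebra K B] (ℬ : ℤ → Submodule K B) [GradedAlgebra ℬ]
    {M : Type*} [AddCommGroup M] [Module K M] [Coalgebra K M]
    (n : ℤ) (db : A ⊗[K] A →ₗ[K] A ⊗[K] A) (hdb : IsDoubleBracket 𝒜 n db)
    (v : M ⊗[K] M →ₗ[K] K) (hv : IsCyclicForm v)
    (p : 𝒜 →ₐᵍ[K] ℬ) (hp : Function.Surjective p)
    (S : Set A) (hS : ∀ ξ ∈ S, ξ ∈ 𝒜 (-n))
    (hker : TwoSidedIdeal.ker p = TwoSidedIdeal.span S)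
    (hmod : ∀ ξ ∈ S, ∃ k : K, ∀ a : A,
      db (ξ ⊗ₜ[K] a) - k • (a ⊗ₜ[K] (1 : A) - (1 : A) ⊗ₜ[K] a) ∈
        LinearMap.range ((LinearMap.ker p.toAlgHom.toLinearMap).subtype.lTensor A) ⊔
          LinearMap.range ((LinearMap.ker p.toAlgHom.toLinearMap).subtype.rTensor A)) :
    -- the bracket `{-,-}_v^+` in `A_M^+` exists, is unique, and restricts to `E`
    ∃ br : RepAlg 𝒜 M →ₗ[K] RepAlg 𝒜 M →ₗ[K] RepAlg 𝒜 M,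
      RepAlg.IsInducedBracket 𝒜 n db v br ∧
      (∀ br₁, RepAlg.IsInducedBracket 𝒜 n db v br₁ → br₁ = br) ∧
      (∀ x ∈ RepAlg.invariants 𝒜 M, ∀ y ∈ RepAlg.invariants 𝒜 M,
        br x y ∈ RepAlg.invariants 𝒜 M) ∧
      -- `p_M^+ (E)` is a graded subalgebra of `B_M^+`
      DirectSum.IsInternal (subalgebraGrading (RepAlg.grading ℬ M) (RepAlg.reduced M p)) ∧
      -- the bracket in `E` descends uniquely to a biderivation in `p_M^+ (E)`
      ∃ br' : RepAlg.reduced M p →ₗ[K] RepAlg.reduced M p →ₗ[K] RepAlg.reduced M p,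
        RepAlg.Descends p br br' ∧
        (∀ br₁, RepAlg.Descends p br br₁ → br₁ = br') ∧
        IsGradedBiderivation
          (subalgebraGrading (RepAlg.grading ℬ M) (RepAlg.reduced M p)) n br' ∧
        (IsDoubleGerstenhaber 𝒜 n db →
          IsGerstenhaber
            (subalgebraGrading (RepAlg.grading ℬ M) (RepAlg.reduced M p)) n br') := by
  obtain ⟨br, h⟩ := RepAlg.exists_isInducedBracket hdb hv
  obtain ⟨br', h'⟩ := h.exists_descends hS hker hmod hp hv
  exact ⟨br, h, fun _ => h.unique, fun _ hx _ hy => h.apply_mem_invariants hv hx hy,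
    isInternal_subalgebraGrading _ _ fun _ hx => RepAlg.decompose_mem_reduced p hx,
    br', h', fun _ => h'.unique, h'.isGradedBiderivation h.biderivation,
    fun hG => h'.isGerstenhaber (fun _ hx _ hy => h.apply_mem_invariants hv hx hy)
      (h.isGerstenhaber hG hv)⟩
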